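/- Let $\mathbb F$ be a field of prime characteristic $p\neq 2$. All Lie superalgebras $L=L_{\bar 0}\oplus L_{\bar 1}$ and modules are finite dimensional and $\mathbb Z_2$-graded, $d(x)$ denotes the parity of a homogeneous element $x$, and if $p=3$ the definition of a Lie superalgebra includes $[x,[x,x]]=0$ for $x\in L_{\bar 1}$. Let $L=\bigoplus_{i\in\mathbb Z}L_i$ be a $\mathbb Z$-graded Lie superalgebra over $\mathbb F$ (each $L_i$ being a $\mathbb Z_2$-graded subspace), $L^{+}=\bigoplus_{i>0}L_i$, $L^-=\bigoplus_{i<0}L_i$ and $K=L_0\oplus L^+$. Let $e_1,\dots,e_k$ be a basis of $L^-\cap L_{\bar 0}$ consisting of $\mathbb Z$-homogeneous elements, and let $m_1,\dots,m_k\ge 0$ be integers such that $z_i:=e_i^{p^{m_i}}$ lies in the centre of the universal enveloping algebra $U(L)$ for all $i$. Let $\theta=\theta(L,K)$ be the subalgebra of $U(L)$ generated by $K$ and $z_1,\dots,z_k$. For $x\in K$ let $\sigma(x)$ be the supertrace of the endomorphism of $L/K$ induced by $\operatorname{ad}x$. Let $V$ be an $L_0$-module, regarded as a $K$-module by letting $L^+$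 act by zero. Let $V_\sigma$ be the space $V$ with the twisted $K$-action $x\circ v=x\cdot v+\sigma(x)v$, made into a $\theta$-module by letting every $z_i$ act by zero, and let $\mathrm{Ind}_K(V_\sigma)=U(L)\otimes_\theta V_\sigma$, an $L$-module under left multiplication. The dual $W^*$ of a module $W$ carries the action $(x\cdot f)(w)=-(-1)^{d(x)d(f)}f(x\cdot w)$. A module homomorphism is a linear map $f$, homogeneous of parity $d(f)\in\mathbb Z_2$, with $x\cdot f(v)=(-1)^{d(x)d(f)}f(x\cdot v)$; an isomorphism is a bijective homomorphism. Then the following are equivalent. 1. There is a nondegenerate invariant bilinear form $\lambda$ on $\mathrm{Ind}_K(V_\sigma)$, homogeneous (i.e. even or odd), which is super-symmetric or skew super-symmetric. That is: for some sign $\varepsilon\in\{1,-1\}$, $\lambda(a,b)=\varepsilon(-1)^{d(a)d(b)}\lambda(b,a)$ for all homogeneous $a,b$; $\lambda(x\cdot a,b)=-(-1)^{d(a)d(x)}\lambda(a,x\cdot b)$ for all homogeneous $x\in L$ and $a$, and all $b$; and $\lambda(a,\cdot)=0$ only for $a=0$. 2. There is an isomorphism of $L_0$-modules $\zeta:V\to(V_\sigma)^*$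 and a sign $\varepsilon\in\{1,-1\}$ such that $\zeta(v)(w)=\varepsilon(-1)^{d(v)d(w)}\zeta(w)(v)$ for all homogeneous $v,w\in V$. -/

import Mathlib

open scoped TensorProduct

namespace SuperLie

/-- The sign `(-1)^{ab}` for parities `a b`. -/
def sgn (F : Type*) [Field F] (a b : ZMod 2) : F := (-1) ^ (a.val * b.val)

/-- The projection onto the `i`-th summand of an internal direct sum decomposition. -/
noncomputable def gradedProj {F V ι : Type*} [Field F] [AddCommGroup V] [Module F V]
    [DecidableEq ι] {𝒜 : ι → Submodule F V} (h : DirectSum.IsInternal 𝒜) (i : ι) :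
    V →ₗ[F] 𝒜 i :=
  DirectSum.component F ι (fun i => 𝒜 i) i ∘ₗ
    (LinearEquiv.ofBijective (DirectSum.coeLinearMap 𝒜)
      (show Function.Bijective (DirectSum.coeLinearMap 𝒜) from h)).symm.toLinearMap

theorem gradedProj_of_mem {F V ι : Type*} [Field F] [AddCommGroup V] [Module F V]
    [DecidableEq ι] {𝒜 : ι → Submodule F V} (h : DirectSum.IsInternal 𝒜) (i j : ι)
    (v : V) (hv : v ∈ 𝒜 j) : (gradedProj h i v : V) = if j = i then v else 0 := by
  have : (LinearEquiv.ofBijective (DirectSum.coeLinearMap 𝒜)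
      (show Function.Bijective (DirectSum.coeLinearMap 𝒜) from h)).symm v
      = DirectSum.lof F ι (fun i => 𝒜 i) j ⟨v, hv⟩ := by
    rw [LinearEquiv.symm_apply_eq]
    exact (DirectSum.coeLinearMap_lof 𝒜 j ⟨v, hv⟩).symm
  simp only [gradedProj, LinearMap.comp_apply, LinearEquiv.coe_coe, this]
  split_ifs with hij
  · subst hij
    simp
  · rw [DirectSum.component.of, dif_neg hij]
    rfl

/-- A superspace: a vector space `V = V_0̄ ⊕ V_1̄`. -/
structure Superspace (F V : Type*) [Field F] [AddCommGroup V] [Module F V] where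
  /-- the homogeneous parts -/
  par : ZMod 2 → Submodule F V
  isInternal : DirectSum.IsInternal par

namespace Superspace

variable {F V : Type*} [Field F] [AddCommGroup V] [Module F V]

/-- The projection of a superspace onto its part of parity `a`, as an endomorphism. -/
noncomputable def proj (S : Superspace F V) (a : ZMod 2) : V →ₗ[F] V :=
  (S.par a).subtype ∘ₗ gradedProj S.isInternal a

/-- The parity operator: `1` on the even part and `-1` on the odd part. -/
noncomputable def parityOp (S : Superspace F V) : V →ₗ[F] V := S.proj 0 - S.proj 1

theorem proj_mem (S : Superspace F V) (a : ZMod 2) (v : V) : S.proj a v ∈ S.par a :=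
  (gradedProj S.isInternal a v).2

theorem proj_of_mem (S : Superspace F V) (a b : ZMod 2) (v : V) (hv : v ∈ S.par b) :
    S.proj a v = if b = a then v else 0 :=
  gradedProj_of_mem S.isInternal a b v hv

theorem proj_add_proj (S : Superspace F V) (v : V) : S.proj 0 v + S.proj 1 v = v := by
  have hv : v ∈ ⨆ a, S.par a := by
    rw [S.isInternal.submodule_iSup_eq_top]; trivial
  induction hv using Submodule.iSup_induction' with
  | mem a x hx =>
    rw [S.proj_of_mem 0 a x hx, S.proj_of_mem 1 a x hx]
    have h01 : (0 : ZMod 2) ≠ 1 := by decide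
    obtain rfl | rfl : a = 0 ∨ a = 1 := by
      clear hx; revert a; decide
    · rw [if_pos rfl, if_neg h01, add_zero]
    · rw [if_neg h01.symm, if_pos rfl, zero_add]
  | zero => simp
  | add x y _ _ hx hy =>
    rw [map_add, map_add]
    nth_rewrite 3 [← hx]
    nth_rewrite 3 [← hy]
    abel

/-- A subspace `W` stable under the parity projections is a superspace, with homogeneous parts
`W ∩ V_a`. -/
def restrict (S : Superspace F V) (W : Submodule F V)
    (hW : ∀ a, ∀ x ∈ W, S.proj a x ∈ W) : Superspace F W where
  par a := (S.par a).comap W.subtype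
  isInternal := by
    have h01 : (0 : ZMod 2) ≠ 1 := by decide
    have huniv : (Set.univ : Set (ZMod 2)) = {0, 1} := by
      ext a; revert a; decide
    rw [DirectSum.isInternal_submodule_iff_isCompl _ h01 huniv]
    refine ⟨?_, ?_⟩
    · rw [Submodule.disjoint_def]
      intro x h0 h1
      exact Subtype.ext
        (Submodule.disjoint_def.1 (S.isInternal.isCompl h01 huniv).disjoint x.1 h0 h1)
    · rw [codisjoint_iff, eq_top_iff]
      intro x _
      exact Submodule.mem_sup.2 ⟨⟨S.proj 0 x, hW 0 x x.2⟩, S.proj_mem 0 x,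
        ⟨S.proj 1 x, hW 1 x x.2⟩, S.proj_mem 1 x, Subtype.ext (S.proj_add_proj x)⟩

/-- The homogeneous parts of the dual space: functionals of parity `a` are those vanishing on
all `V_b` with `b ≠ a`. -/
def dualPar (S : Superspace F V) (a : ZMod 2) : Submodule F (Module.Dual F V) :=
  (⨆ b, ⨆ _ : b ≠ a, S.par b).dualAnnihilator

end Superspace

/-- A Lie superalgebra. The axiom `odd_cube` follows from the Jacobi identity when `3` is
invertible; in characteristic three it is part of the standard definition. -/
structure LieSuperalgebra (F L : Type*) [Field F] [AddCommGroup L] [Module F L] extends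
    Superspace F L where
  bracket : L →ₗ[F] L →ₗ[F] L
  bracket_mem : ∀ a b, ∀ x ∈ par a, ∀ y ∈ par b, bracket x y ∈ par (a + b)
  skew : ∀ a b, ∀ x ∈ par a, ∀ y ∈ par b, bracket x y = -(sgn F a b • bracket y x)
  jacobi : ∀ a b, ∀ x ∈ par a, ∀ y ∈ par b, ∀ z,
    bracket x (bracket y z) = bracket (bracket x y) z + sgn F a b • bracket y (bracket x z)
  odd_cube : ∀ x ∈ par 1, bracket x (bracket x x) = 0

namespace LieSuperalgebra

variable {F L : Type*} [Field F] [AddCommGroup L] [Module F L]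

/-- A graded subspace closed under the bracket is a Lie superalgebra. -/
def restrict (A : LieSuperalgebra F L) (W : Submodule F L)
    (hW : ∀ a, ∀ x ∈ W, A.proj a x ∈ W)
    (hb : ∀ x ∈ W, ∀ y ∈ W, A.bracket x y ∈ W) : LieSuperalgebra F W where
  toSuperspace := A.toSuperspace.restrict W hW
  bracket := LinearMap.mk₂ F (fun x y => ⟨A.bracket x y, hb x x.2 y y.2⟩)
    (fun _ _ _ => Subtype.ext (by simp)) (fun _ _ _ => Subtype.ext (by simp))
    (fun _ _ _ => Subtype.ext (by simp)) (fun _ _ _ => Subtype.ext (by simp))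
  bracket_mem a b x hx y hy := A.bracket_mem a b x hx y hy
  skew a b x hx y hy := Subtype.ext (by simpa using A.skew a b x hx y hy)
  jacobi a b x hx y hy z := Subtype.ext (by simpa using A.jacobi a b x hx y hy z)
  odd_cube x hx := Subtype.ext (by simpa using A.odd_cube x hx)

/-- The relations `x y - (-1)^{ab} y x = [x, y]`, for `x, y` of parities `a, b`, in the tensor
algebra. -/
inductive EnvRel (A : LieSuperalgebra F L) : TensorAlgebra F L → TensorAlgebra F L → Prop
  | mk (a b : ZMod 2) (x y : L) (hx : x ∈ A.par a) (hy : y ∈ A.par b) :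
      EnvRel A
        (TensorAlgebra.ι F x * TensorAlgebra.ι F y
          - sgn F a b • (TensorAlgebra.ι F y * TensorAlgebra.ι F x))
        (TensorAlgebra.ι F (A.bracket x y))

/-- The universal enveloping algebra `U(L)`. -/
def Env (A : LieSuperalgebra F L) : Type _ := RingQuot A.EnvRel

noncomputable instance (A : LieSuperalgebra F L) : Ring A.Env :=
  inferInstanceAs (Ring (RingQuot A.EnvRel))

noncomputable instance (A : LieSuperalgebra F L) : Algebra F A.Env :=
  inferInstanceAs (Algebra F (RingQuot A.EnvRel))

/-- The quotient map from the tensor algebra onto `U(L)`. -/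
noncomputable def envMk (A : LieSuperalgebra F L) : TensorAlgebra F L →ₐ[F] A.Env :=
  RingQuot.mkAlgHom F A.EnvRel

/-- The canonical map `L → U(L)`. -/
noncomputable def envι (A : LieSuperalgebra F L) : L →ₗ[F] A.Env :=
  A.envMk.toLinearMap ∘ₗ TensorAlgebra.ι F

/-- `A.IsMonomial u a`: `u` is a product of homogeneous elements of `L` of total parity `a`. -/
inductive IsMonomial (A : LieSuperalgebra F L) : A.Env → ZMod 2 → Prop
  | one : IsMonomial A 1 0
  | mul (a b : ZMod 2) (x : L) (u : A.Env) (hx : x ∈ A.par a) (hu : IsMonomial A u b) :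
      IsMonomial A (A.envι x * u) (a + b)

/-- The part of `U(L)` of parity `a`. -/
noncomputable def envPar (A : LieSuperalgebra F L) (a : ZMod 2) : Submodule F A.Env :=
  Submodule.span F {u | A.IsMonomial u a}

end LieSuperalgebra

/-- A (`ℤ₂`-graded) module over a Lie superalgebra. -/
structure Supermodule {F L : Type*} [Field F] [AddCommGroup L] [Module F L]
    (A : LieSuperalgebra F L) (V : Type*) [AddCommGroup V] [Module F V] extends
    Superspace F V where
  act : L →ₗ[F] Module.End F V
  act_mem : ∀ a b, ∀ x ∈ A.par a, ∀ v ∈ par b, act x v ∈ par (a + b)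
  act_bracket : ∀ a b, ∀ x ∈ A.par a, ∀ y ∈ A.par b, ∀ v,
    act (A.bracket x y) v = act x (act y v) - sgn F a b • act y (act x v)

/-- The dual action: `(x · f)(v) = -(-1)^{d(x) d(f)} f(x · v)` for homogeneous `x` and `f`,
extended bilinearly. Here `f ∘ proj b` is the component of `f` of parity `b`. -/
noncomputable def dualAct {F L V : Type*} [Field F] [AddCommGroup L] [Module F L]
    [AddCommGroup V] [Module F V] (A : LieSuperalgebra F L) (S : Superspace F V)
    (ρ : L →ₗ[F] Module.End F V) : L →ₗ[F] Module.End F (Module.Dual F V) :=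
  LinearMap.mk₂ F
    (fun x f => -∑ a : ZMod 2, ∑ b : ZMod 2,
      sgn F a b • ((f ∘ₗ S.proj b) ∘ₗ ρ (A.proj a x)))
    (fun x x' f => by
      simp only [map_add, LinearMap.comp_add, smul_add, Finset.sum_add_distrib, neg_add])
    (fun c x f => by
      simp only [map_smul, LinearMap.comp_smul, smul_comm _ c, ← Finset.smul_sum, smul_neg])
    (fun x f f' => by
      simp only [LinearMap.add_comp, smul_add, Finset.sum_add_distrib, neg_add])
    (fun c x f => by
      simp only [LinearMap.smul_comp, smul_comm _ c, ← Finset.smul_sum, smul_neg])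

/-- Homomorphisms of modules over a Lie superalgebra: maps `f`, homogeneous of some parity `c`,
with `x · f(v) = (-1)^{d(x) c} f(x · v)`. The two modules are given by their homogeneous parts
and their actions. -/
def IsSupermoduleHom {F L V W : Type*} [Field F] [AddCommGroup L] [Module F L]
    [AddCommGroup V] [Module F V] [AddCommGroup W] [Module F W] (A : LieSuperalgebra F L)
    (𝒱 : ZMod 2 → Submodule F V) (ρ : L →ₗ[F] Module.End F V)
    (𝒲 : ZMod 2 → Submodule F W) (τ : L →ₗ[F] Module.End F W) (f : V →ₗ[F] W) : Prop :=
  ∃ c : ZMod 2, (∀ b, ∀ v ∈ 𝒱 b, f v ∈ 𝒲 (b + c)) ∧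
    ∀ a, ∀ x ∈ A.par a, ∀ v, τ x (f v) = sgn F a c • f (ρ x v)

section Forms

variable {F L M : Type*} [Field F] [AddCommGroup L] [Module F L] [AddCommGroup M] [Module F M]

/-- `β(v, w) = (-1)^{d(v) d(w)} β(w, v)` for homogeneous `v, w`. -/
def IsSuperSymm (ℳ : ZMod 2 → Submodule F M) (β : M →ₗ[F] M →ₗ[F] F) : Prop :=
  ∀ a b, ∀ v ∈ ℳ a, ∀ w ∈ ℳ b, β v w = sgn F a b * β w v

/-- `β(v, w) = -(-1)^{d(v) d(w)} β(w, v)` for homogeneous `v, w`. -/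
def IsSkewSuperSymm (ℳ : ZMod 2 → Submodule F M) (β : M →ₗ[F] M →ₗ[F] F) : Prop :=
  ∀ a b, ∀ v ∈ ℳ a, ∀ w ∈ ℳ b, β v w = -(sgn F a b * β w v)

/-- The form is homogeneous: even (`c = 0`) or odd (`c = 1`). -/
def IsHomogeneousForm (ℳ : ZMod 2 → Submodule F M) (β : M →ₗ[F] M →ₗ[F] F) : Prop :=
  ∃ c : ZMod 2, ∀ a b, ∀ v ∈ ℳ a, ∀ w ∈ ℳ b, a + b ≠ c → β v w = 0

/-- `β(x · v, w) = -(-1)^{d(v) d(x)} β(v, x · w)` for homogeneous `x, v`. -/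
def IsInvariantForm (A : LieSuperalgebra F L) (ℳ : ZMod 2 → Submodule F M)
    (ρ : L →ₗ[F] Module.End F M) (β : M →ₗ[F] M →ₗ[F] F) : Prop :=
  ∀ a b, ∀ x ∈ A.par a, ∀ v ∈ ℳ b, ∀ w, β (ρ x v) w = -(sgn F b a * β v (ρ x w))

end Forms

/-- A `ℤ`-graded Lie superalgebra `L = ⨁ L_i`; each `L_i` is a `ℤ₂`-graded subspace. -/
structure ZGradedLieSuperalgebra (F L : Type*) [Field F] [AddCommGroup L] [Module F L] extends
    LieSuperalgebra F L where
  /-- the parts `L_i` -/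
  deg : ℤ → Submodule F L
  deg_isInternal : DirectSum.IsInternal deg
  deg_bracket : ∀ i j, ∀ x ∈ deg i, ∀ y ∈ deg j, bracket x y ∈ deg (i + j)
  deg_proj : ∀ i a, ∀ x ∈ deg i, toSuperspace.proj a x ∈ deg i

namespace ZGradedLieSuperalgebra

variable {F L V : Type*} [Field F] [AddCommGroup L] [Module F L] [AddCommGroup V] [Module F V]
variable (G : ZGradedLieSuperalgebra F L)

/-- The Lie superalgebra `L_0` (degree zero for the `ℤ`-grading). -/
def zeroPart : LieSuperalgebra F (G.deg 0) :=
  G.toLieSuperalgebra.restrict (G.deg 0) (fun a x hx => G.deg_proj 0 a x hx)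
    (fun x hx y hy => by simpa using G.deg_bracket 0 0 x hx y hy)

/-- `L⁻ = ⨁_{i < 0} L_i`. -/
def neg : Submodule F L := ⨆ i : ℤ, ⨆ _ : i < 0, G.deg i

/-- `K = L_0 ⊕ L⁺ = ⨁_{i ≥ 0} L_i`. -/
def nonneg : Submodule F L := ⨆ i : ℤ, ⨆ _ : 0 ≤ i, G.deg i

theorem deg_le_nonneg (i : ℤ) (hi : 0 ≤ i) : G.deg i ≤ G.nonneg :=
  le_iSup₂_of_le (f := fun (i : ℤ) (_ : 0 ≤ i) => G.deg i) i hi le_rfl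

theorem nonneg_le_comap_bracket (x : L) (hx : x ∈ G.nonneg) :
    G.nonneg ≤ G.nonneg.comap (G.bracket x) := by
  have h : G.nonneg ≤ ⨅ y : G.nonneg, G.nonneg.comap (G.bracket.flip y) := by
    refine iSup₂_le fun i hi x hx => ?_
    rw [Submodule.mem_iInf]
    rintro ⟨y, hy⟩
    have : G.nonneg ≤ G.nonneg.comap (G.bracket x) :=
      iSup₂_le fun j hj y hy =>
        G.deg_le_nonneg (i + j) (add_nonneg hi hj) (G.deg_bracket i j x hx y hy)
    exact this hy
  intro y hy
  exact (Submodule.mem_iInf _).1 (h hx) ⟨y, hy⟩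

theorem nonneg_le_comap_parityOp : G.nonneg ≤ G.nonneg.comap G.toSuperspace.parityOp :=
  iSup₂_le fun i hi x hx => G.deg_le_nonneg i hi
    (Submodule.sub_mem _ (G.deg_proj i 0 x hx) (G.deg_proj i 1 x hx))

/-- The representation `ρ` of `K` in `L / K` induced by the bracket. -/
noncomputable def quotRep : G.nonneg →ₗ[F] Module.End F (L ⧸ G.nonneg) where
  toFun x := G.nonneg.mapQ G.nonneg (G.bracket x) (G.nonneg_le_comap_bracket x x.2)
  map_add' x y := by ext z; simp
  map_smul' c x := by ext z; simp

/-- The parity operator of `L / K`. -/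
noncomputable def quotParityOp : Module.End F (L ⧸ G.nonneg) :=
  G.nonneg.mapQ G.nonneg G.toSuperspace.parityOp G.nonneg_le_comap_parityOp

/-- `σ(x) = str(ρ(x))`, where the supertrace of an endomorphism is the trace of its composition
with the parity operator. -/
noncomputable def sigma : G.nonneg →ₗ[F] F :=
  LinearMap.trace F (L ⧸ G.nonneg) ∘ₗ LinearMap.mulLeft F G.quotParityOp ∘ₗ G.quotRep

/-- The extension of an action of `L_0` to `K` by letting `L⁺` act trivially. -/
noncomputable def extendAct (ρ : G.deg 0 →ₗ[F] Module.End F V) :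
    G.nonneg →ₗ[F] Module.End F V :=
  ρ ∘ₗ gradedProj G.deg_isInternal 0 ∘ₗ G.nonneg.subtype

/-- The twisted action `x ∘ v = x · v + σ(x) v` of `K`. -/
noncomputable def twistAct (ρ : G.nonneg →ₗ[F] Module.End F V) :
    G.nonneg →ₗ[F] Module.End F V :=
  ρ + (LinearMap.toSpanSingleton F (Module.End F V) 1) ∘ₗ G.sigma

/-- The restriction of an action of `K` to `L_0`. -/
noncomputable def restrictAct (ρ : G.nonneg →ₗ[F] Module.End F V) :
    G.deg 0 →ₗ[F] Module.End F V :=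
  ρ ∘ₗ Submodule.inclusion (G.deg_le_nonneg 0 le_rfl)

section Induced

variable {k : ℕ} (z : Fin k → G.Env) (ρ : G.nonneg →ₗ[F] Module.End F V)

/-- The balancing relations of `U(L) ⊗_θ V`, where `θ = θ(L, K)` is the subalgebra of `U(L)`
generated by `K` and the `z_i`, and where `K` acts on `V` by `ρ` and the `z_i` act by zero:
it is enough to balance over these generators of `θ`. -/
noncomputable def indRel : Submodule F (G.Env ⊗[F] V) :=
  Submodule.span F
    ({t | ∃ (u : G.Env) (x : G.nonneg) (v : V),
        t = (u * G.envι x) ⊗ₜ[F] v - u ⊗ₜ[F] (ρ x v)} ∪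
      {t | ∃ (u : G.Env) (i : Fin k) (v : V), t = (u * z i) ⊗ₜ[F] v})

/-- The generalized reduced Verma module `Ind_K(V) = U(L) ⊗_θ V`. -/
abbrev Ind : Type _ := (G.Env ⊗[F] V) ⧸ G.indRel z ρ

theorem indRel_le_comap (u : G.Env) : G.indRel z ρ ≤
    (G.indRel z ρ).comap (LinearMap.rTensor V (LinearMap.mulLeft F u)) := by
  refine Submodule.span_le.2 ?_
  rintro t (⟨u', x, v, rfl⟩ | ⟨u', i, v, rfl⟩)
  · refine Submodule.subset_span (Or.inl ⟨u * u', x, v, ?_⟩)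
    simp [mul_assoc]
  · refine Submodule.subset_span (Or.inr ⟨u * u', i, v, ?_⟩)
    simp [mul_assoc]

/-- The action of `L` on `Ind_K(V)` by left multiplication. -/
noncomputable def indAct : L →ₗ[F] Module.End F (G.Ind z ρ) where
  toFun x := (G.indRel z ρ).mapQ (G.indRel z ρ)
    (LinearMap.rTensor V (LinearMap.mulLeft F (G.envι x))) (G.indRel_le_comap z ρ _)
  map_add' x y := by
    refine Submodule.linearMap_qext _ (TensorProduct.ext' fun u v => ?_)
    simp [add_mul, TensorProduct.add_tmul]
  map_smul' c x := by
    refine Submodule.linearMap_qext _ (TensorProduct.ext' fun u v => ?_)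
    simp only [map_smul, LinearMap.comp_apply,
      Submodule.mapQ_apply, Submodule.mkQ_apply, LinearMap.rTensor_tmul, LinearMap.mulLeft_apply,
      smul_mul_assoc, LinearMap.smul_apply, RingHom.id_apply, ← TensorProduct.smul_tmul',
      Submodule.Quotient.mk_smul]

/-- The homogeneous parts of `Ind_K(V)`: `d(u ⊗ v) = d(u) + d(v)`. -/
noncomputable def indPar (S : Superspace F V) (a : ZMod 2) : Submodule F (G.Ind z ρ) :=
  Submodule.span F {t | ∃ (b c : ZMod 2) (u : G.Env) (v : V), u ∈ G.envPar b ∧ v ∈ S.par c ∧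
    b + c = a ∧ t = (G.indRel z ρ).mkQ (u ⊗ₜ[F] v)}

end Induced

/-- The elements `z_i = e_i^{p^{m_i}}` of `U(L)`, for a basis `e` of `L⁻ ∩ L_0̄`. -/
noncomputable def zElt {k : ℕ} (p : ℕ)
    (e : Module.Basis (Fin k) F (G.neg ⊓ G.par 0 : Submodule F L)) (m : Fin k → ℕ)
    (i : Fin k) : G.Env :=
  G.envι (e i) ^ p ^ m i

end ZGradedLieSuperalgebra

end SuperLie

open scoped TensorProduct

namespace SuperLie

/-! ### Signs attached to pairs of parities. -/

section Sign

variable (F : Type*) [Field F]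

/-! By a Poincaré–Birkhoff–Witt argument, the induced module is spanned by ordered monomials in
homogeneous basis letters of $L^-$, applied to $1\otimes V$. Even letters $e_j$ have exponent less
than $q_j=p^{m_j}$ and odd letters have exponent at most $1$. Let $\delta$ be the monomial with all
exponents maximal (`Frame.top`) and $D$ its parity. All letters have negative degree, so every
proper submonomial of $\delta$ has strictly larger degree, and $\delta$ is alone in the lowest
degree. Any computation landing in that degree is therefore exact, not only exact modulo shorter
products: $L^-$ kills $\delta\otimes V$ (`indAct_top_of_neg`), and every rearrangement of $\delta$
acts on $1\otimes V$ as $\pm\delta$ (`word_top_perm`).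

The twist enters as follows. Moving $x\in L_0$ past $\delta$ produces the scalar
$\sum_j(q_j-1)x_{jj}$ over even letters plus $\sum_j x_{jj}$ over odd letters, where $x_{jj}$ are
the diagonal coefficients of $\operatorname{ad}x$. In $\mathbb F$ either $q_j=0$, or $q_j=1$ and
$e_j$ is central, which forces $x_{jj}=0$ when $V\ne0$. So on $V$ the scalar is $-\sigma(x)$
(`sum_diag_top`) and cancels the twist: $1\otimes V$ carries $V_\sigma$, while $\delta\otimes V$
carries the untwisted $V$ up to signs (`indAct_top`).

From a form to $\zeta$: put $\zeta(v)(w)=\lambda(\delta\otimes v,1\otimes w)$. It is equivariant by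
the preceding remark. It is injective because $\lambda(\delta\otimes v,L^-\cdot t)=0$, and it has a
symmetry because the reversal of $\delta$ is $\pm\delta$ (`exists_dual_iso_of_form`).

From $\zeta$ to a form: the coefficient $\pi$ at $\delta$ (`topCoeff`) intertwines $K$ with its
untwisted action on $V$, up to signs (`topCoeff_indAct`). Hence $v\mapsto\pm\zeta(v)\circ\pi$ is a
$K$-map from $V_\sigma$ to a signed dual of the induced module. It extends to the induced module
because the $z_i$ act by zero on that dual; the extension is the form (`indForm`). Symmetry is
tested on $\lambda(1\otimes v,t)$ with $t$ a monomial. Nondegeneracy holds because every nonzero $t$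
can be multiplied by letters until its $\delta$-coefficient is nonzero (`exists_topCoeff_ne_zero`).

The existence of $\pi$ is where linear independence of monomials is needed. Operators of $L$ are
built on ordered words with coefficients in $V$, the letters of $K$ acting on $V$ once they reach
the right end. The commutation relations are verified by induction on word length (`comm_word`).
Characteristic different from $2$ gives $x^2=\frac12[x,x]$ for odd $x$, and the axiom $[x,[x,x]]=0$
settles the overlap $xxx$. -/

theorem sgn_comm (a b : ZMod 2) : sgn F a b = sgn F b a := by
  simp only [sgn, mul_comm]

@[simp] theorem sgn_zero_left (b : ZMod 2) : sgn F 0 b = 1 := by simp [sgn]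

@[simp] theorem sgn_zero_right (b : ZMod 2) : sgn F b 0 = 1 := by simp [sgn]

@[simp] theorem sgn_one_one : sgn F 1 1 = -1 := by simp [sgn, ZMod.val_one]

theorem zmod_two_cases (a : ZMod 2) : a = 0 ∨ a = 1 := by revert a; decide

theorem sgn_add_left (a b c : ZMod 2) : sgn F (a + b) c = sgn F a c * sgn F b c := by
  have h : (1 : ZMod 2) + 1 = 0 := by decide
  rcases zmod_two_cases a with rfl | rfl <;> rcases zmod_two_cases b with rfl | rfl <;>
    rcases zmod_two_cases c with rfl | rfl <;> simp [h]

theorem sgn_add_right (a b c : ZMod 2) : sgn F a (b + c) = sgn F a b * sgn F a c := by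
  rw [sgn_comm, sgn_add_left, sgn_comm F b, sgn_comm F c]

@[simp] theorem sgn_mul_self (a b : ZMod 2) : sgn F a b * sgn F a b = 1 := by
  rcases zmod_two_cases a with rfl | rfl <;> rcases zmod_two_cases b with rfl | rfl <;> simp

theorem sgn_self_mul (a b : ZMod 2) (c : F) : sgn F a b * (sgn F a b * c) = c := by
  rw [← mul_assoc, sgn_mul_self, one_mul]

end Sign

/-! ### Ordered words and the straightening operators. -/

/-- An ordered homogeneous basis of a Lie superalgebra `L`, the letters satisfying `N` preceding
the others, and an action on `V` of the subalgebra spanned by the letters which do not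
satisfy `N`. -/
structure InductionData {F L : Type*} [Field F] [AddCommGroup L] [Module F L]
    (A : LieSuperalgebra F L) (V : Type*) [AddCommGroup V] [Module F V]
    (J : Type*) [LinearOrder J] [Fintype J] where
  b : Module.Basis J F L
  pa : J → ZMod 2
  mem_par : ∀ j, b j ∈ A.par (pa j)
  N : J → Prop
  N_lt : ∀ i j, N i → ¬ N j → i < j
  ρ : J → Module.End F V
  bracket_repr : ∀ i j, ¬ N i → ¬ N j → ∀ l, N l → b.repr (A.bracket (b i) (b j)) l = 0
  ρ_bracket : ∀ i j, ¬ N i → ¬ N j → ∀ v,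
    ∑ l, b.repr (A.bracket (b i) (b j)) l • ρ l v =
      ρ i (ρ j v) - sgn F (pa i) (pa j) • ρ j (ρ i v)

namespace InductionData

variable {F L V J : Type*} [Field F] [AddCommGroup L] [Module F L] [AddCommGroup V] [Module F V]
  [LinearOrder J] [Fintype J] {A : LieSuperalgebra F L} (D : InductionData A V J)

/-- The letter `i` may precede the letter `j` in an ordered monomial. -/
def R (i j : J) : Prop := i < j ∨ (i = j ∧ D.pa i = 0)

/-- Ordered monomials in the letters satisfying `N`. -/
def Good : List J → Prop
  | [] => True
  | i :: w => D.N i ∧ (∀ j ∈ w, D.R i j) ∧ Good w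

open Classical in
/-- The action of the letter `i` on the word `w`. -/
noncomputable def X : List J → J → (V →ₗ[F] (List J →₀ V))
  | [], i => if D.N i then Finsupp.lsingle [i] else Finsupp.lsingle [] ∘ₗ D.ρ i
  | k :: w, i =>
    if D.N i ∧ D.R i k then Finsupp.lsingle (i :: k :: w)
    else if i = k then (2 : F)⁻¹ • ∑ j, D.b.repr (A.bracket (D.b i) (D.b i)) j • X w j
    else sgn F (D.pa i) (D.pa k) •
        -- The length test makes the recursion well founded. On a good word, the terms of `X w i`
        -- longer than `w` have exactly one more letter, and all their letters are `i` or letters of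
        -- `w`. The letter `k` is then already in position and is simply prepended.
        (Finsupp.lsum F (fun w' => if _h : w'.length ≤ w.length then X w' k
          else Finsupp.lsingle (k :: w')) ∘ₗ X w i) +
      ∑ j, D.b.repr (A.bracket (D.b i) (D.b k)) j • X w j
termination_by w => w.length

/-- The operator of the letter `i`. -/
noncomputable def op (i : J) : Module.End F (List J →₀ V) :=
  Finsupp.lsum F (fun w => D.X w i)

/-- The operator of an element of `L`. -/
noncomputable def opL : L →ₗ[F] Module.End F (List J →₀ V) := D.b.constr F D.op

@[simp] theorem opL_b (i : J) : D.opL (D.b i) = D.op i := D.b.constr_basis F _ i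

theorem op_single (i : J) (w : List J) (v : V) : D.op i (Finsupp.single w v) = D.X w i v := by
  simp [op]

theorem opL_eq_sum (x : L) : D.opL x = ∑ j, D.b.repr x j • D.op j := by
  simp [opL, Module.Basis.constr_apply_fintype, Module.Basis.equivFun_apply]

theorem opL_single (x : L) (w : List J) (v : V) :
    D.opL x (Finsupp.single w v) = ∑ j, D.b.repr x j • D.X w j v := by
  simp [opL_eq_sum, op_single]

theorem X_of_good_cons (i : J) (w : List J) (h : D.Good (i :: w)) :
    D.X w i = Finsupp.lsingle (i :: w) := by
  cases w with
  | nil => rw [X, if_pos h.1]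
  | cons k w => rw [X, if_pos ⟨h.1, h.2.1 k (by simp)⟩]

theorem op_of_good_cons (i : J) (w : List J) (h : D.Good (i :: w)) (v : V) :
    D.op i (Finsupp.single w v) = Finsupp.single (i :: w) v := by
  rw [op_single, X_of_good_cons _ _ _ h]; rfl

/-- Good words of length at most `n`, or of length `n + 1` with letters in `T`. -/
noncomputable def Q (n : ℕ) (T : J → Prop) : Submodule F (List J →₀ V) :=
  Submodule.span F {t | ∃ w v, D.Good w ∧ (w.length ≤ n ∨ (w.length = n + 1 ∧ ∀ j ∈ w, T j)) ∧
    t = Finsupp.single w v}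

theorem Q_mono {n n' : ℕ} {T T' : J → Prop} (hn : n ≤ n') (hT : n = n' → ∀ j, T j → T' j) :
    D.Q n T ≤ D.Q n' T' := by
  refine Submodule.span_mono ?_
  rintro t ⟨w, v, hw, h, rfl⟩
  refine ⟨w, v, hw, ?_, rfl⟩
  rcases h with h | ⟨h, h'⟩
  · left; omega
  · rcases hn.eq_or_lt with rfl | hlt
    · exact Or.inr ⟨h, fun j hj => hT rfl j (h' j hj)⟩
    · left; omega

theorem R_trans {i j k : J} (h : D.R i j) (h' : D.R j k) : D.R i k := by
  rcases h with h | ⟨rfl, h⟩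
  · rcases h' with h' | ⟨rfl, _⟩
    · exact Or.inl (h.trans h')
    · exact Or.inl h
  · exact h'

theorem N_of_le {i j : J} (hj : D.N j) (h : i ≤ j) : D.N i := by
  by_contra hi
  exact absurd (D.N_lt _ _ hj hi) (not_lt.2 h)

theorem lt_of_not {i k : J} (hk : D.N k) (h : ¬ (D.N i ∧ D.R i k)) (hik : i ≠ k) : k < i := by
  by_contra hlt
  have hlt' : i < k := lt_of_le_of_ne (not_lt.1 hlt) hik
  exact h ⟨D.N_of_le hk hlt'.le, Or.inl hlt'⟩

/-- Straightening `i` into `w` introduces in the longest terms no letter besides `i` and those of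
`w`, so the smaller letter `k` may still stand in front. -/
theorem good_cons_of_letters {k i : J} {w w' : List J} (hk : D.Good (k :: w)) (hki : k < i)
    (hw' : D.Good w') (hl : ∀ j ∈ w', j = i ∨ j ∈ w) : D.Good (k :: w') := by
  refine ⟨hk.1, fun j hj => ?_, hw'⟩
  rcases hl j hj with rfl | hj
  · exact Or.inl hki
  · exact hk.2.1 j hj

/-- Length and letters have to be controlled together: the bound on the letters in the longest terms
is what shows that prepending `k` in the recursive definition produces a good word, and it justifies
the default branch there. -/
theorem X_mem_Q (n : ℕ) : ∀ w : List J, w.length = n → D.Good w → ∀ (i : J) (v : V),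
    D.X w i v ∈ D.Q w.length (fun j => j = i ∨ j ∈ w) := by
  induction n using Nat.strong_induction_on with
  | _ n ih =>
  intro w hn hw i v
  cases w with
  | nil =>
    rw [X]
    split_ifs with h
    · exact Submodule.subset_span ⟨[i], v, (⟨h, by simp, trivial⟩ : D.Good [i]), Or.inr (by simp), rfl⟩
    · exact Submodule.subset_span ⟨[], D.ρ i v, (trivial : D.Good []), Or.inl (by simp), rfl⟩
  | cons k w =>
    subst hn
    have hshort : ∀ (w' : List J), w'.length ≤ w.length → D.Good w' → ∀ (j : J) (v : V),
        D.X w' j v ∈ D.Q (k :: w).length (fun j => j = i ∨ j ∈ k :: w) := by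
      intro w' hl hg j v
      refine D.Q_mono (by simp; omega) (fun h => ?_)
        (ih w'.length (by simp; omega) w' rfl hg j v)
      simp at h; omega
    rw [X]
    split_ifs with h h'
    · refine Submodule.subset_span ⟨i :: k :: w, v, (⟨h.1, fun j hj => ?_, hw⟩ :
        D.Good (i :: k :: w)), Or.inr ⟨by simp, by simp⟩, rfl⟩
      rcases List.mem_cons.1 hj with rfl | hj
      · exact h.2
      · exact D.R_trans h.2 (hw.2.1 j hj)
    · simp only [LinearMap.smul_apply, LinearMap.sum_apply]
      exact Submodule.smul_mem _ _ (Submodule.sum_mem _ fun j _ =>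
        Submodule.smul_mem _ _ (hshort w le_rfl hw.2.2 j v))
    · simp only [LinearMap.add_apply, LinearMap.smul_apply, LinearMap.sum_apply,
        LinearMap.comp_apply]
      refine Submodule.add_mem _ (Submodule.smul_mem _ _ ?_) (Submodule.sum_mem _ fun j _ =>
        Submodule.smul_mem _ _ (hshort w le_rfl hw.2.2 j v))
      have hki := D.lt_of_not hw.1 h h'
      have h1 := ih w.length (by simp) w rfl hw.2.2 i v
      refine (Submodule.span_le.2 ?_ : D.Q w.length (fun j => j = i ∨ j ∈ w) ≤
        (D.Q (k :: w).length (fun j => j = i ∨ j ∈ k :: w)).comap _) h1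
      rintro t ⟨w', v', hg, hw', rfl⟩
      simp only [Submodule.comap_coe, Set.mem_preimage, SetLike.mem_coe, Finsupp.lsum_single]
      split_ifs with hl
      · exact hshort w' hl hg k v'
      · rcases hw' with hw' | ⟨hl', hw'⟩
        · exact absurd hw' hl
        · refine Submodule.subset_span ⟨k :: w', v', D.good_cons_of_letters hw hki hg hw',
            Or.inr ⟨by simp [hl'], fun j hj => ?_⟩, rfl⟩
          rcases List.mem_cons.1 hj with rfl | hj
          · simp
          · rcases hw' j hj with rfl | h
            · simp
            · simp [h]

theorem op_mem_Q {w : List J} (hw : D.Good w) (i : J) (v : V) :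
    D.op i (Finsupp.single w v) ∈ D.Q w.length (fun j => j = i ∨ j ∈ w) := by
  rw [op_single]; exact D.X_mem_Q _ w rfl hw i v

/-- The straightening rule. -/
theorem op_op_of_lt {k i : J} {w : List J} (hw : D.Good (k :: w)) (hki : k < i) (v : V) :
    D.op i (D.op k (Finsupp.single w v)) =
      sgn F (D.pa i) (D.pa k) • D.op k (D.op i (Finsupp.single w v)) +
        D.opL (A.bracket (D.b i) (D.b k)) (Finsupp.single w v) := by
  rw [D.op_of_good_cons k w hw, D.op_single i, X, if_neg, if_neg hki.ne', opL_single]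
  · simp only [LinearMap.add_apply, LinearMap.smul_apply, LinearMap.sum_apply,
        LinearMap.comp_apply]
    congr 2
    rw [op_single]
    have h1 := D.X_mem_Q _ w rfl hw.2.2 i v
    refine (Submodule.span_le.2 ?_ : D.Q w.length (fun j => j = i ∨ j ∈ w) ≤
      LinearMap.eqLocus _ (D.op k)) h1
    rintro t ⟨w', v', hg, hw', rfl⟩
    simp only [SetLike.mem_coe, LinearMap.mem_eqLocus, Finsupp.lsum_single, op_single]
    split_ifs with hl
    · rfl
    · rcases hw' with hw' | ⟨hl', hw'⟩
      · exact absurd hw' hl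
      · rw [D.X_of_good_cons _ _ (D.good_cons_of_letters hw hki hg hw')]
  · rintro ⟨_, h | ⟨h, _⟩⟩
    · exact absurd h (not_lt.2 hki.le)
    · exact hki.ne' h

theorem op_op_self {i : J} {w : List J} (hw : D.Good (i :: w)) (hi : D.pa i = 1) (v : V) :
    D.op i (D.op i (Finsupp.single w v)) =
      (2 : F)⁻¹ • D.opL (A.bracket (D.b i) (D.b i)) (Finsupp.single w v) := by
  rw [D.op_of_good_cons i w hw, D.op_single i, X, if_neg, if_pos rfl, opL_single]
  · simp
  · rintro ⟨_, h | ⟨_, h⟩⟩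
    · exact lt_irrefl _ h
    · rw [hi] at h; exact one_ne_zero h

end InductionData

end SuperLie

/-! ### The commutation relations on ordered words. -/

namespace SuperLie

/-- Induction on the elements of parity `a` with respect to a homogeneous basis. -/
theorem Superspace.par_induction {F L J : Type*} [Field F] [AddCommGroup L] [Module F L]
    [Fintype J] (A : Superspace F L) (b : Module.Basis J F L) (pa : J → ZMod 2)
    (hb : ∀ j, b j ∈ A.par (pa j)) {a : ZMod 2} {P : L → Prop} (zero : P 0)
    (add : ∀ x y, P x → P y → P (x + y)) (smul : ∀ (c : F) x, P x → P (c • x))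
    (basis : ∀ j, pa j = a → P (b j)) {x : L} (hx : x ∈ A.par a) : P x := by
  have h : x = ∑ j, b.repr x j • A.proj a (b j) := by
    conv_lhs => rw [← (A.proj_of_mem a a x hx).trans (if_pos rfl), ← b.sum_repr x]
    simp only [map_sum, map_smul]
  rw [h]
  refine Finset.sum_induction _ P add zero fun j _ => smul _ _ ?_
  rw [A.proj_of_mem a (pa j) _ (hb j)]
  split_ifs with hj
  · exact basis j hj
  · exact zero

namespace InductionData

variable {F L V J : Type*} [Field F] [AddCommGroup L] [Module F L] [AddCommGroup V] [Module F V]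
  [LinearOrder J] [Fintype J] {A : LieSuperalgebra F L} (D : InductionData A V J)

/-- The commutation relation for `x` and `y`, of parities `a` and `c`, holds on `t`. -/
def Comm (a c : ZMod 2) (x y : L) (t : List J →₀ V) : Prop :=
  D.opL x (D.opL y t) = sgn F a c • D.opL y (D.opL x t) + D.opL (A.bracket x y) t

variable {D}

theorem Comm.symm {a c : ZMod 2} {x y : L} {t : List J →₀ V} (hx : x ∈ A.par a)
    (hy : y ∈ A.par c) (h : D.Comm a c x y t) : D.Comm c a y x t := by
  unfold Comm at h ⊢
  rw [h, A.skew c a y hy x hx, smul_add, smul_smul, sgn_comm F c a, sgn_mul_self, one_smul]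
  simp

theorem Comm.add_smul {a c : ZMod 2} {x y : L} {t t' : List J →₀ V} (r : F)
    (h : D.Comm a c x y t) (h' : D.Comm a c x y t') : D.Comm a c x y (t + r • t') := by
  unfold Comm at h h' ⊢
  simp only [map_add, map_smul, h, h', smul_add, smul_comm r]
  abel

theorem comm_of_letters {a c : ZMod 2} {x y : L} {t : List J →₀ V} (hx : x ∈ A.par a)
    (hy : y ∈ A.par c)
    (h : ∀ i j, D.Comm (D.pa i) (D.pa j) (D.b i) (D.b j) t) : D.Comm a c x y t := by
  refine A.par_induction (P := fun x => D.Comm a c x y t) D.b D.pa D.mem_par ?_ ?_ ?_ ?_ hx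
  · simp [Comm]
  · intro x x' hx hx'
    unfold Comm at *
    simp only [map_add, LinearMap.add_apply, hx, hx', smul_add]; abel
  · intro r x hx
    unfold Comm at *
    simp only [map_smul, LinearMap.smul_apply, hx, smul_add, smul_comm r]
  intro i hi
  refine A.par_induction (P := fun y => D.Comm a c (D.b i) y t) D.b D.pa D.mem_par ?_ ?_ ?_ ?_ hy
  · simp [Comm]
  · intro x x' hx hx'
    unfold Comm at *
    simp only [map_add, LinearMap.add_apply, hx, hx', smul_add]; abel
  · intro r x hx
    unfold Comm at *
    simp only [map_smul, LinearMap.smul_apply, hx, smul_add, smul_comm r]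
  · intro j hj
    subst hi hj; exact h i j

theorem comm_of_mem_Q {a c : ZMod 2} {x y : L} {n : ℕ} {T : J → Prop} {t : List J →₀ V}
    (ht : t ∈ D.Q n T)
    (h : ∀ w v, D.Good w → (w.length ≤ n ∨ (w.length = n + 1 ∧ ∀ j ∈ w, T j)) →
      D.Comm a c x y (Finsupp.single w v)) : D.Comm a c x y t := by
  induction ht using Submodule.span_induction with
  | mem t ht =>
    obtain ⟨w, v, hg, hw, rfl⟩ := ht
    exact h w v hg hw
  | zero => simp [Comm]
  | add t t' _ _ ht ht' => simpa using ht.add_smul 1 ht'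
  | smul r t _ ht =>
    have h0 : D.Comm a c x y 0 := by simp [Comm]
    simpa using h0.add_smul r ht

variable (D)

theorem comm_of_good_of_lt {k i : J} {w : List J} (hw : D.Good (k :: w)) (hki : k < i) (v : V) :
    D.Comm (D.pa i) (D.pa k) (D.b i) (D.b k) (Finsupp.single w v) := by
  simp only [Comm, opL_b]
  exact D.op_op_of_lt hw hki v

theorem comm_self_of_good (h2 : (2 : F) ≠ 0) {i : J} {w : List J} (hw : D.Good (i :: w))
    (hi : D.pa i = 1) (v : V) :
    D.Comm (D.pa i) (D.pa i) (D.b i) (D.b i) (Finsupp.single w v) := by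
  simp only [Comm, opL_b]
  rw [D.op_op_self hw hi v, hi, smul_smul]
  nth_rewrite 3 [← one_smul F (D.opL _ _)]
  rw [← add_smul, sgn_one_one]
  congr 1
  field_simp
  norm_num

theorem bracket_self_even (h2 : (2 : F) ≠ 0) {x : L} (hx : x ∈ A.par 0) : A.bracket x x = 0 := by
  have h := A.skew 0 0 x hx x hx
  rw [sgn_zero_left, one_smul, eq_neg_iff_add_eq_zero, ← two_smul F] at h
  exact (smul_eq_zero.1 h).resolve_left h2

theorem comm_self_of_even (h2 : (2 : F) ≠ 0) {i : J} (hi : D.pa i = 0) (t : List J →₀ V) :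
    D.Comm (D.pa i) (D.pa i) (D.b i) (D.b i) t := by
  have hm := D.mem_par i
  rw [hi] at hm
  simp [Comm, hi, bracket_self_even h2 hm]

theorem comm_of_good_of_good (h2 : (2 : F) ≠ 0) {i j : J} {w : List J} (hi : D.Good (i :: w))
    (hj : D.Good (j :: w)) (v : V) :
    D.Comm (D.pa i) (D.pa j) (D.b i) (D.b j) (Finsupp.single w v) := by
  rcases lt_trichotomy i j with h | rfl | h
  · exact (D.comm_of_good_of_lt hi h v).symm (D.mem_par _) (D.mem_par _)
  · rcases zmod_two_cases (D.pa i) with h | h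
    · exact D.comm_self_of_even h2 h _
    · exact D.comm_self_of_good h2 hi h v
  · exact D.comm_of_good_of_lt hj h v

/-- If `j` may be prepended to `w`, then the relation for `i` and `j` holds on `w`. -/
theorem comm_of_good (h2 : (2 : F) ≠ 0) {i j : J} {w : List J} (hj : D.Good (j :: w)) (v : V) :
    D.Comm (D.pa i) (D.pa j) (D.b i) (D.b j) (Finsupp.single w v) := by
  rcases lt_or_ge j i with h | h
  · exact D.comm_of_good_of_lt hj h v
  · rcases h.eq_or_lt with rfl | h
    · exact D.comm_of_good_of_good h2 hj hj v
    · refine D.comm_of_good_of_good h2 ⟨D.N_of_le hj.1 h.le, fun l hl => ?_, hj.2.2⟩ hj v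
      exact D.R_trans (Or.inl h) (hj.2.1 l hl)

/-- A letter of `N` can be prepended to the empty word. If neither letter lies in `N`, everything
takes place in `V` and the relation is the module axiom for the subalgebra. -/
theorem comm_nil (h2 : (2 : F) ≠ 0) (i j : J) (v : V) :
    D.Comm (D.pa i) (D.pa j) (D.b i) (D.b j) (Finsupp.single [] v) := by
  by_cases hj : D.N j
  · exact D.comm_of_good h2 (⟨hj, by simp, trivial⟩ : D.Good [j]) v
  · by_cases hi : D.N i
    · exact (D.comm_of_good h2 (⟨hi, by simp, trivial⟩ : D.Good [i]) v).symm (D.mem_par _) (D.mem_par _)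
    · have hX : ∀ l, ¬ D.N l → ∀ v, D.op l (Finsupp.single [] v) = Finsupp.single [] (D.ρ l v) := by
        intro l hl v
        rw [op_single, X, if_neg hl]; rfl
      have hB : D.opL (A.bracket (D.b i) (D.b j)) (Finsupp.single [] v) =
          Finsupp.single [] (∑ l, D.b.repr (A.bracket (D.b i) (D.b j)) l • D.ρ l v) := by
        rw [opL_eq_sum, Finsupp.single_finsetSum]
        simp only [LinearMap.sum_apply, LinearMap.smul_apply]
        refine Finset.sum_congr rfl fun l _ => ?_
        by_cases hl : D.N l
        · simp [D.bracket_repr i j hi hj l hl]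
        · rw [hX l hl, Finsupp.smul_single]
      simp only [Comm, hB, opL_b, hX i hi, hX j hj, D.ρ_bracket i j hi hj, Finsupp.smul_single,
        ← Finsupp.single_add]
      congr 1
      abel

section Step

variable {D}
variable {u : List J →₀ V}

/-- The inductive step for letters `i, j` which are both greater than `k`. -/
theorem comm_step {a c e : ZMod 2} {x y z : L} (hx : x ∈ A.par a) (hy : y ∈ A.par c)
    (hz : z ∈ A.par e)
    (hxy : D.Comm a c x y u) (hxz : D.Comm a e x z u) (hyz : D.Comm c e y z u)
    (hxz' : D.Comm a e x z (D.opL y u)) (hyz' : D.Comm c e y z (D.opL x u))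
    (hx_yz : D.Comm a (c + e) x (A.bracket y z) u) (hy_xz : D.Comm c (a + e) y (A.bracket x z) u)
    (hxy_z : D.Comm (a + c) e (A.bracket x y) z u) :
    D.Comm a c x y (D.opL z u) := by
  unfold Comm at *
  -- On both sides `z` is moved to the left of `x` and `y`; all the relations used concern `u`, `y
  -- u` or `x u`. The remaining bracket terms match by the Jacobi identity.
  rw [hyz, map_add, map_smul, hxz', hx_yz, hxz, map_add, map_smul, hyz', hy_xz, hxy_z, hxy]
  have hj := A.jacobi a c x hx y hy z
  rw [hj]
  simp only [map_add, map_smul, LinearMap.add_apply, LinearMap.smul_apply, smul_add, smul_smul,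
    sgn_add_left, sgn_add_right]
  rcases zmod_two_cases a with rfl | rfl <;> rcases zmod_two_cases c with rfl | rfl <;>
    rcases zmod_two_cases e with rfl | rfl <;> simp <;> abel

/-- The inductive step for a letter `y` and an odd letter `x` acting on `x u`. -/
theorem comm_step_odd (h2 : (2 : F) ≠ 0) {c : ZMod 2} {x y : L} (hx : x ∈ A.par 1)
    (hy : y ∈ A.par c)
    (hxx : D.Comm 1 1 x x u) (hyx : D.Comm c 1 y x u)
    (hxx' : D.Comm 1 1 x x (D.opL y u))
    (hy_xx : D.Comm c 0 y (A.bracket x x) u) (hx_yx : D.Comm 1 (c + 1) x (A.bracket y x) u) :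
    D.Comm c 1 y x (D.opL x u) := by
  unfold Comm at *
  have half : ∀ t t' : List J →₀ V, t = -t + t' → t = (2 : F)⁻¹ • t' := by
    intro t t' h
    rw [eq_comm, inv_smul_eq_iff₀ h2, two_smul]
    nth_rewrite 1 [h]
    abel
  simp only [sgn_one_one, neg_smul, one_smul] at hxx hxx'
  -- The squares of `x` on `u` and on `y u` become half of `[x,x]`. What remains expresses
  -- `[y,[x,x]]` through `[[y,x],x]`, which is Jacobi together with skew symmetry.
  rw [half _ _ hxx, map_smul, hyx, map_add, map_smul, half _ _ hxx', hy_xx, hx_yx]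
  have hj := A.jacobi c 1 y hy x hx x
  have hs := A.skew (c + 1) 1 _ (A.bracket_mem c 1 y hy x hx) x hx
  rw [hj, hs]
  have h4 : ∀ t : List J →₀ V, (2 : F)⁻¹ • (t + t) = t := fun t => by
    rw [← two_smul F, smul_smul, inv_mul_cancel₀ h2, one_smul]
  rcases zmod_two_cases c with rfl | rfl
  · simp [h4]
    abel
  · simp [sgn_add_left, sgn_add_right, h4]
    abel

/-- Since `x` applied twice to `u` is half of `[x,x]`, the relation on `x u` says that `x` and
`[x,x]` commute on `u`. This is the overlap `xxx`, and it rests on the axiom `[x,[x,x]] = 0`. -/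
theorem comm_step_self (h2 : (2 : F) ≠ 0) {x : L} (hx : x ∈ A.par 1)
    (hxx : D.Comm 1 1 x x u) (hx_xx : D.Comm 1 0 x (A.bracket x x) u) :
    D.Comm 1 1 x x (D.opL x u) := by
  unfold Comm at *
  have half : ∀ t t' : List J →₀ V, t = -t + t' → t = (2 : F)⁻¹ • t' := by
    intro t t' h
    rw [eq_comm, inv_smul_eq_iff₀ h2, two_smul]
    nth_rewrite 1 [h]
    abel
  simp only [sgn_one_one, neg_smul, one_smul] at hxx
  rw [half _ _ hxx, map_smul, hx_xx, A.odd_cube x hx]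
  simp only [sgn_zero_right, one_smul, map_zero, LinearMap.zero_apply, add_zero, sgn_one_one,
    neg_smul]
  generalize D.opL (A.bracket x x) (D.opL x u) = t
  rw [eq_neg_add_iff_add_eq, ← two_smul F, smul_smul, mul_inv_cancel₀ h2, one_smul]

end Step

/-- Induction on the length. For shorter words the relations pass from letters to all homogeneous
elements, brackets included. If neither `i` nor `j` can be prepended to `k :: w`, each of them is
larger than `k` or equal to an odd `k`. Writing the word as `k` applied to `w` leaves the overlaps
treated in `comm_step`, `comm_step_odd` and `comm_step_self`. -/
theorem comm_word (h2 : (2 : F) ≠ 0) (n : ℕ) : ∀ w : List J, w.length = n → D.Good w →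
    ∀ i j v, D.Comm (D.pa i) (D.pa j) (D.b i) (D.b j) (Finsupp.single w v) := by
  induction n using Nat.strong_induction_on with
  | _ n ih =>
  intro w hn hw i j v
  cases w with
  | nil => exact D.comm_nil h2 i j v
  | cons k w =>
  subst hn
  have IH : ∀ (w' : List J), w'.length ≤ w.length → D.Good w' → ∀ {a c : ZMod 2} {x y : L},
      x ∈ A.par a → y ∈ A.par c → ∀ v, D.Comm a c x y (Finsupp.single w' v) :=
    fun w' hl hg a c x y hx hy v =>
      comm_of_letters hx hy fun i j => ih w'.length (by simp; omega) w' rfl hg i j v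
  have IHu : ∀ {a c : ZMod 2} {x y : L}, x ∈ A.par a → y ∈ A.par c →
    D.Comm a c x y (Finsupp.single w v) := fun hx hy => IH w le_rfl hw.2.2 hx hy v
  have hmem := D.mem_par
  have hbr : ∀ i j, A.bracket (D.b i) (D.b j) ∈ A.par (D.pa i + D.pa j) :=
    fun i j => A.bracket_mem _ _ _ (hmem i) _ (hmem j)
  have hlead : ∀ i, D.Good (i :: k :: w) ∨ k < i ∨ (i = k ∧ D.pa i = 1) := by
    intro i
    by_cases h : D.N i ∧ D.R i k
    · refine Or.inl ⟨h.1, fun l hl => ?_, hw⟩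
      rcases List.mem_cons.1 hl with rfl | hl
      · exact h.2
      · exact D.R_trans h.2 (hw.2.1 l hl)
    · right
      by_cases hik : i = k
      · subst hik
        refine Or.inr ⟨rfl, (zmod_two_cases _).resolve_left fun h0 => h ⟨hw.1, Or.inr ⟨rfl, h0⟩⟩⟩
      · exact Or.inl (D.lt_of_not hw.1 h hik)
  -- the relation with `k`, on the image of an operator
  have hk : ∀ i j, (k < i ∨ i = k) → k < j →
      D.Comm (D.pa i) (D.pa k) (D.b i) (D.b k) (D.op j (Finsupp.single w v)) := by
    intro i j _ hj
    refine comm_of_mem_Q (D.op_mem_Q hw.2.2 j v) fun w' v' hg hw' => ?_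
    rcases hw' with hw' | ⟨_, hw'⟩
    · exact IH w' hw' hg (hmem i) (hmem k) v'
    · exact D.comm_of_good h2 (D.good_cons_of_letters hw hj hg hw') v'
  rcases hlead j with hj | hj
  · exact D.comm_of_good h2 hj v
  rcases hlead i with hi | hi
  · exact (D.comm_of_good h2 hi v).symm (hmem _) (hmem _)
  rw [← D.op_of_good_cons k w hw v, ← opL_b]
  rcases hi with hi | ⟨rfl, hi⟩
  · rcases hj with hj | ⟨rfl, hj⟩
    · refine comm_step (hmem i) (hmem j) (hmem k) (IHu (hmem i) (hmem j)) (IHu (hmem i) (hmem k))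
        (IHu (hmem j) (hmem k)) ?_ ?_ (IHu (hmem i) (hbr j k)) (IHu (hmem j) (hbr i k))
        (IHu (hbr i j) (hmem k))
      · rw [opL_b]; exact hk i j (Or.inl hi) hj
      · rw [opL_b]; exact hk j i (Or.inl hj) hi
    · have h1 := hmem j
      have h0 := hbr j j
      have hc := hbr i j
      have hji := hk j i (Or.inr rfl) hi
      rw [hj] at h1 h0 hji hc ⊢
      exact comm_step_odd h2 h1 (hmem i) (IHu h1 h1) (IHu (hmem i) h1)
        (by rw [opL_b]; exact hji) (IHu (hmem i) h0) (IHu h1 hc)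
  · rcases hj with hj | ⟨rfl, hj⟩
    · have h1 := hmem i
      have h0 := hbr i i
      have hc := hbr j i
      have hji := hk i j (Or.inr rfl) hj
      rw [hi] at h1 h0 hji hc ⊢
      exact (comm_step_odd h2 h1 (hmem j) (IHu h1 h1) (IHu (hmem j) h1)
        (by rw [opL_b]; exact hji) (IHu (hmem j) h0) (IHu h1 hc)).symm (hmem _) h1
    · have h1 := hmem j
      have h0 := hbr j j
      rw [hj] at h1 h0 ⊢
      exact comm_step_self h2 h1 (IHu h1 h1) (IHu h1 h0)

end InductionData

end SuperLie

/-! ### The enveloping algebra acting on ordered words, and coefficient functions. -/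

namespace SuperLie

namespace LieSuperalgebra

variable {F L B : Type*} [Field F] [AddCommGroup L] [Module F L] [Ring B] [Algebra F B]
  (A : LieSuperalgebra F L)

theorem envι_mul_envι {a c : ZMod 2} {x y : L} (hx : x ∈ A.par a) (hy : y ∈ A.par c) :
    A.envι x * A.envι y = sgn F a c • (A.envι y * A.envι x) + A.envι (A.bracket x y) := by
  have h := RingQuot.mkAlgHom_rel F (EnvRel.mk (A := A) a c x y hx hy)
  rw [map_sub, map_smul, map_mul, map_mul] at h
  rw [add_comm]
  exact sub_eq_iff_eq_add.1 h

/-- The universal property of the enveloping algebra. -/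
noncomputable def envLift (f : L →ₗ[F] B)
    (hf : ∀ a c, ∀ x ∈ A.par a, ∀ y ∈ A.par c,
      f x * f y = sgn F a c • (f y * f x) + f (A.bracket x y)) : A.Env →ₐ[F] B :=
  RingQuot.liftAlgHom F ⟨TensorAlgebra.lift F f, by
    rintro _ _ ⟨a, c, x, y, hx, hy⟩
    simp [hf a c x hx y hy]⟩

@[simp] theorem envLift_envι (f : L →ₗ[F] B)
    (hf : ∀ a c, ∀ x ∈ A.par a, ∀ y ∈ A.par c,
      f x * f y = sgn F a c • (f y * f x) + f (A.bracket x y)) (x : L) :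
    A.envLift f hf (A.envι x) = f x := by
  have h := RingQuot.liftAlgHom_mkAlgHom_apply (S := F) (f := TensorAlgebra.lift F f)
    (s := A.EnvRel) (by rintro _ _ ⟨a, c, x, y, hx, hy⟩; simp [hf a c x hx y hy])
    (TensorAlgebra.ι F x)
  rw [TensorAlgebra.lift_ι_apply] at h
  exact h

variable {A}

theorem env_induction (P : Submodule F A.Env) (h1 : 1 ∈ P)
    (hmul : ∀ x, ∀ u ∈ P, A.envι x * u ∈ P) (u : A.Env) : u ∈ P := by
  obtain ⟨t, rfl⟩ : ∃ t, A.envMk t = u := RingQuot.mkAlgHom_surjective F A.EnvRel u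
  have key : ∀ t : TensorAlgebra F L, ∀ u ∈ P, A.envMk t * u ∈ P := by
    intro t
    induction t using TensorAlgebra.induction with
    | algebraMap r =>
      intro u hu
      rw [AlgHom.commutes, ← Algebra.smul_def]
      exact P.smul_mem r hu
    | ι x => exact fun u hu => hmul x u hu
    | mul s t hs ht =>
      intro u hu
      rw [map_mul, mul_assoc]
      exact hs _ (ht _ hu)
    | add s t hs ht =>
      intro u hu
      rw [map_add, add_mul]
      exact P.add_mem (hs _ hu) (ht _ hu)
  simpa using key t 1 h1

end LieSuperalgebra

namespace InductionData

variable {F L V J : Type*} [Field F] [AddCommGroup L] [Module F L] [AddCommGroup V] [Module F V]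
  [LinearOrder J] [Fintype J] {A : LieSuperalgebra F L} (D : InductionData A V J)

/-- The span of the ordered monomials. -/
noncomputable def words : Submodule F (List J →₀ V) :=
  Submodule.span F {t | ∃ w v, D.Good w ∧ t = Finsupp.single w v}

theorem single_mem_words {w : List J} (hw : D.Good w) (v : V) :
    Finsupp.single w v ∈ D.words := Submodule.subset_span ⟨w, v, hw, rfl⟩

theorem opL_mem_words (x : L) {t : List J →₀ V} (ht : t ∈ D.words) : D.opL x t ∈ D.words := by
  refine (Submodule.span_le.2 ?_ : D.words ≤ D.words.comap (D.opL x)) ht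
  rintro t ⟨w, v, hw, rfl⟩
  simp only [Submodule.comap_coe, Set.mem_preimage, SetLike.mem_coe, opL_eq_sum,
    LinearMap.sum_apply, LinearMap.smul_apply]
  refine Submodule.sum_mem _ fun j _ => Submodule.smul_mem _ _ ?_
  refine (Submodule.span_mono ?_ : D.Q _ _ ≤ D.words) (D.op_mem_Q hw j v)
  rintro t ⟨w, v, hw, -, rfl⟩
  exact ⟨w, v, hw, rfl⟩

theorem comm_of_mem_words (h2 : (2 : F) ≠ 0) {a c : ZMod 2} {x y : L} (hx : x ∈ A.par a)
    (hy : y ∈ A.par c) {t : List J →₀ V} (ht : t ∈ D.words) : D.Comm a c x y t := by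
  refine comm_of_letters hx hy fun i j => ?_
  induction ht using Submodule.span_induction with
  | mem t ht =>
    obtain ⟨w, v, hw, rfl⟩ := ht
    exact D.comm_word h2 _ w rfl hw i j v
  | zero => simp [Comm]
  | add t t' _ _ ht ht' => simpa using ht.add_smul 1 ht'
  | smul r t _ ht =>
    have h0 : D.Comm (D.pa i) (D.pa j) (D.b i) (D.b j) 0 := by simp [Comm]
    simpa using h0.add_smul r ht

/-- The action of `L` on the span of the ordered monomials. -/
noncomputable def wordsAct : L →ₗ[F] Module.End F D.words where
  toFun x := (D.opL x).restrict fun _ => D.opL_mem_words x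
  map_add' x y := by ext t : 2; simp
  map_smul' c x := by ext t : 2; simp

/-- The action of `U(L)` on the span of the ordered monomials. -/
noncomputable def envRep (h2 : (2 : F) ≠ 0) : A.Env →ₐ[F] Module.End F D.words :=
  A.envLift (B := Module.End F D.words) D.wordsAct fun _ _ _ hx _ hy => LinearMap.ext fun t =>
    Subtype.ext (D.comm_of_mem_words h2 hx hy t.2)

theorem envRep_b (h2 : (2 : F) ≠ 0) (i : J) (t : D.words) :
    (D.envRep h2 (A.envι (D.b i)) t : List J →₀ V) = D.op i t := by
  rw [envRep, A.envLift_envι, ← opL_b]; rfl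

/-- The vector `1 ⊗ v`. -/
noncomputable def vac : V →ₗ[F] D.words :=
  LinearMap.codRestrict D.words (Finsupp.lsingle []) fun v =>
    D.single_mem_words (w := []) trivial v

/-- The coefficient of `u ⊗ v` at the ordered monomial `w`. -/
noncomputable def coeff (h2 : (2 : F) ≠ 0) (w : List J) : A.Env →ₗ[F] Module.End F V :=
  LinearMap.mk₂ F (fun u v => (D.envRep h2 u (D.vac v) : List J →₀ V) w)
    (fun _ _ _ => by simp) (fun _ _ _ => by simp) (fun _ _ _ => by simp) (fun _ _ _ => by simp)

theorem coeff_apply (h2 : (2 : F) ≠ 0) (w : List J) (u : A.Env) (v : V) :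
    D.coeff h2 w u v = (D.envRep h2 u (D.vac v) : List J →₀ V) w := rfl

/-- A letter outside `N` acts on the vacuum vectors through `V`. With `coeff_mul_central` this gives
the balancing relations that make a coefficient descend to the induced module. -/
theorem coeff_mul_envι (h2 : (2 : F) ≠ 0) (w : List J) (u : A.Env) {k : J} (hk : ¬ D.N k)
    (v : V) : D.coeff h2 w (u * A.envι (D.b k)) v = D.coeff h2 w u (D.ρ k v) := by
  have h : D.envRep h2 (A.envι (D.b k)) (D.vac v) = D.vac (D.ρ k v) := by
    refine Subtype.ext ?_
    rw [envRep_b]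
    change D.op k (Finsupp.single [] v) = Finsupp.single [] _
    rw [op_single, X, if_neg hk]; rfl
  rw [coeff_apply, map_mul, Module.End.mul_apply, h, coeff_apply]

theorem envRep_prod (h2 : (2 : F) ≠ 0) {w : List J} (hw : D.Good w) (v : V) :
    (D.envRep h2 (w.map fun j => A.envι (D.b j)).prod (D.vac v) : List J →₀ V) =
      Finsupp.single w v := by
  induction w with
  | nil => rw [List.map_nil, List.prod_nil, map_one]; rfl
  | cons k w ih =>
    rw [List.map_cons, List.prod_cons, map_mul, Module.End.mul_apply, envRep_b, ih hw.2.2,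
      D.op_of_good_cons k w hw]

theorem coeff_prod (h2 : (2 : F) ≠ 0) {w w' : List J} (hw : D.Good w) (v : V) :
    D.coeff h2 w' (w.map fun j => A.envι (D.b j)).prod v = if w = w' then v else 0 := by
  rw [coeff_apply, envRep_prod D h2 hw, Finsupp.single_apply]

theorem envRep_pow_single (h2 : (2 : F) ≠ 0) {i : J} (hi : D.N i) (h0 : D.pa i = 0) (q : ℕ)
    {w : List J} (hw : D.Good w) (hl : ∀ j ∈ w, i ≤ j) (v : V) :
    D.Good (List.replicate q i ++ w) ∧
    (D.envRep h2 (A.envι (D.b i) ^ q) ⟨_, D.single_mem_words hw v⟩ : List J →₀ V) =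
      Finsupp.single (List.replicate q i ++ w) v := by
  induction q with
  | zero => exact ⟨hw, by simp⟩
  | succ q ih =>
    have hg : D.Good (i :: (List.replicate q i ++ w)) := by
      refine ⟨hi, fun j hj => ?_, ih.1⟩
      rcases List.mem_append.1 hj with hj | hj
      · rw [List.eq_of_mem_replicate hj]; exact Or.inr ⟨rfl, h0⟩
      · rcases (hl j hj).eq_or_lt with rfl | h
        · exact Or.inr ⟨rfl, h0⟩
        · exact Or.inl h
    refine ⟨hg, ?_⟩
    rw [pow_succ', map_mul, Module.End.mul_apply, envRep_b, ih.2, D.op_of_good_cons _ _ hg]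
    rfl

/-- Being central, the power can be moved past all letters smaller than `i` and inserted where `i`
belongs. The result is one good word, with no straightening terms. -/
theorem envRep_central (h2 : (2 : F) ≠ 0) {i : J} (hi : D.N i) (h0 : D.pa i = 0) {q : ℕ}
    (hc : A.envι (D.b i) ^ q ∈ Subalgebra.center F A.Env) {w : List J} (hw : D.Good w) (v : V) :
    ∃ w', D.Good w' ∧ (∀ j ∈ w', j = i ∨ j ∈ w) ∧ q ≤ w'.count i ∧
      (D.envRep h2 (A.envι (D.b i) ^ q) ⟨_, D.single_mem_words hw v⟩ : List J →₀ V) =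
        Finsupp.single w' v := by
  induction w with
  | nil =>
    obtain ⟨hg, he⟩ := D.envRep_pow_single h2 hi h0 q hw (by simp) v
    exact ⟨_, hg, fun j hj => by simp at hj; exact Or.inl hj.2, by simp, he⟩
  | cons k w ih =>
    rcases le_or_gt i k with hik | hki
    · obtain ⟨hg, he⟩ := D.envRep_pow_single h2 hi h0 q hw (fun j hj => by
        rcases List.mem_cons.1 hj with rfl | hj
        · exact hik
        · rcases hw.2.1 j hj with h | ⟨rfl, _⟩
          · exact hik.trans h.le
          · exact hik) v
      refine ⟨_, hg, fun j hj => ?_, by simp [List.count_append], he⟩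
      rcases List.mem_append.1 hj with hj | hj
      · exact Or.inl (List.eq_of_mem_replicate hj)
      · exact Or.inr hj
    · obtain ⟨w', hg, hl, hq, he⟩ := ih hw.2.2
      have hg' := D.good_cons_of_letters hw hki hg hl
      refine ⟨k :: w', hg', fun j hj => ?_, hq.trans (List.count_le_count_cons ..), ?_⟩
      · rcases List.mem_cons.1 hj with rfl | hj
        · simp
        · rcases hl j hj with h | h
          · exact Or.inl h
          · simp [h]
      · have h1 : (⟨_, D.single_mem_words hw v⟩ : D.words) =
            D.envRep h2 (A.envι (D.b k)) ⟨_, D.single_mem_words hw.2.2 v⟩ :=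
          Subtype.ext (by rw [envRep_b, D.op_of_good_cons k w hw])
        rw [h1, ← Module.End.mul_apply, ← map_mul, ← Subalgebra.mem_center_iff.1 hc, map_mul,
          Module.End.mul_apply, envRep_b, he, D.op_of_good_cons _ _ hg']

/-- Moved to the left by centrality, the power sends every good word to one containing `i` at least
`q` times, hence never to `w`. -/
theorem coeff_mul_central (h2 : (2 : F) ≠ 0) {i : J} (hi : D.N i) (h0 : D.pa i = 0) {q : ℕ}
    (hc : A.envι (D.b i) ^ q ∈ Subalgebra.center F A.Env) {w : List J} (hw : w.count i < q)
    (u : A.Env) (v : V) : D.coeff h2 w (u * A.envι (D.b i) ^ q) v = 0 := by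
  rw [Subalgebra.mem_center_iff.1 hc, coeff_apply, map_mul, Module.End.mul_apply]
  obtain ⟨t, ht⟩ := D.envRep h2 u (D.vac v)
  induction ht using Submodule.span_induction with
  | mem t ht =>
    obtain ⟨w', v, hg, rfl⟩ := ht
    obtain ⟨w'', -, -, hq, he⟩ := D.envRep_central h2 hi h0 hc hg v
    rw [he, Finsupp.single_apply, if_neg]
    rintro rfl
    omega
  | zero => exact congrArg (fun t : D.words => (t : List J →₀ V) w) (map_zero _)
  | add t t' h h' iht iht' =>
    have hadd := map_add (D.envRep h2 (A.envι (D.b i) ^ q)) ⟨t, h⟩ ⟨t', h'⟩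
    refine (congrArg (fun t : D.words => (t : List J →₀ V) w) hadd).trans ?_
    exact (congrArg₂ (· + ·) iht iht').trans (add_zero 0)
  | smul r t h iht =>
    have hsmul := map_smul (D.envRep h2 (A.envι (D.b i) ^ q)) r ⟨t, h⟩
    refine (congrArg (fun t : D.words => (t : List J →₀ V) w) hsmul).trans ?_
    exact (congrArg (r • ·) iht).trans (smul_zero r)

/-- A letter which is central in `U(L)` has no diagonal structure constants. -/
theorem repr_bracket_smul_eq_zero (h2 : (2 : F) ≠ 0) {i : J} (hi : D.N i) (h0 : D.pa i = 0)
    (hc : A.envι (D.b i) ∈ Subalgebra.center F A.Env) {a : ZMod 2} {x : L} (hx : x ∈ A.par a)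
    (v : V) : D.b.repr (A.bracket x (D.b i)) i • v = 0 := by
  have hb := D.mem_par i
  rw [h0] at hb
  have h := A.envι_mul_envι hx hb
  rw [sgn_zero_right, one_smul, Subalgebra.mem_center_iff.1 hc (A.envι x), left_eq_add] at h
  -- Centrality makes the bracket vanish in the enveloping algebra. The coefficient at the
  -- one-letter word `[i]` then reads off the `i`-th coordinate, because letters outside `N` only
  -- contribute to the empty word.
  have h' : D.coeff h2 [i] (A.envι (A.bracket x (D.b i))) v = 0 := by rw [h]; simp
  rw [← D.b.sum_repr (A.bracket x (D.b i)), map_sum, map_sum, LinearMap.sum_apply,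
    Finset.sum_eq_single i] at h'
  · have := D.coeff_prod h2 (w := [i]) (w' := [i]) ⟨hi, by simp, trivial⟩ v
    simp only [List.map_cons, List.map_nil, List.prod_cons, List.prod_nil, mul_one] at this
    simpa [this] using h'
  · intro j _ hj
    rw [map_smul, map_smul, LinearMap.smul_apply]
    by_cases hN : D.N j
    · have := D.coeff_prod h2 (w := [j]) (w' := [i]) ⟨hN, by simp, trivial⟩ v
      simp only [List.map_cons, List.map_nil, List.prod_cons, List.prod_nil, mul_one] at this
      rw [this, if_neg (by simpa using hj), smul_zero]
    · have h1 := D.coeff_mul_envι h2 [i] 1 hN v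
      have h3 := D.coeff_prod h2 (w := []) (w' := [i]) trivial (D.ρ j v)
      rw [one_mul] at h1
      simp only [List.map_nil, List.prod_nil] at h3
      rw [h1, h3]; simp
  · simp

end InductionData

end SuperLie

/-! ### Homogeneous frames, the induced module and the coefficient at the largest monomial. -/

namespace SuperLie

theorem repr_eq_zero_of_mem {F L J ι : Type*} [Field F] [AddCommGroup L] [Module F L]
    [Fintype J] [DecidableEq ι] {𝒜 : ι → Submodule F L} (h : DirectSum.IsInternal 𝒜)
    (b : Module.Basis J F L) {d : J → ι} (hb : ∀ j, b j ∈ 𝒜 (d j)) {i : ι} {x : L} (hx : x ∈ 𝒜 i)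
    {l : J} (hl : d l ≠ i) : b.repr x l = 0 := by
  classical
  have hx' : x = ∑ j, b.repr x j • (gradedProj h i (b j) : L) := by
    conv_lhs => rw [← (gradedProj_of_mem h i i x hx).trans (if_pos rfl), ← b.sum_repr x]
    simp only [map_sum, map_smul, Submodule.coe_sum, Submodule.coe_smul]
  rw [hx', map_sum, Finsupp.finsetSum_apply]
  refine Finset.sum_eq_zero fun j _ => ?_
  rw [gradedProj_of_mem h i (d j) _ (hb j)]
  split_ifs with hj
  · have : j ≠ l := by rintro rfl; exact hl hj
    simp [this]
  · simp

namespace ZGradedLieSuperalgebra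

variable {F L V : Type*} [Field F] [AddCommGroup L] [Module F L] [AddCommGroup V] [Module F V]
variable (G : ZGradedLieSuperalgebra F L)

/-- A parity preserving action of `K` which is trivial on `L⁺`. -/
structure IsGradedAction (S : Superspace F V) (ρ : G.nonneg →ₗ[F] Module.End F V) : Prop where
  mem : ∀ a c, ∀ x : G.nonneg, (x : L) ∈ G.par a → ∀ v ∈ S.par c, ρ x v ∈ S.par (a + c)
  bracket : ∀ a c, ∀ x y : G.nonneg, (x : L) ∈ G.par a → (y : L) ∈ G.par c → ∀ v,
    ρ ⟨G.bracket x y, G.nonneg_le_comap_bracket x x.2 y.2⟩ v =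
      ρ x (ρ y v) - sgn F a c • ρ y (ρ x v)
  pos : ∀ i, 0 < i → ∀ x : G.nonneg, (x : L) ∈ G.deg i → ρ x = 0

/-- A basis of `L`, homogeneous for both gradings and ordered by degree, and exponents `q j` such
that the elements `z i` are the powers `b j ^ q j` of the even letters of negative degree. -/
structure Frame {k : ℕ} (z : Fin k → G.Env) (J : Type*) [LinearOrder J] [Fintype J] where
  b : Module.Basis J F L
  pa : J → ZMod 2
  mem_par : ∀ j, b j ∈ G.par (pa j)
  d : J → ℤ
  mem_deg : ∀ j, b j ∈ G.deg (d j)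
  lt_of_d_lt : ∀ i j, d i < d j → i < j
  q : J → ℕ
  q_pos : ∀ j, d j < 0 → pa j = 0 → 0 < q j
  -- The exponents are powers of the characteristic, so they vanish in `F` unless the power is
  -- trivial.
  q_cast : ∀ j, d j < 0 → pa j = 0 → (q j : F) = 0 ∨ q j = 1
  exists_z : ∀ j, d j < 0 → pa j = 0 → ∃ i, z i = G.envι (b j) ^ q j
  exists_letter : ∀ i, ∃ j, d j < 0 ∧ pa j = 0 ∧ z i = G.envι (b j) ^ q j
  central : ∀ j, d j < 0 → pa j = 0 → G.envι (b j) ^ q j ∈ Subalgebra.center F G.Env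

section Ind

variable {k : ℕ} (z : Fin k → G.Env) (ρ : G.nonneg →ₗ[F] Module.End F V)

/-- The element `u ⊗ v` of the induced module. -/
noncomputable def indMk (u : G.Env) : V →ₗ[F] G.Ind z ρ :=
  (G.indRel z ρ).mkQ ∘ₗ TensorProduct.mk F G.Env V u

/-- The element `1 ⊗ v` of the induced module. -/
noncomputable abbrev indOne : V →ₗ[F] G.Ind z ρ := G.indMk z ρ 1

@[simp] theorem indAct_indMk (x : L) (u : G.Env) (v : V) :
    G.indAct z ρ x (G.indMk z ρ u v) = G.indMk z ρ (G.envι x * u) v := rfl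

theorem indMk_mul_envι (u : G.Env) (x : G.nonneg) (v : V) :
    G.indMk z ρ (u * G.envι x) v = G.indMk z ρ u (ρ x v) := by
  rw [← sub_eq_zero]
  exact (Submodule.Quotient.mk_eq_zero _).2 (Submodule.subset_span (Or.inl ⟨u, x, v, rfl⟩))

theorem indMk_mul_z (u : G.Env) (i : Fin k) (v : V) : G.indMk z ρ (u * z i) v = 0 :=
  (Submodule.Quotient.mk_eq_zero _).2 (Submodule.subset_span (Or.inr ⟨u, i, v, rfl⟩))

theorem indMk_add (u u' : G.Env) (v : V) :
    G.indMk z ρ (u + u') v = G.indMk z ρ u v + G.indMk z ρ u' v := by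
  simp [indMk]

theorem indMk_smul (c : F) (u : G.Env) (v : V) :
    G.indMk z ρ (c • u) v = c • G.indMk z ρ u v := by
  simp only [indMk, LinearMap.comp_apply, map_smul, LinearMap.smul_apply]

variable {z ρ}

theorem ind_hom_ext {W : Type*} [AddCommGroup W] [Module F W] {f g : G.Ind z ρ →ₗ[F] W}
    (h : ∀ u v, f (G.indMk z ρ u v) = g (G.indMk z ρ u v)) : f = g :=
  Submodule.linearMap_qext _ (TensorProduct.ext' h)

theorem indAct_one (x : G.nonneg) (v : V) :
    G.indAct z ρ x (G.indOne z ρ v) = G.indOne z ρ (ρ x v) := by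
  rw [indAct_indMk, mul_one, ← one_mul (G.envι (x : L)), indMk_mul_envι]

theorem indAct_comm {a c : ZMod 2} {x y : L} (hx : x ∈ G.par a) (hy : y ∈ G.par c)
    (t : G.Ind z ρ) : G.indAct z ρ x (G.indAct z ρ y t) =
      sgn F a c • G.indAct z ρ y (G.indAct z ρ x t) + G.indAct z ρ (G.bracket x y) t := by
  refine LinearMap.congr_fun (f := G.indAct z ρ x * G.indAct z ρ y)
    (g := sgn F a c • (G.indAct z ρ y * G.indAct z ρ x) + G.indAct z ρ (G.bracket x y))
    (G.ind_hom_ext fun u v => ?_) t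
  simp only [Module.End.mul_apply, LinearMap.add_apply, LinearMap.smul_apply, indAct_indMk]
  rw [← indMk_smul, ← indMk_add, ← mul_assoc, G.envι_mul_envι hx hy, add_mul, smul_mul_assoc,
    mul_assoc]

theorem indAct_pow_indMk (x : L) (n : ℕ) (u : G.Env) (v : V) :
    (G.indAct z ρ x ^ n) (G.indMk z ρ u v) = G.indMk z ρ (G.envι x ^ n * u) v := by
  induction n with
  | zero => simp
  | succ n ih => rw [pow_succ', Module.End.mul_apply, ih, indAct_indMk, pow_succ', mul_assoc]

theorem indAct_pow_eq_zero {x : L} {n : ℕ} (hc : G.envι x ^ n ∈ Subalgebra.center F G.Env)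
    {i : Fin k} (hi : z i = G.envι x ^ n) : G.indAct z ρ x ^ n = 0 := by
  refine G.ind_hom_ext fun u v => ?_
  rw [indAct_pow_indMk, ← Subalgebra.mem_center_iff.1 hc, ← hi, indMk_mul_z]
  rfl

theorem ind_induction (P : Submodule F (G.Ind z ρ)) (h1 : ∀ v, G.indOne z ρ v ∈ P)
    (hact : ∀ x, ∀ t ∈ P, G.indAct z ρ x t ∈ P) : P = ⊤ := by
  rw [eq_top_iff]
  rintro t -
  obtain ⟨t, rfl⟩ := Submodule.mkQ_surjective _ t
  induction t using TensorProduct.induction_on with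
  | zero => simp
  | tmul u v =>
    change G.indMk z ρ u v ∈ P
    exact LieSuperalgebra.env_induction (A := G.toLieSuperalgebra)
      (P.comap ((G.indRel z ρ).mkQ ∘ₗ (TensorProduct.mk F G.Env V).flip v)) (h1 v)
      (fun x u hu => hact x _ hu) u
  | add t t' ht ht' => rw [map_add]; exact P.add_mem ht ht'

namespace Frame

variable {J : Type*} [LinearOrder J] [Fintype J] {G} (Fr : G.Frame z J)

theorem repr_deg {i : ℤ} {x : L} (hx : x ∈ G.deg i) {l : J} (hl : Fr.d l ≠ i) :
    Fr.b.repr x l = 0 := repr_eq_zero_of_mem G.deg_isInternal Fr.b Fr.mem_deg hx hl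

theorem repr_par {i : ZMod 2} {x : L} (hx : x ∈ G.par i) {l : J} (hl : Fr.pa l ≠ i) :
    Fr.b.repr x l = 0 := repr_eq_zero_of_mem G.isInternal Fr.b Fr.mem_par hx hl

theorem repr_nonneg {x : L} (hx : x ∈ G.nonneg) {l : J} (hl : Fr.d l < 0) :
    Fr.b.repr x l = 0 := by
  have h : G.nonneg ≤ LinearMap.ker (Fr.b.coord l) :=
    iSup₂_le fun i hi x hx => Fr.repr_deg hx (by omega)
  exact h hx

theorem b_mem_nonneg {j : J} (hj : 0 ≤ Fr.d j) : Fr.b j ∈ G.nonneg :=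
  G.deg_le_nonneg _ hj (Fr.mem_deg j)

open Classical in
/-- The action of a letter of non-negative degree. -/
noncomputable def letterAct (ρ : G.nonneg →ₗ[F] Module.End F V) (j : J) : Module.End F V :=
  if h : 0 ≤ Fr.d j then ρ ⟨Fr.b j, Fr.b_mem_nonneg h⟩ else 0

theorem sum_letterAct (ρ : G.nonneg →ₗ[F] Module.End F V) (x : G.nonneg) :
    ∑ l, Fr.b.repr x l • Fr.letterAct ρ l = ρ x := by
  classical
  have hx : x = ∑ l, Fr.b.repr x l •
      (if h : 0 ≤ Fr.d l then (⟨Fr.b l, Fr.b_mem_nonneg h⟩ : G.nonneg) else 0) := by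
    refine Subtype.ext ?_
    conv_lhs => rw [← Fr.b.sum_repr x]
    rw [Submodule.coe_sum]
    refine Finset.sum_congr rfl fun l _ => ?_
    split_ifs with h
    · rfl
    · rw [Fr.repr_nonneg x.2 (not_le.1 h)]; simp
  conv_rhs => rw [hx]
  rw [map_sum]
  refine Finset.sum_congr rfl fun l _ => ?_
  rw [map_smul, letterAct]
  split_ifs <;> simp

/-- The data of the induction from `K`. -/
noncomputable def inductionData {S : Superspace F V} (hρ : G.IsGradedAction S ρ) :
    InductionData G.toLieSuperalgebra V J where
  b := Fr.b
  pa := Fr.pa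
  mem_par := Fr.mem_par
  N j := Fr.d j < 0
  N_lt i j hi hj := Fr.lt_of_d_lt i j (by omega)
  ρ := Fr.letterAct ρ
  bracket_repr i j hi hj l hl :=
    Fr.repr_deg (G.deg_bracket _ _ _ (Fr.mem_deg i) _ (Fr.mem_deg j)) (by omega)
  ρ_bracket i j hi hj v := by
    have hi' := Fr.b_mem_nonneg (not_lt.1 hi)
    have hj' := Fr.b_mem_nonneg (not_lt.1 hj)
    have h := hρ.bracket _ _ ⟨_, hi'⟩ ⟨_, hj'⟩ (Fr.mem_par i) (Fr.mem_par j) v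
    rw [← Fr.sum_letterAct] at h
    rw [letterAct, letterAct, dif_pos (not_lt.1 hi), dif_pos (not_lt.1 hj), ← h]
    simp

/-- The largest exponent of the letter `j` in the monomial basis of the induced module. -/
noncomputable def bound (j : J) : ℕ := by
  classical
  exact if Fr.d j < 0 then (if Fr.pa j = 0 then Fr.q j - 1 else 1) else 0

/-- The largest monomial. -/
noncomputable def top : Multiset J := ∑ j, Multiset.replicate (Fr.bound j) j

theorem count_top (j : J) : Fr.top.count j = Fr.bound j := by
  simp [top, Multiset.count_sum', Multiset.count_replicate]

theorem d_neg_of_mem_top {j : J} (hj : j ∈ Fr.top) : Fr.d j < 0 := by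
  by_contra h
  have := Multiset.count_pos.2 hj
  rw [count_top, bound, if_neg h] at this
  exact lt_irrefl _ this

/-- Even letters may repeat in a good word, and odd letters occur at most once below the largest
monomial. -/
theorem good_of_le_top {S : Superspace F V} (hρ : G.IsGradedAction S ρ) {s : Multiset J}
    (hs : s ≤ Fr.top) : (Fr.inductionData hρ).Good s.sort := by
  have h : ∀ w : List J, w.Pairwise (· ≤ ·) → (w : Multiset J) ≤ Fr.top →
      (Fr.inductionData hρ).Good w := by
    intro w
    induction w with
    | nil => exact fun _ _ => trivial
    | cons i w ih =>
      intro hw hle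
      have hneg : Fr.d i < 0 := Fr.d_neg_of_mem_top (Multiset.mem_of_le hle (by simp))
      refine ⟨hneg, fun j hj => ?_,
        ih (List.pairwise_cons.1 hw).2 ((Multiset.le_cons_self _ i).trans hle)⟩
      rcases ((List.pairwise_cons.1 hw).1 j hj).eq_or_lt with rfl | h
      · refine Or.inr ⟨rfl, ?_⟩
        change Fr.pa i = 0
        by_contra hp
        have h1 := Multiset.count_le_of_le i hle
        have h2 := List.count_pos_iff.2 hj
        rw [count_top, bound, if_pos hneg, if_neg hp, Multiset.coe_count, List.count_cons_self] at h1
        omega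
      · exact Or.inl h
  exact h _ (Multiset.pairwise_sort _ _) (by rwa [Multiset.sort_eq])

/-- The coefficient at the largest monomial. -/
noncomputable def topCoeff (h2 : (2 : F) ≠ 0) {S : Superspace F V}
    (hρ : G.IsGradedAction S ρ) : G.Ind z ρ →ₗ[F] V :=
  (G.indRel z ρ).liftQ (TensorProduct.lift
    ((Fr.inductionData hρ).coeff h2 Fr.top.sort)) <| Submodule.span_le.2 <| by
    rintro t (⟨u, x, v, rfl⟩ | ⟨u, i, v, rfl⟩)
    · simp only [SetLike.mem_coe, LinearMap.mem_ker, map_sub, TensorProduct.lift.tmul]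
      rw [sub_eq_zero]
      conv_lhs => rw [← Fr.b.sum_repr (x : L)]
      rw [← Fr.sum_letterAct]
      simp only [map_sum, map_smul, Finset.mul_sum, mul_smul_comm, LinearMap.sum_apply,
        LinearMap.smul_apply]
      refine Finset.sum_congr rfl fun l _ => ?_
      by_cases hl : Fr.d l < 0
      · rw [Fr.repr_nonneg x.2 hl]; simp
      · congr 1
        exact (Fr.inductionData hρ).coeff_mul_envι h2 _ u (k := l) hl v
    · simp only [SetLike.mem_coe, LinearMap.mem_ker, TensorProduct.lift.tmul]
      obtain ⟨j, hj, h0, hz⟩ := Fr.exists_letter i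
      rw [hz]
      refine (Fr.inductionData hρ).coeff_mul_central h2 (i := j) hj h0 (Fr.central j hj h0) ?_ u v
      rw [← Multiset.coe_count, Multiset.sort_eq, count_top, bound, if_pos hj, if_pos h0]
      have := Fr.q_pos j hj h0
      omega

variable (z ρ) in
/-- The operator of a product of letters. -/
noncomputable def word (w : List J) : Module.End F (G.Ind z ρ) :=
  (w.map fun j => G.indAct z ρ (Fr.b j)).prod

end Frame

end Ind

end ZGradedLieSuperalgebra

end SuperLie

/-! ### Reduction to monomials below the largest one, with length and degree control. -/

namespace SuperLie
namespace ZGradedLieSuperalgebra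

variable {F L V : Type*} [Field F] [AddCommGroup L] [Module F L] [AddCommGroup V] [Module F V]
variable {G : ZGradedLieSuperalgebra F L}
variable {k : ℕ} {z : Fin k → G.Env} {ρ : G.nonneg →ₗ[F] Module.End F V}

namespace Frame

variable {J : Type*} [LinearOrder J] [Fintype J] (Fr : G.Frame z J)

@[simp] theorem word_nil : Fr.word z ρ [] = 1 := rfl

@[simp] theorem word_cons (j : J) (w : List J) :
    Fr.word z ρ (j :: w) = G.indAct z ρ (Fr.b j) * Fr.word z ρ w := by simp [word]

@[simp] theorem word_append (w w' : List J) :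
    Fr.word z ρ (w ++ w') = Fr.word z ρ w * Fr.word z ρ w' := by simp [word]

theorem word_one (w : List J) (v : V) : Fr.word z ρ w (G.indOne z ρ v) =
    G.indMk z ρ (w.map fun j => G.envι (Fr.b j)).prod v := by
  induction w with
  | nil => rfl
  | cons j w ih => rw [word_cons, Module.End.mul_apply, ih, indAct_indMk]; simp

theorem topCoeff_sort (h2 : (2 : F) ≠ 0) {S : Superspace F V} (hρ : G.IsGradedAction S ρ)
    {s : Multiset J} (hs : s ≤ Fr.top) (v : V) :
    Fr.topCoeff h2 hρ (Fr.word z ρ s.sort (G.indOne z ρ v)) = if s = Fr.top then v else 0 := by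
  rw [word_one]
  refine (((Fr.inductionData hρ).coeff_prod h2 (Fr.good_of_le_top hρ hs) v :
    (Fr.inductionData hρ).coeff h2 Fr.top.sort _ v = _)).trans ?_
  congr 1
  refine propext ⟨fun h => ?_, fun h => by rw [h]⟩
  rw [← Multiset.sort_eq s (· ≤ ·), h, Multiset.sort_eq]

variable (z ρ) in
/-- The span of the products of fewer than `n` letters, of total degree `e`, on `1 ⊗ V`. -/
noncomputable def filt (n : ℕ) (e : ℤ) : Submodule F (G.Ind z ρ) :=
  Submodule.span F {t | ∃ w v, w.length < n ∧ (w.map Fr.d).sum = e ∧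
    t = Fr.word z ρ w (G.indOne z ρ v)}

theorem word_mem_filt {n : ℕ} {e : ℤ} {w : List J} (hw : w.length < n)
    (he : (w.map Fr.d).sum = e) (v : V) :
    Fr.word z ρ w (G.indOne z ρ v) ∈ Fr.filt z ρ n e :=
  Submodule.subset_span ⟨w, v, hw, he, rfl⟩

theorem filt_mono {n n' : ℕ} (h : n ≤ n') (e : ℤ) : Fr.filt z ρ n e ≤ Fr.filt z ρ n' e := by
  refine Submodule.span_mono ?_
  rintro t ⟨w, v, hw, he, rfl⟩
  exact ⟨w, v, hw.trans_le h, he, rfl⟩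

theorem indAct_mem_filt {n : ℕ} {e i : ℤ} {x : L} (hx : x ∈ G.deg i) {t : G.Ind z ρ}
    (ht : t ∈ Fr.filt z ρ n e) : G.indAct z ρ x t ∈ Fr.filt z ρ (n + 1) (i + e) := by
  refine (Submodule.span_le.2 ?_ : Fr.filt z ρ n e ≤
    (Fr.filt z ρ (n + 1) (i + e)).comap (G.indAct z ρ x)) ht
  rintro t ⟨w, v, hw, he, rfl⟩
  simp only [Submodule.comap_coe, Set.mem_preimage, SetLike.mem_coe]
  rw [← Fr.b.sum_repr x, map_sum, LinearMap.sum_apply]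
  refine Submodule.sum_mem _ fun j _ => ?_
  rw [map_smul, LinearMap.smul_apply]
  by_cases hj : Fr.d j = i
  · refine Submodule.smul_mem _ _ ?_
    have := Fr.word_mem_filt (z := z) (ρ := ρ) (n := n + 1) (e := i + e) (w := j :: w)
      (by simpa using hw) (by simp [hj, he]) v
    simpa using this
  · rw [Fr.repr_deg hx hj, zero_smul]; exact Submodule.zero_mem _

/-- Reordering the letters of a product changes it by a sign and by shorter products. -/
theorem word_perm {w w' : List J} (h : w.Perm w') : ∃ η : F, (η = 1 ∨ η = -1) ∧ ∀ v,
    Fr.word z ρ w (G.indOne z ρ v) - η • Fr.word z ρ w' (G.indOne z ρ v) ∈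
      Fr.filt z ρ w.length (w.map Fr.d).sum := by
  induction h with
  | nil => exact ⟨1, Or.inl rfl, fun v => by simp⟩
  | cons x h ih =>
    obtain ⟨η, hη, h⟩ := ih
    refine ⟨η, hη, fun v => ?_⟩
    have := Fr.indAct_mem_filt (Fr.mem_deg x) (h v)
    simpa using this
  | swap x y l =>
    refine ⟨sgn F (Fr.pa y) (Fr.pa x), ?_, fun v => ?_⟩
    · rcases zmod_two_cases (Fr.pa y) with h | h <;> rcases zmod_two_cases (Fr.pa x) with h' | h' <;>
        simp [h, h']
    · simp only [word_cons, Module.End.mul_apply, List.map_cons, List.sum_cons]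
      rw [G.indAct_comm (Fr.mem_par y) (Fr.mem_par x), add_sub_cancel_left, ← add_assoc]
      exact Fr.indAct_mem_filt (G.deg_bracket _ _ _ (Fr.mem_deg y) _ (Fr.mem_deg x))
        (Fr.word_mem_filt (by simp) rfl v)
  | trans h h' ih ih' =>
    obtain ⟨η, hη, h1⟩ := ih
    obtain ⟨η', hη', h2⟩ := ih'
    refine ⟨η * η', ?_, fun v => ?_⟩
    · rcases hη with rfl | rfl <;> rcases hη' with rfl | rfl <;> simp
    · have h2 := h2 v
      rw [← h.length_eq, ← (h.map Fr.d).sum_eq] at h2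
      have := Submodule.add_mem _ (h1 v) (Submodule.smul_mem _ η h2)
      rw [smul_sub, smul_smul] at this
      simpa using this

/-- A product in which some letter occurs too often reduces to shorter products. -/
theorem word_overflow (h2 : (2 : F) ≠ 0) {S : Superspace F V} (hρ : G.IsGradedAction S ρ)
    {w : List J} {j : J} (hj : Fr.bound j < w.count j) (v : V) :
    Fr.word z ρ w (G.indOne z ρ v) ∈ Fr.filt z ρ w.length (w.map Fr.d).sum := by
  have key : ∀ w' : List J, w.Perm w' →
      Fr.word z ρ w' (G.indOne z ρ v) ∈ Fr.filt z ρ w'.length (w'.map Fr.d).sum →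
      Fr.word z ρ w (G.indOne z ρ v) ∈ Fr.filt z ρ w.length (w.map Fr.d).sum := by
    intro w' hw' h
    obtain ⟨η, -, h1⟩ := Fr.word_perm (z := z) (ρ := ρ) hw'
    rw [← hw'.length_eq, ← (hw'.map Fr.d).sum_eq] at h
    have := Submodule.add_mem _ (h1 v) (Submodule.smul_mem _ η h)
    simpa using this
  -- Up to sign and shorter products, the surplus copies of `j` are collected in front. The
  -- resulting block is zero when `j` is even of negative degree, and half of `[x,x]` when it is odd
  -- of negative degree.
  obtain ⟨l, hl⟩ := (List.replicate_sublist_iff.2 hj).exists_perm_append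
  rcases lt_or_ge (Fr.d j) 0 with hd | hd
  · refine key _ hl ?_
    by_cases h0 : Fr.pa j = 0
    · obtain ⟨i, hi⟩ := Fr.exists_z j hd h0
      have hq : (Fr.bound j).succ = Fr.q j := by
        have := Fr.q_pos j hd h0
        rw [bound, if_pos hd, if_pos h0]; omega
      have hz : Fr.word z ρ (List.replicate (Fr.q j) j) = 0 := by
        rw [word, List.map_replicate, List.prod_replicate]
        exact G.indAct_pow_eq_zero (Fr.central j hd h0) hi
      rw [hq, word_append, hz, zero_mul]
      exact Submodule.zero_mem _
    · have h1 : Fr.pa j = 1 := (zmod_two_cases _).resolve_left h0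
      have hb : (Fr.bound j).succ = 2 := by rw [bound, if_pos hd, if_neg h0]
      have hm := Fr.mem_par j
      rw [h1] at hm
      have hc := G.indAct_comm hm hm (Fr.word z ρ l (G.indOne z ρ v))
      rw [sgn_one_one, neg_smul, one_smul, eq_neg_add_iff_add_eq, ← two_smul F] at hc
      have hmem : (2 : F) • G.indAct z ρ (Fr.b j) (G.indAct z ρ (Fr.b j)
          (Fr.word z ρ l (G.indOne z ρ v))) ∈
            Fr.filt z ρ (l.length + 2) (Fr.d j + Fr.d j + (l.map Fr.d).sum) := by
        rw [hc]
        exact Fr.indAct_mem_filt (G.deg_bracket _ _ _ (Fr.mem_deg j) _ (Fr.mem_deg j))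
          (Fr.word_mem_filt (by simp) rfl v)
      rw [hb]
      have := ((Fr.filt z ρ _ _).smul_mem_iff h2).1 hmem
      simpa [List.replicate_succ, add_assoc] using this
  -- A letter of non-negative degree is moved to the right end instead. There it acts on `V` when
  -- its degree is `0`, and it gives zero when its degree is positive.
  · have hb : (Fr.bound j).succ = 1 := by rw [bound, if_neg (not_lt.2 hd)]
    rw [hb] at hl
    refine key (l ++ [j]) (hl.trans List.perm_append_comm) ?_
    simp only [word_append, Module.End.mul_apply, word_cons, word_nil, Module.End.one_apply]
    have hm := Fr.b_mem_nonneg hd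
    rw [G.indAct_one ⟨_, hm⟩]
    rcases hd.eq_or_lt with hd | hd
    · exact Fr.word_mem_filt (by simp) (by simp [← hd]) _
    · rw [hρ.pos _ hd ⟨_, hm⟩ (Fr.mem_deg j)]
      simp

variable (z ρ) in
/-- The span of the monomials below the largest one with fewer than `n` letters and of
degree `e`, on `1 ⊗ V`. -/
noncomputable def reduced (n : ℕ) (e : ℤ) : Submodule F (G.Ind z ρ) :=
  Submodule.span F {t | ∃ s v, s ≤ Fr.top ∧ s.card < n ∧ (s.map Fr.d).sum = e ∧
    t = Fr.word z ρ s.sort (G.indOne z ρ v)}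

/-- Induction on the number of letters: a word is either a rearrangement of a monomial below the
largest one or has a letter in excess. In both cases the correction consists of shorter products of
the same degree. -/
theorem filt_le_reduced (h2 : (2 : F) ≠ 0) {S : Superspace F V} (hρ : G.IsGradedAction S ρ)
    (n : ℕ) (e : ℤ) : Fr.filt z ρ n e ≤ Fr.reduced z ρ n e := by
  induction n generalizing e with
  | zero =>
    refine Submodule.span_le.2 ?_
    rintro t ⟨w, v, hw, -⟩
    exact absurd hw (Nat.not_lt_zero _)
  | succ n ih =>
    have hmono : Fr.reduced z ρ n e ≤ Fr.reduced z ρ (n + 1) e := by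
      refine Submodule.span_mono ?_
      rintro t ⟨s, v, hs, hn, he, rfl⟩
      exact ⟨s, v, hs, by omega, he, rfl⟩
    refine Submodule.span_le.2 ?_
    rintro t ⟨w, v, hw, he, rfl⟩
    have hlow : Fr.filt z ρ w.length (w.map Fr.d).sum ≤ Fr.reduced z ρ (n + 1) e := by
      rw [he]
      exact (Fr.filt_mono (by omega) e).trans ((ih e).trans hmono)
    by_cases hle : (w : Multiset J) ≤ Fr.top
    · have hp : w.Perm ((w : Multiset J).sort) := Multiset.coe_eq_coe.1 (Multiset.sort_eq _ _).symm
      obtain ⟨η, -, h⟩ := Fr.word_perm (z := z) (ρ := ρ) hp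
      have h1 := hlow (h v)
      have h3 : Fr.word z ρ (w : Multiset J).sort (G.indOne z ρ v) ∈ Fr.reduced z ρ (n + 1) e :=
        Submodule.subset_span ⟨w, v, hle, by simpa using hw, by simpa using he, rfl⟩
      have := Submodule.add_mem _ h1 (Submodule.smul_mem _ η h3)
      simpa using this
    · obtain ⟨j, hj⟩ : ∃ j, Fr.bound j < w.count j := by
        by_contra! h
        exact hle (Multiset.le_iff_count.2 fun j => by
          rw [count_top, Multiset.coe_count]; exact h j)
      exact hlow (Fr.word_overflow h2 hρ hj v)

/-- The missing letters all have negative degree. This makes the largest monomial the unique one of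
lowest degree, which is the source of all exact identities below. -/
theorem sum_d_lt_of_lt_top {s : Multiset J} (hs : s < Fr.top) :
    (Fr.top.map Fr.d).sum < (s.map Fr.d).sum := by
  obtain ⟨t, ht⟩ := Multiset.le_iff_exists_add.1 hs.le
  have ht0 : t ≠ 0 := by rintro rfl; exact hs.ne (by simp [ht])
  have hneg : ∀ j ∈ t, Fr.d j < 0 := fun j hj => Fr.d_neg_of_mem_top (by rw [ht]; simp [hj])
  rw [ht, Multiset.map_add, Multiset.sum_add]
  have : (t.map Fr.d).sum < 0 := by
    clear ht
    induction t using Multiset.induction_on with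
    | empty => exact absurd rfl ht0
    | cons a t ih =>
      rw [Multiset.map_cons, Multiset.sum_cons]
      have ha := hneg a (by simp)
      by_cases h : t = 0
      · simpa [h] using ha
      · have := ih h fun j hj => hneg j (by simp [hj])
        omega
  omega

theorem reduced_eq_bot_of_lt {n : ℕ} {e : ℤ} (he : e < (Fr.top.map Fr.d).sum) :
    Fr.reduced z ρ n e = ⊥ := by
  rw [eq_bot_iff]
  refine Submodule.span_le.2 ?_
  rintro t ⟨s, v, hs, -, rfl, -⟩
  rcases hs.eq_or_lt with rfl | hs
  · exact absurd he (lt_irrefl _)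
  · exact absurd (Fr.sum_d_lt_of_lt_top hs) (not_lt.2 he.le)

/-- In the lowest degree there is no monomial besides the largest one, so congruences modulo shorter
products become equalities. -/
theorem reduced_eq_bot {n : ℕ} (hn : n ≤ Fr.top.card) :
    Fr.reduced z ρ n (Fr.top.map Fr.d).sum = ⊥ := by
  rw [eq_bot_iff]
  refine Submodule.span_le.2 ?_
  rintro t ⟨s, v, hs, hc, he, -⟩
  rcases hs.eq_or_lt with rfl | hs
  · omega
  · exact absurd (Fr.sum_d_lt_of_lt_top hs) (not_lt.2 he.le)

theorem topCoeff_reduced (h2 : (2 : F) ≠ 0) {S : Superspace F V} (hρ : G.IsGradedAction S ρ)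
    {n : ℕ} (hn : n ≤ Fr.top.card) {e : ℤ} {t : G.Ind z ρ} (ht : t ∈ Fr.reduced z ρ n e) :
    Fr.topCoeff h2 hρ t = 0 := by
  refine (Submodule.span_le.2 ?_ : Fr.reduced z ρ n e ≤ LinearMap.ker (Fr.topCoeff h2 hρ)) ht
  rintro t ⟨s, v, hs, hc, he, rfl⟩
  rw [SetLike.mem_coe, LinearMap.mem_ker, topCoeff_sort _ _ _ hs, if_neg]
  rintro rfl
  omega

/-- A word with fewer letters than the largest monomial reduces to monomials that are too short. One
with equally many letters but a different content has a letter in excess, and is again a combination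
of shorter products. -/
theorem topCoeff_word_eq_zero (h2 : (2 : F) ≠ 0) {S : Superspace F V}
    (hρ : G.IsGradedAction S ρ) {w : List J} (hw : w.length ≤ Fr.top.card)
    (hne : (w : Multiset J) ≠ Fr.top) (v : V) :
    Fr.topCoeff h2 hρ (Fr.word z ρ w (G.indOne z ρ v)) = 0 := by
  rcases hw.lt_or_eq with hlt | heq
  · exact Fr.topCoeff_reduced h2 hρ (n := w.length + 1) hlt
      (Fr.filt_le_reduced h2 hρ _ _ (Fr.word_mem_filt (Nat.lt_succ_self _) rfl v))
  · obtain ⟨j, hj⟩ : ∃ j, Fr.bound j < w.count j := by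
      by_contra! h
      refine hne (Multiset.eq_of_le_of_card_le (Multiset.le_iff_count.2 fun j => ?_) ?_)
      · rw [count_top, Multiset.coe_count]; exact h j
      · simp [heq]
    exact Fr.topCoeff_reduced h2 hρ heq.le
      (Fr.filt_le_reduced h2 hρ _ _ (Fr.word_overflow h2 hρ hj v))

/-- Reordering costs a sign and shorter products of the same degree, and the latter vanish because
this degree is the lowest one. -/
theorem word_top_perm (h2 : (2 : F) ≠ 0) {S : Superspace F V} (hρ : G.IsGradedAction S ρ)
    {w : List J} (hw : (w : Multiset J) = Fr.top) : ∃ η : F, (η = 1 ∨ η = -1) ∧ ∀ v,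
    Fr.word z ρ w (G.indOne z ρ v) = η • Fr.word z ρ Fr.top.sort (G.indOne z ρ v) := by
  have hp : w.Perm Fr.top.sort := by
    rw [← hw]; exact Multiset.coe_eq_coe.1 (Multiset.sort_eq _ _).symm
  obtain ⟨η, hη, h⟩ := Fr.word_perm (z := z) (ρ := ρ) hp
  refine ⟨η, hη, fun v => ?_⟩
  have h1 := Fr.filt_le_reduced h2 hρ _ _ (h v)
  have hs : (w.map Fr.d).sum = (Fr.top.map Fr.d).sum := by rw [← hw]; simp
  rw [hs, Fr.reduced_eq_bot (by rw [← hw]; simp)] at h1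
  exact sub_eq_zero.1 ((Submodule.mem_bot F).1 h1)

theorem topCoeff_top (h2 : (2 : F) ≠ 0) {S : Superspace F V} (hρ : G.IsGradedAction S ρ)
    (v : V) : Fr.topCoeff h2 hρ (Fr.word z ρ Fr.top.sort (G.indOne z ρ v)) = v := by
  rw [topCoeff_sort _ _ _ le_rfl, if_pos rfl]

/-- The induced module is spanned by the monomials below the largest one. -/
theorem ind_induction_word (h2 : (2 : F) ≠ 0) {S : Superspace F V} (hρ : G.IsGradedAction S ρ)
    (P : Submodule F (G.Ind z ρ))
    (h : ∀ s ≤ Fr.top, ∀ v, Fr.word z ρ s.sort (G.indOne z ρ v) ∈ P) : P = ⊤ := by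
  have hw : Submodule.span F {t | ∃ w v, t = Fr.word z ρ w (G.indOne z ρ v)} = ⊤ := by
    refine G.ind_induction _ (fun v => Submodule.subset_span ⟨[], v, rfl⟩) fun x t ht => ?_
    refine (Submodule.span_le.2 ?_ : Submodule.span F _ ≤ (Submodule.span F
      {t | ∃ w v, t = Fr.word z ρ w (G.indOne z ρ v)}).comap (G.indAct z ρ x)) ht
    rintro t ⟨w, v, rfl⟩
    simp only [Submodule.comap_coe, Set.mem_preimage, SetLike.mem_coe]
    rw [← Fr.b.sum_repr x, map_sum, LinearMap.sum_apply]
    refine Submodule.sum_mem _ fun j _ => ?_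
    rw [map_smul, LinearMap.smul_apply]
    exact Submodule.smul_mem _ _ (Submodule.subset_span ⟨j :: w, v, by simp⟩)
  rw [eq_top_iff, ← hw]
  refine Submodule.span_le.2 ?_
  rintro t ⟨w, v, rfl⟩
  refine (Submodule.span_le.2 ?_ : Fr.reduced z ρ _ _ ≤ P)
    (Fr.filt_le_reduced h2 hρ _ _ (Fr.word_mem_filt (Nat.lt_succ_self _) rfl v))
  rintro t ⟨s, v, hs, -, -, rfl⟩
  exact h s hs v

/-- The functional `topCoeff` generates the dual of the induced module. -/
theorem exists_topCoeff_ne_zero (h2 : (2 : F) ≠ 0) {S : Superspace F V}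
    (hρ : G.IsGradedAction S ρ) {t : G.Ind z ρ} (ht : t ≠ 0) :
    ∃ w, Fr.topCoeff h2 hρ (Fr.word z ρ w t) ≠ 0 := by
  classical
  obtain ⟨f, hf⟩ : ∃ f : Multiset J → V,
      t = ∑ s ∈ Fr.top.powerset.toFinset, Fr.word z ρ (s.sort (· ≤ ·)) (G.indOne z ρ (f s)) := by
    let P : Submodule F (G.Ind z ρ) :=
      { carrier := {t | ∃ f : Multiset J → V,
          t = ∑ s ∈ Fr.top.powerset.toFinset, Fr.word z ρ (s.sort (· ≤ ·)) (G.indOne z ρ (f s))}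
        add_mem' := by
          rintro _ _ ⟨f, rfl⟩ ⟨g, rfl⟩
          exact ⟨f + g, by simp only [Pi.add_apply, map_add, Finset.sum_add_distrib]⟩
        zero_mem' := ⟨0, by simp only [Pi.zero_apply, map_zero, Finset.sum_const_zero]⟩
        smul_mem' := by
          rintro c _ ⟨f, rfl⟩
          exact ⟨c • f, by simp only [Pi.smul_apply, map_smul, Finset.smul_sum]⟩ }
    have hP : P = ⊤ := Fr.ind_induction_word h2 hρ P fun s hs v => by
      refine ⟨Pi.single s v, ?_⟩
      rw [Finset.sum_eq_single s]
      · rw [Pi.single_eq_same]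
      · intro s' _ hs'
        rw [Pi.single_eq_of_ne hs', map_zero, map_zero]
      · intro h
        exact absurd (by simpa using hs) h
    have : t ∈ P := by rw [hP]; trivial
    exact this
  have hne : (Fr.top.powerset.toFinset.filter fun s => f s ≠ 0).Nonempty := by
    rw [Finset.nonempty_iff_ne_empty]
    intro h
    refine ht (hf.trans (Finset.sum_eq_zero fun s hs => ?_))
    have := Finset.filter_eq_empty_iff.1 h hs
    rw [not_not.1 this, map_zero, map_zero]
  -- A term with as many letters as possible is completed to the largest monomial by its complement.
  -- Any other term then gives a word that is not longer than the largest monomial and has a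
  -- different content, so its coefficient is zero.
  obtain ⟨s, hs, hmax⟩ := Finset.exists_max_image _ Multiset.card hne
  rw [Finset.mem_filter, Multiset.mem_toFinset, Multiset.mem_powerset] at hs
  refine ⟨(Fr.top - s).sort (· ≤ ·), ?_⟩
  have hcard := congrArg Multiset.card (tsub_add_cancel_of_le hs.1)
  rw [Multiset.card_add] at hcard
  have hcoe : ∀ s' : Multiset J,
      (((Fr.top - s).sort (· ≤ ·) ++ s'.sort (· ≤ ·) : List J) : Multiset J) =
      Fr.top - s + s' := fun s' => by
    rw [← Multiset.coe_add, Multiset.sort_eq, Multiset.sort_eq]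
  obtain ⟨η, hη, hw⟩ := Fr.word_top_perm (z := z) h2 hρ
    ((hcoe s).trans (tsub_add_cancel_of_le hs.1))
  rw [hf, map_sum, map_sum, Finset.sum_eq_single s]
  · rw [← Module.End.mul_apply, ← word_append, hw, map_smul, topCoeff_top]
    rcases hη with rfl | rfl
    · simpa using hs.2
    · simpa using hs.2
  · intro s' hs' hss'
    by_cases h0 : f s' = 0
    · rw [h0]; simp
    rw [← Module.End.mul_apply, ← word_append]
    refine Fr.topCoeff_word_eq_zero h2 hρ ?_ ?_ _
    · have := hmax s' (Finset.mem_filter.2 ⟨hs', h0⟩)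
      rw [List.length_append, Multiset.length_sort, Multiset.length_sort]
      omega
    · rw [hcoe]
      intro h
      exact hss' (add_left_cancel (h.trans (tsub_add_cancel_of_le hs.1).symm))
  · intro h
    exact absurd (by simpa using hs.1) h

end Frame
end ZGradedLieSuperalgebra
end SuperLie

/-! ### Parity on the induced module. -/

namespace SuperLie

theorem Superspace.parityOp_of_mem {F V : Type*} [Field F] [AddCommGroup V] [Module F V]
    (S : Superspace F V) {a : ZMod 2} {v : V} (hv : v ∈ S.par a) :
    S.parityOp v = sgn F 1 a • v := by
  rw [Superspace.parityOp, LinearMap.sub_apply, S.proj_of_mem 0 a v hv, S.proj_of_mem 1 a v hv]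
  rcases zmod_two_cases a with rfl | rfl <;> simp

/-- Every vector is a sum of homogeneous vectors. -/
theorem Superspace.hom_induction {F V : Type*} [Field F] [AddCommGroup V] [Module F V]
    (S : Superspace F V) {P : V → Prop} (add : ∀ v w, P v → P w → P (v + w))
    (hom : ∀ a, ∀ v ∈ S.par a, P v) (v : V) : P v := by
  rw [← S.proj_add_proj v]
  exact add _ _ (hom _ _ (S.proj_mem _ _)) (hom _ _ (S.proj_mem _ _))

namespace ZGradedLieSuperalgebra

variable {F L V : Type*} [Field F] [AddCommGroup L] [Module F L] [AddCommGroup V] [Module F V]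
variable {G : ZGradedLieSuperalgebra F L}
variable {k : ℕ} {z : Fin k → G.Env} {ρ : G.nonneg →ₗ[F] Module.End F V}

section Parity

variable {S : Superspace F V}

variable (z ρ S) in
theorem indOne_mem_indPar {c : ZMod 2} {v : V} (hv : v ∈ S.par c) :
    G.indOne z ρ v ∈ G.indPar z ρ S c :=
  Submodule.subset_span ⟨0, c, 1, v, Submodule.subset_span LieSuperalgebra.IsMonomial.one, hv,
    zero_add c, rfl⟩

theorem indAct_mem_indPar {a c : ZMod 2} {x : L} (hx : x ∈ G.par a) {t : G.Ind z ρ}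
    (ht : t ∈ G.indPar z ρ S c) : G.indAct z ρ x t ∈ G.indPar z ρ S (a + c) := by
  refine (Submodule.span_le.2 ?_ : G.indPar z ρ S c ≤
    (G.indPar z ρ S (a + c)).comap (G.indAct z ρ x)) ht
  rintro t ⟨b, e, u, v, hu, hv, rfl, rfl⟩
  refine Submodule.subset_span ⟨a + b, e, G.envι x * u, v, ?_, hv, add_assoc a b e, rfl⟩
  refine (Submodule.span_le.2 ?_ : G.envPar b ≤
    (G.envPar (a + b)).comap (LinearMap.mulLeft F (G.envι x))) hu
  exact fun u hu => Submodule.subset_span (LieSuperalgebra.IsMonomial.mul a b x u hx hu)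

theorem indPar_le (Q : ZMod 2 → Submodule F (G.Ind z ρ))
    (h1 : ∀ c, ∀ v ∈ S.par c, G.indOne z ρ v ∈ Q c)
    (hact : ∀ a c, ∀ x ∈ G.par a, ∀ t ∈ Q c, G.indAct z ρ x t ∈ Q (a + c)) (a : ZMod 2) :
    G.indPar z ρ S a ≤ Q a := by
  refine Submodule.span_le.2 ?_
  rintro t ⟨b, c, u, v, hu, hv, rfl, rfl⟩
  refine (Submodule.span_le.2 ?_ : G.envPar b ≤
    (Q (b + c)).comap ((G.indRel z ρ).mkQ ∘ₗ (TensorProduct.mk F G.Env V).flip v)) hu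
  clear hu u
  intro u hu
  change G.IsMonomial u b at hu
  induction hu with
  | one => rw [zero_add]; exact h1 c v hv
  | mul a b x u hx hu ih =>
    rw [add_assoc]
    exact hact a _ x hx _ ih

theorem indPar_sup : G.indPar z ρ S 0 ⊔ G.indPar z ρ S 1 = ⊤ := by
  have hle : ∀ a, G.indPar z ρ S a ≤ G.indPar z ρ S 0 ⊔ G.indPar z ρ S 1 := fun a => by
    rcases zmod_two_cases a with rfl | rfl
    · exact le_sup_left
    · exact le_sup_right
  refine G.ind_induction _ (fun v => ?_) fun x t ht => ?_
  · exact S.hom_induction (P := fun v => G.indOne z ρ v ∈ _)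
      (fun v w hv hw => by rw [map_add]; exact Submodule.add_mem _ hv hw)
      (fun a v hv => hle a (G.indOne_mem_indPar z ρ S hv)) v
  · refine G.hom_induction (P := fun x => G.indAct z ρ x t ∈ _)
      (fun v w hv hw => by rw [map_add]; exact Submodule.add_mem _ hv hw) (fun a x hx => ?_) x
    obtain ⟨t0, h0, t1, h1, rfl⟩ := Submodule.mem_sup.1 ht
    rw [map_add]
    exact Submodule.add_mem _ (hle _ (G.indAct_mem_indPar hx h0))
      (hle _ (G.indAct_mem_indPar hx h1))

variable (G) in
/-- The parity automorphism of `U(L)`. -/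
noncomputable def envParityOp : G.Env →ₐ[F] G.Env :=
  G.envLift (G.envι ∘ₗ G.toSuperspace.parityOp) fun a c x hx y hy => by
    simp only [LinearMap.comp_apply]
    rw [G.parityOp_of_mem hx, G.parityOp_of_mem hy, G.parityOp_of_mem (G.bracket_mem a c x hx y hy),
      map_smul, map_smul, map_smul, smul_mul_smul_comm, smul_mul_smul_comm, G.envι_mul_envι hx hy,
      sgn_add_right, smul_add, mul_comm (sgn F 1 c), smul_comm (sgn F a c)]

theorem parityOp_mem_nonneg (x : G.nonneg) : G.toSuperspace.parityOp (x : L) ∈ G.nonneg :=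
  G.nonneg_le_comap_parityOp x.2

theorem IsGradedAction.parityOp_apply (hρ : G.IsGradedAction S ρ) (x : G.nonneg) (v : V) :
    S.parityOp (ρ x v) = ρ ⟨_, G.parityOp_mem_nonneg x⟩ (S.parityOp v) := by
  have hK : ∀ a, ∀ x ∈ G.nonneg, G.proj a x ∈ G.nonneg := by
    intro a
    change G.nonneg ≤ G.nonneg.comap (G.proj a)
    exact iSup₂_le fun i hi x hx => G.deg_le_nonneg i hi (G.deg_proj i a x hx)
  have hom : ∀ a, ∀ x : G.nonneg, (x : L) ∈ G.par a →
      S.parityOp (ρ x v) = ρ ⟨_, G.parityOp_mem_nonneg x⟩ (S.parityOp v) := by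
    intro a x hx
    have hx' : (⟨_, G.parityOp_mem_nonneg x⟩ : G.nonneg) = sgn F 1 a • x :=
      Subtype.ext (G.parityOp_of_mem hx)
    rw [hx']
    refine S.hom_induction (P := fun v => S.parityOp (ρ x v) = ρ (sgn F 1 a • x) (S.parityOp v))
      (fun v w hv hw => by simp only [map_add, hv, hw]) (fun c v hv => ?_) v
    rw [S.parityOp_of_mem hv, S.parityOp_of_mem (hρ.mem a c x hx v hv), sgn_add_right, map_smul,
      map_smul, LinearMap.smul_apply, smul_smul, mul_comm]
  have hx : x = ⟨_, hK 0 x x.2⟩ + ⟨_, hK 1 x x.2⟩ := Subtype.ext (G.proj_add_proj x).symm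
  have h0 := hom 0 ⟨_, hK 0 x x.2⟩ (G.proj_mem 0 x)
  have h1 := hom 1 ⟨_, hK 1 x x.2⟩ (G.proj_mem 1 x)
  have hP : (⟨_, G.parityOp_mem_nonneg x⟩ : G.nonneg) =
      ⟨_, G.parityOp_mem_nonneg ⟨_, hK 0 x x.2⟩⟩ + ⟨_, G.parityOp_mem_nonneg ⟨_, hK 1 x x.2⟩⟩ := by
    refine Subtype.ext ?_
    change G.parityOp (x : L) = G.parityOp (G.proj 0 x) + G.parityOp (G.proj 1 x)
    rw [← map_add, G.proj_add_proj]
  rw [hP, map_add, LinearMap.add_apply, ← h0, ← h1]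
  nth_rewrite 1 [hx]
  rw [map_add, LinearMap.add_apply, map_add]

namespace Frame

variable {J : Type*} [LinearOrder J] [Fintype J] (Fr : G.Frame z J)

/-- The parity operator of the induced module. -/
noncomputable def indParityOp (hρ : G.IsGradedAction S ρ) : Module.End F (G.Ind z ρ) :=
  (G.indRel z ρ).mapQ (G.indRel z ρ)
    (TensorProduct.map G.envParityOp.toLinearMap S.parityOp) <| Submodule.span_le.2 <| by
    rintro t (⟨u, x, v, rfl⟩ | ⟨u, i, v, rfl⟩)
    · refine Submodule.subset_span (Or.inl ⟨G.envParityOp u, ⟨_, G.parityOp_mem_nonneg x⟩,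
        S.parityOp v, ?_⟩)
      simp [hρ.parityOp_apply, envParityOp]
    · refine Submodule.subset_span (Or.inr ⟨G.envParityOp u, i, S.parityOp v, ?_⟩)
      obtain ⟨j, -, h0, hz⟩ := Fr.exists_letter i
      have hm := Fr.mem_par j
      rw [h0] at hm
      simp [hz, envParityOp, G.parityOp_of_mem hm]

theorem indParityOp_one (hρ : G.IsGradedAction S ρ) (v : V) :
    Fr.indParityOp hρ (G.indOne z ρ v) = G.indOne z ρ (S.parityOp v) := by
  change (G.indRel z ρ).mkQ (G.envParityOp 1 ⊗ₜ[F] S.parityOp v) = _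
  rw [map_one]; rfl

theorem indParityOp_indAct (hρ : G.IsGradedAction S ρ) (x : L) (t : G.Ind z ρ) :
    Fr.indParityOp hρ (G.indAct z ρ x t) =
      G.indAct z ρ (G.parityOp x) (Fr.indParityOp hρ t) := by
  refine LinearMap.congr_fun (f := Fr.indParityOp hρ * G.indAct z ρ x)
    (g := G.indAct z ρ (G.parityOp x) * Fr.indParityOp hρ) (G.ind_hom_ext fun u v => ?_) t
  change (G.indRel z ρ).mkQ (G.envParityOp (G.envι x * u) ⊗ₜ[F] S.parityOp v) =
    (G.indRel z ρ).mkQ ((G.envι (G.parityOp x) * G.envParityOp u) ⊗ₜ[F] S.parityOp v)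
  rw [map_mul]
  simp [envParityOp]

theorem indParityOp_of_mem (hρ : G.IsGradedAction S ρ) {a : ZMod 2} {t : G.Ind z ρ}
    (ht : t ∈ G.indPar z ρ S a) : Fr.indParityOp hρ t = sgn F 1 a • t := by
  refine G.indPar_le (S := S)
    (fun a => LinearMap.eqLocus (Fr.indParityOp hρ) (sgn F 1 a • LinearMap.id)) ?_ ?_ a ht
  · intro c v hv
    rw [LinearMap.mem_eqLocus, indParityOp_one, S.parityOp_of_mem hv, map_smul]; rfl
  · intro a c x hx t ht
    rw [LinearMap.mem_eqLocus] at ht ⊢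
    rw [indParityOp_indAct, ht, G.parityOp_of_mem hx]
    simp [sgn_add_right, smul_smul, mul_comm]

theorem word_mem_indPar (w : List J) {c : ZMod 2} {t : G.Ind z ρ} (ht : t ∈ G.indPar z ρ S c) :
    Fr.word z ρ w t ∈ G.indPar z ρ S ((w.map Fr.pa).sum + c) := by
  induction w with
  | nil => simpa using ht
  | cons j w ih =>
    rw [word_cons, Module.End.mul_apply, List.map_cons, List.sum_cons, add_assoc]
    exact G.indAct_mem_indPar (Fr.mem_par j) ih

theorem indParityOp_word (hρ : G.IsGradedAction S ρ) (w : List J) (t : G.Ind z ρ) :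
    Fr.indParityOp hρ (Fr.word z ρ w t) =
      sgn F 1 (w.map Fr.pa).sum • Fr.word z ρ w (Fr.indParityOp hρ t) := by
  induction w with
  | nil => simp
  | cons j w ih =>
    rw [word_cons, Module.End.mul_apply, indParityOp_indAct, ih, G.parityOp_of_mem (Fr.mem_par j)]
    simp [sgn_add_right, smul_smul, mul_comm]

end Frame

end Parity

end ZGradedLieSuperalgebra
end SuperLie

/-! ### The projection onto degree zero and the supertrace character. -/

namespace SuperLie
namespace ZGradedLieSuperalgebra

variable {F L V : Type*} [Field F] [AddCommGroup L] [Module F L] [AddCommGroup V] [Module F V]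
variable {G : ZGradedLieSuperalgebra F L}
variable {k : ℕ} {z : Fin k → G.Env} {ρ : G.nonneg →ₗ[F] Module.End F V}

section DegreeZero

theorem zmodTwo_ne {a c : ZMod 2} (h : a ≠ c) : c = a + 1 := by revert a c; decide

variable (G) in
/-- The projection of `L` onto `L_0`. -/
noncomputable abbrev zeroProj : L →ₗ[F] G.deg 0 := gradedProj G.deg_isInternal 0

theorem zeroProj_of_mem (x : G.deg 0) : G.zeroProj x = x :=
  Subtype.ext ((gradedProj_of_mem G.deg_isInternal 0 0 x x.2).trans (if_pos rfl))

theorem zeroProj_of_mem_deg {i : ℤ} (hi : i ≠ 0) {x : L} (hx : x ∈ G.deg i) :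
    G.zeroProj x = 0 :=
  Subtype.ext ((gradedProj_of_mem G.deg_isInternal 0 i x hx).trans (if_neg hi))

theorem deg_induction {P : L → Prop} (add : ∀ x y, P x → P y → P (x + y)) (zero : P 0)
    (hom : ∀ i, ∀ x ∈ G.deg i, P x) (x : L) : P x := by
  have hx : x ∈ ⨆ i, G.deg i := by
    rw [G.deg_isInternal.submodule_iSup_eq_top]; trivial
  induction hx using Submodule.iSup_induction' with
  | mem i x hx => exact hom i x hx
  | zero => exact zero
  | add x y _ _ hx hy => exact add x y hx hy

theorem nonneg_induction {P : L → Prop} (add : ∀ x y, P x → P y → P (x + y)) (zero : P 0)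
    (hom : ∀ i, 0 ≤ i → ∀ x ∈ G.deg i, P x) {x : L} (hx : x ∈ G.nonneg) : P x := by
  unfold nonneg at hx
  rw [iSup_subtype'] at hx
  induction hx using Submodule.iSup_induction' with
  | mem i x hx => exact hom i.1 i.2 x hx
  | zero => exact zero
  | add x y _ _ hx hy => exact add x y hx hy

theorem proj_zeroProj (a : ZMod 2) (x : L) :
    G.proj a (G.zeroProj x) = G.zeroProj (G.proj a x) := by
  refine G.deg_induction (P := fun x => G.proj a (G.zeroProj x) = G.zeroProj (G.proj a x))
    (fun x y hx hy => by simp only [map_add, Submodule.coe_add, hx, hy]) (by simp)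
    (fun i x hx => ?_) x
  by_cases hi : i = 0
  · subst hi
    have h1 := G.zeroProj_of_mem ⟨x, hx⟩
    have h2 := G.zeroProj_of_mem ⟨_, G.deg_proj 0 a x hx⟩
    simp only at h1 h2
    rw [h1, h2]
  · rw [zeroProj_of_mem_deg hi hx, zeroProj_of_mem_deg hi (G.deg_proj i a x hx)]
    simp

theorem zeroProj_mem_par {a : ZMod 2} {x : L} (hx : x ∈ G.par a) :
    (G.zeroProj x : L) ∈ G.par a := by
  have h := G.proj_zeroProj a x
  rw [G.proj_of_mem a a x hx, if_pos rfl] at h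
  rw [← h]
  exact G.proj_mem _ _

theorem zeroProj_bracket {x y : L} (hx : x ∈ G.nonneg) (hy : y ∈ G.nonneg) :
    (G.zeroProj (G.bracket x y) : L) = G.bracket (G.zeroProj x) (G.zeroProj y) := by
  refine G.nonneg_induction (P := fun x => (G.zeroProj (G.bracket x y) : L) =
    G.bracket (G.zeroProj x) (G.zeroProj y)) (fun x y hx hy => ?_) (by simp)
    (fun i hi x hx => ?_) hx
  · simp only [map_add, LinearMap.add_apply, Submodule.coe_add, hx, hy]
  refine G.nonneg_induction (P := fun y => (G.zeroProj (G.bracket x y) : L) =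
    G.bracket (G.zeroProj x) (G.zeroProj y)) (fun x y hx hy => ?_) (by simp)
    (fun j hj y hy => ?_) hy
  · simp only [map_add, Submodule.coe_add, hx, hy]
  have hb := G.deg_bracket i j x hx y hy
  by_cases hij : i + j = 0
  · obtain rfl : i = 0 := by omega
    obtain rfl : j = 0 := by omega
    have h1 := G.zeroProj_of_mem ⟨x, hx⟩
    have h2 := G.zeroProj_of_mem ⟨y, hy⟩
    have h3 := G.zeroProj_of_mem ⟨_, G.deg_bracket 0 0 x hx y hy⟩
    simp only at h1 h2 h3
    rw [h1, h2, h3]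
  · rw [zeroProj_of_mem_deg hij hb]
    by_cases hi0 : i = 0
    · have hj0 : j ≠ 0 := by omega
      rw [zeroProj_of_mem_deg hj0 hy]; simp
    · rw [zeroProj_of_mem_deg hi0 hx]; simp

end DegreeZero

namespace Frame

variable {J : Type*} [LinearOrder J] [Fintype J] (Fr : G.Frame z J)

/-- The diagonal structure constants. -/
noncomputable def diag (x : L) (j : J) : F := Fr.b.repr (G.bracket x (Fr.b j)) j

theorem diag_eq_zero_of_deg {i : ℤ} (hi : i ≠ 0) {x : L} (hx : x ∈ G.deg i) (j : J) :
    Fr.diag x j = 0 :=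
  Fr.repr_deg (G.deg_bracket _ _ _ hx _ (Fr.mem_deg j)) (by omega)

theorem diag_eq_zero_of_odd {x : L} (hx : x ∈ G.par 1) (j : J) : Fr.diag x j = 0 :=
  Fr.repr_par (G.bracket_mem _ _ _ hx _ (Fr.mem_par j)) (by
    intro h
    exact one_ne_zero (left_eq_add.1 ((add_comm (1 : ZMod 2) _ ▸ h))))

/-- The supertrace on `L / K` in terms of the structure constants. -/
theorem sigma_eq_sum (x : G.nonneg) :
    G.sigma x = ∑ j, if Fr.d j < 0 then sgn F 1 (Fr.pa j) * Fr.diag x j else 0 := by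
  classical
  let f : Module.End F L := G.parityOp ∘ₗ G.bracket x
  let pr : Module.End F L := Fr.b.constr F fun j => if Fr.d j < 0 then Fr.b j else 0
  have hpr : ∀ j, pr (Fr.b j) = if Fr.d j < 0 then Fr.b j else 0 := fun j =>
    Fr.b.constr_basis F _ j
  have hker : G.nonneg ≤ LinearMap.ker pr := fun y hy => by
    rw [LinearMap.mem_ker, ← Fr.b.sum_repr y, map_sum]
    refine Finset.sum_eq_zero fun j _ => ?_
    rw [map_smul, hpr]
    split_ifs with h
    · rw [Fr.repr_nonneg hy h, zero_smul]
    · rw [smul_zero]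
  let s : (L ⧸ G.nonneg) →ₗ[F] L := G.nonneg.liftQ pr hker
  have hs : G.nonneg.mkQ ∘ₗ pr = G.nonneg.mkQ := by
    refine Fr.b.ext fun j => ?_
    rw [LinearMap.comp_apply, hpr]
    split_ifs with h
    · rfl
    · rw [map_zero, eq_comm]
      exact (Submodule.Quotient.mk_eq_zero _).2 (Fr.b_mem_nonneg (not_lt.1 h))
  have hT : (G.quotParityOp * G.quotRep x) = (G.nonneg.mkQ ∘ₗ f) ∘ₗ s := by
    refine Submodule.linearMap_qext _ (LinearMap.ext fun y => ?_)
    have h1 : G.nonneg.mkQ (pr y) = G.nonneg.mkQ y := LinearMap.congr_fun hs y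
    have h2 : pr y - y ∈ G.nonneg := (Submodule.Quotient.eq _).1 h1
    change G.nonneg.mkQ (f y) = G.nonneg.mkQ (f (pr y))
    rw [eq_comm]
    refine (Submodule.Quotient.eq _).2 ?_
    rw [← map_sub]
    exact G.nonneg_le_comap_parityOp (G.nonneg_le_comap_bracket x x.2 h2)
  -- The map `s` lifts `L / K` to the span of the letters of negative degree, and cyclicity of the
  -- trace moves the computation from the quotient to `L`.
  have htr : G.sigma x = LinearMap.trace F L (f ∘ₗ pr) := by
    change LinearMap.trace F _ (G.quotParityOp * G.quotRep x) = _
    rw [hT]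
    have : Module.Finite F L := Module.Finite.of_basis Fr.b
    rw [LinearMap.comp_assoc, LinearMap.trace_comp_comm' (f ∘ₗ s) G.nonneg.mkQ]
    rfl
  have hP : ∀ y j, Fr.b.repr (G.parityOp y) j = sgn F 1 (Fr.pa j) * Fr.b.repr y j := by
    intro y j
    refine G.hom_induction (P := fun y => Fr.b.repr (G.parityOp y) j =
      sgn F 1 (Fr.pa j) * Fr.b.repr y j) (fun v w hv hw => ?_) (fun a y hy => ?_) y
    · simp only [map_add, Finsupp.add_apply, hv, hw, mul_add]
    · rw [G.parityOp_of_mem hy, map_smul, Finsupp.smul_apply, smul_eq_mul]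
      by_cases h : Fr.pa j = a
      · rw [h]
      · rw [Fr.repr_par hy h]; simp
  rw [htr, LinearMap.trace_eq_matrix_trace F Fr.b, Matrix.trace]
  refine Finset.sum_congr rfl fun j _ => ?_
  rw [Matrix.diag_apply, LinearMap.toMatrix_apply, LinearMap.comp_apply, hpr]
  split_ifs with h
  · exact hP _ _
  · simp

theorem sigma_eq_zero_of_pos (Fr : G.Frame z J) {i : ℤ} (hi : i ≠ 0) {x : G.nonneg}
    (hx : (x : L) ∈ G.deg i) :
    G.sigma x = 0 := by
  rw [Fr.sigma_eq_sum]
  exact Finset.sum_eq_zero fun j _ => by rw [Fr.diag_eq_zero_of_deg hi hx]; simp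

theorem sigma_eq_zero_of_odd (Fr : G.Frame z J) {x : G.nonneg} (hx : (x : L) ∈ G.par 1) :
    G.sigma x = 0 := by
  rw [Fr.sigma_eq_sum]
  exact Finset.sum_eq_zero fun j _ => by rw [Fr.diag_eq_zero_of_odd hx]; simp

/-- For equal parities this is the vanishing of the supertrace on supercommutators: the parity
operator commutes with the action up to the sign that turns it into the vanishing of a trace on
commutators. For different parities the bracket is odd and has no diagonal part. Consequently the
twist by `σ` is again an action. -/
theorem sigma_bracket (Fr : G.Frame z J) {a c : ZMod 2} {x y : G.nonneg} (hx : (x : L) ∈ G.par a)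
    (hy : (y : L) ∈ G.par c) :
    G.sigma ⟨G.bracket x y, G.nonneg_le_comap_bracket x x.2 y.2⟩ = 0 := by
  by_cases hac : a = c
  · subst hac
    have hq : G.quotRep ⟨G.bracket x y, G.nonneg_le_comap_bracket x x.2 y.2⟩ =
        G.quotRep x * G.quotRep y - sgn F a a • (G.quotRep y * G.quotRep x) := by
      refine Submodule.linearMap_qext _ (LinearMap.ext fun w => ?_)
      change G.nonneg.mkQ (G.bracket (G.bracket x y) w) =
        G.nonneg.mkQ (G.bracket x (G.bracket y w)) -
          sgn F a a • G.nonneg.mkQ (G.bracket y (G.bracket x w))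
      rw [G.jacobi a a x hx y hy w, map_add, map_smul, add_sub_cancel_right]
    have hP : G.quotParityOp * G.quotRep x = sgn F 1 a • (G.quotRep x * G.quotParityOp) := by
      refine Submodule.linearMap_qext _ (LinearMap.ext fun w => ?_)
      change G.nonneg.mkQ (G.parityOp (G.bracket x w)) =
        sgn F 1 a • G.nonneg.mkQ (G.bracket x (G.parityOp w))
      refine G.hom_induction (P := fun w => G.nonneg.mkQ (G.parityOp (G.bracket x w)) =
        sgn F 1 a • G.nonneg.mkQ (G.bracket x (G.parityOp w)))
        (fun v w hv hw => by simp only [map_add, hv, hw, smul_add]) (fun c w hw => ?_) w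
      rw [G.parityOp_of_mem hw, G.parityOp_of_mem (G.bracket_mem a c x hx w hw), sgn_add_right]
      simp [smul_smul]
    change LinearMap.trace F _ (G.quotParityOp * G.quotRep _) = 0
    rw [hq, mul_sub, mul_smul_comm, ← mul_assoc, map_sub, map_smul, hP, smul_mul_assoc, map_smul,
      mul_assoc, LinearMap.trace_mul_comm, mul_assoc]
    rcases zmod_two_cases a with rfl | rfl <;> simp
  · refine Fr.sigma_eq_zero_of_odd ?_
    have := G.bracket_mem a c x hx y hy
    rwa [zmodTwo_ne hac, ← add_assoc, CharTwo.add_self_eq_zero, zero_add] at this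

/-- The action of `K` on `V_σ`. -/
theorem isGradedAction_twist (Fr : G.Frame z J) (M : Supermodule G.zeroPart V) :
    G.IsGradedAction M.toSuperspace (G.twistAct (G.extendAct M.act)) := by
  have happ : ∀ (x : G.nonneg) v, G.twistAct (G.extendAct M.act) x v =
      M.act (G.zeroProj x) v + G.sigma x • v := fun x v => rfl
  refine ⟨fun a c x hx v hv => ?_, fun a c x y hx hy v => ?_, fun i hi x hx => ?_⟩
  · rw [happ]
    refine Submodule.add_mem _ (M.act_mem a c _ (zeroProj_mem_par hx) v hv) ?_
    rcases zmod_two_cases a with rfl | rfl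
    · rw [zero_add]; exact Submodule.smul_mem _ _ hv
    · rw [Fr.sigma_eq_zero_of_odd hx, zero_smul]; exact Submodule.zero_mem _
  · simp only [happ]
    have hb : G.zeroProj (G.bracket x y) =
        G.zeroPart.bracket (G.zeroProj x) (G.zeroProj y) :=
      Subtype.ext (G.zeroProj_bracket x.2 y.2)
    rw [hb, M.act_bracket a c _ (zeroProj_mem_par hx) _ (zeroProj_mem_par hy),
      Fr.sigma_bracket hx hy]
    rcases zmod_two_cases a with rfl | rfl
    · simp [smul_comm (G.sigma x)]
      abel
    · rw [Fr.sigma_eq_zero_of_odd hx]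
      rcases zmod_two_cases c with rfl | rfl
      · simp
      · rw [Fr.sigma_eq_zero_of_odd hy]; simp
  · refine LinearMap.ext fun v => ?_
    rw [happ, zeroProj_of_mem_deg hi.ne' hx, Fr.sigma_eq_zero_of_pos hi.ne' hx]
    simp

end Frame

end ZGradedLieSuperalgebra
end SuperLie

/-! ### The action on the largest monomial and the cancellation of the twist. -/

namespace SuperLie
namespace ZGradedLieSuperalgebra

variable {F L V : Type*} [Field F] [AddCommGroup L] [Module F L] [AddCommGroup V] [Module F V]
variable {G : ZGradedLieSuperalgebra F L}
variable {k : ℕ} {z : Fin k → G.Env} {ρ : G.nonneg →ₗ[F] Module.End F V}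

namespace Frame

variable {J : Type*} [LinearOrder J] [Fintype J] (Fr : G.Frame z J)

/-- `w'` arises from `w` by replacing a letter by another one of the same degree. -/
def Replaced (w w' : List J) : Prop :=
  ∃ l₁ l₂ i j, w = l₁ ++ i :: l₂ ∧ w' = l₁ ++ j :: l₂ ∧ j ≠ i ∧ Fr.d j = Fr.d i

/-- The commutation of an element of `L_0` with a product of letters. -/
theorem indAct_word_sub_mem {a : ZMod 2} {x : L} (hx0 : x ∈ G.deg 0) (hx : x ∈ G.par a)
    (w : List J) (t : G.Ind z ρ) :
    G.indAct z ρ x (Fr.word z ρ w t) -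
        sgn F a (w.map Fr.pa).sum • Fr.word z ρ w (G.indAct z ρ x t) -
        (w.map (Fr.diag x)).sum • Fr.word z ρ w t ∈
      Submodule.span F {s | ∃ w', Fr.Replaced w w' ∧ s = Fr.word z ρ w' t} := by
  induction w with
  | nil => simp
  | cons i w ih =>
    set E := Submodule.span F {s | ∃ w', Fr.Replaced (i :: w) w' ∧ s = Fr.word z ρ w' t}
    have hE : ∀ s ∈ Submodule.span F {s | ∃ w', Fr.Replaced w w' ∧ s = Fr.word z ρ w' t},
        G.indAct z ρ (Fr.b i) s ∈ E := by
      intro s hs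
      refine (Submodule.span_le.2 ?_ : Submodule.span F _ ≤ E.comap (G.indAct z ρ (Fr.b i))) hs
      rintro s ⟨_, ⟨l₁, l₂, i', j, rfl, rfl, hj, hd⟩, rfl⟩
      exact Submodule.subset_span ⟨i :: (l₁ ++ j :: l₂), ⟨i :: l₁, l₂, i', j, rfl, rfl, hj, hd⟩,
        by simp⟩
    have hbr : G.indAct z ρ (G.bracket x (Fr.b i)) (Fr.word z ρ w t) -
        Fr.diag x i • Fr.word z ρ (i :: w) t ∈ E := by
      have hdeg := G.deg_bracket 0 _ x hx0 _ (Fr.mem_deg i)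
      rw [zero_add] at hdeg
      have hexp : G.indAct z ρ (G.bracket x (Fr.b i)) (Fr.word z ρ w t) =
          ∑ j, Fr.b.repr (G.bracket x (Fr.b i)) j • G.indAct z ρ (Fr.b j) (Fr.word z ρ w t) := by
        conv_lhs => rw [← Fr.b.sum_repr (G.bracket x (Fr.b i))]
        simp only [map_sum, map_smul, LinearMap.sum_apply, LinearMap.smul_apply]
      rw [hexp, ← Finset.add_sum_erase _ _ (Finset.mem_univ i), diag, word_cons,
        Module.End.mul_apply, add_sub_cancel_left]
      refine Submodule.sum_mem _ fun j hj => ?_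
      by_cases hd : Fr.d j = Fr.d i
      · refine Submodule.smul_mem _ _ (Submodule.subset_span ⟨j :: w, ⟨[], w, i, j, rfl, rfl,
          (Finset.mem_erase.1 hj).1, hd⟩, by simp⟩)
      · rw [Fr.repr_deg hdeg hd, zero_smul]; exact Submodule.zero_mem _
    -- An odd element has no diagonal structure constants, so the sign picked up in passing the
    -- letter `i` does not affect the diagonal sum.
    have hsgn : sgn F a (Fr.pa i) • (w.map (Fr.diag x)).sum = (w.map (Fr.diag x)).sum := by
      rcases zmod_two_cases a with rfl | rfl
      · simp
      · have : w.map (Fr.diag x) = w.map fun _ => 0 :=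
          List.map_congr_left fun j _ => Fr.diag_eq_zero_of_odd hx j
        rw [this]; simp
    have h := Submodule.add_mem _ (Submodule.smul_mem _ (sgn F a (Fr.pa i)) (hE _ ih)) hbr
    convert h using 1
    simp only [word_cons, Module.End.mul_apply, List.map_cons, List.sum_cons, map_sub, map_smul,
      smul_sub, smul_smul, add_smul, sgn_add_right, G.indAct_comm hx (Fr.mem_par i)]
    rw [smul_eq_mul] at hsgn
    rw [hsgn]
    abel

/-- The replaced word has the same degree and length as the largest monomial, but the inserted
letter exceeds its bound. It is thus a combination of shorter monomials of the lowest degree, of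
which there are none. -/
theorem word_replaced_top (h2 : (2 : F) ≠ 0) {S : Superspace F V} (hρ : G.IsGradedAction S ρ)
    {w' : List J} (h : Fr.Replaced Fr.top.sort w') (v : V) :
    Fr.word z ρ w' (G.indOne z ρ v) = 0 := by
  obtain ⟨l₁, l₂, i, j, hw, rfl, hj, hd⟩ := h
  have hcount : (Fr.top.sort (· ≤ ·)).count j = Fr.bound j := by
    rw [← Multiset.coe_count, Multiset.sort_eq, count_top]
  have hlen : (Fr.top.sort (· ≤ ·)).length = Fr.top.card := Multiset.length_sort _
  have hsum : ((Fr.top.sort (· ≤ ·)).map Fr.d).sum = (Fr.top.map Fr.d).sum := by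
    rw [← Multiset.sum_coe, ← Multiset.map_coe, Multiset.sort_eq]
  rw [hw] at hcount hlen hsum
  have h1 : Fr.bound j < (l₁ ++ j :: l₂).count j := by
    rw [← hcount, List.count_append, List.count_append, List.count_cons_self,
      List.count_cons_of_ne hj.symm]
    omega
  have h3 := Fr.filt_le_reduced h2 hρ _ _ (Fr.word_overflow (z := z) h2 hρ h1 v)
  have hsum' : ((l₁ ++ j :: l₂).map Fr.d).sum = (Fr.top.map Fr.d).sum := by
    rw [← hsum]; simp [hd]
  rw [hsum', Fr.reduced_eq_bot (by rw [← hlen]; simp)] at h3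
  exact (Submodule.mem_bot F).1 h3

/-- Letters of negative degree annihilate the largest monomial. -/
theorem indAct_top_of_neg (h2 : (2 : F) ≠ 0) {S : Superspace F V} (hρ : G.IsGradedAction S ρ)
    {i : ℤ} (hi : i < 0) {x : L} (hx : x ∈ G.deg i) (v : V) :
    G.indAct z ρ x (Fr.word z ρ Fr.top.sort (G.indOne z ρ v)) = 0 := by
  have h := Fr.filt_le_reduced h2 hρ _ _ (Fr.indAct_mem_filt hx
    (Fr.word_mem_filt (z := z) (ρ := ρ) (w := Fr.top.sort) (Nat.lt_succ_self _) rfl v))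
  have hsum : ((Fr.top.sort (· ≤ ·)).map Fr.d).sum = (Fr.top.map Fr.d).sum := by
    rw [← Multiset.sum_coe, ← Multiset.map_coe, Multiset.sort_eq]
  rw [hsum, Fr.reduced_eq_bot_of_lt (by omega)] at h
  exact (Submodule.mem_bot F).1 h

/-- Even letters contribute `q j - 1` times their diagonal constant and odd letters contribute it
once, whereas the supertrace has opposite signs. If `q j` vanishes in `F` the terms agree at once.
If `q j = 1` the letter is central and its diagonal constant kills `V`; stating the identity on a
vector covers `V = 0` as well. -/
theorem sum_diag_top (h2 : (2 : F) ≠ 0) {S : Superspace F V} (hρ : G.IsGradedAction S ρ)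
    {a : ZMod 2} {x : G.nonneg} (hx : (x : L) ∈ G.par a) (v : V) :
    ((Fr.top.sort (· ≤ ·)).map (Fr.diag x)).sum • v = -(G.sigma x • v) := by
  have h1 : ((Fr.top.sort (· ≤ ·)).map (Fr.diag x)).sum = ∑ j, (Fr.bound j : F) * Fr.diag x j := by
    rw [← Multiset.sum_coe, ← Multiset.map_coe, Multiset.sort_eq, top, ← Multiset.coe_mapAddMonoidHom,
      map_sum, ← Multiset.coe_sumAddMonoidHom, map_sum]
    simp
  rw [h1, Fr.sigma_eq_sum, Finset.sum_smul, Finset.sum_smul, ← Finset.sum_neg_distrib]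
  refine Finset.sum_congr rfl fun j _ => ?_
  rw [bound]
  split_ifs with hd h0
  · rw [Nat.cast_pred (Fr.q_pos j hd h0), h0, sgn_zero_right, one_mul, sub_mul, one_mul, sub_smul,
      sub_eq_neg_self]
    rcases Fr.q_cast j hd h0 with hq | hq
    · rw [hq]; simp
    · have hc := Fr.central j hd h0
      rw [hq, pow_one] at hc
      rw [hq, Nat.cast_one, one_mul]
      exact (Fr.inductionData hρ).repr_bracket_smul_eq_zero h2 (i := j) hd h0 hc hx v
  · rw [(zmod_two_cases _).resolve_left h0]; simp
  · simp

end Frame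

section Twisted

variable (M : Supermodule G.zeroPart V)

local notation "τ" => G.twistAct (G.extendAct M.act)

namespace Frame

variable {J : Type*} [LinearOrder J] [Fintype J] (Fr : G.Frame z J)

/-- The action of `L_0` on the largest monomial is not twisted. -/
theorem indAct_top (h2 : (2 : F) ≠ 0) {a : ZMod 2} (x : G.deg 0) (hx : (x : L) ∈ G.par a)
    (v : V) :
    G.indAct z τ x (Fr.word z τ Fr.top.sort (G.indOne z τ v)) =
      sgn F a ((Fr.top.sort (· ≤ ·)).map Fr.pa).sum •
        Fr.word z τ Fr.top.sort (G.indOne z τ (M.act x v)) := by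
  have hρ := Fr.isGradedAction_twist M
  have h := Fr.indAct_word_sub_mem (ρ := τ) x.2 hx (Fr.top.sort (· ≤ ·)) (G.indOne z τ v)
  have hbot : Submodule.span F {s | ∃ w', Fr.Replaced (Fr.top.sort (· ≤ ·)) w' ∧
      s = Fr.word z τ w' (G.indOne z τ v)} = ⊥ := by
    rw [eq_bot_iff]
    refine Submodule.span_le.2 ?_
    rintro s ⟨w', hw', rfl⟩
    exact (Submodule.mem_bot F).2 (Fr.word_replaced_top h2 hρ hw' v)
  rw [hbot, Submodule.mem_bot, sub_sub, sub_eq_zero] at h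
  have hK := G.deg_le_nonneg 0 le_rfl x.2
  have h1 : G.indAct z τ x (G.indOne z τ v) =
      G.indOne z τ (M.act x v + G.sigma ⟨x, hK⟩ • v) := by
    rw [G.indAct_one ⟨x, hK⟩]
    change G.indOne z τ (M.act (G.zeroProj x) v + _) = _
    rw [G.zeroProj_of_mem]
    rfl
  have h3 := congrArg (fun u => Fr.word z τ (Fr.top.sort (· ≤ ·)) (G.indOne z τ u))
    (Fr.sum_diag_top h2 hρ (x := ⟨x, hK⟩) hx v)
  simp only [map_neg, map_smul] at h3
  rw [h, h1, h3, map_add, map_add, smul_add, map_smul, map_smul]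
  -- For even `x`, the twist of the action on `1 ⊗ v` cancels against the diagonal sum `-σ(x)`. For
  -- odd `x`, `σ(x)` is zero.
  rcases zmod_two_cases a with rfl | rfl
  · simp
  · rw [Fr.sigma_eq_zero_of_odd (x := ⟨x, hK⟩) hx]; simp

/-- The top coefficient intertwines the action of `K` on the induced module with the untwisted
action. -/
theorem topCoeff_indAct (h2 : (2 : F) ≠ 0) {a : ZMod 2} {x : L} (hK : x ∈ G.nonneg)
    (hx : x ∈ G.par a) (t : G.Ind z τ) :
    Fr.topCoeff h2 (Fr.isGradedAction_twist M) (G.indAct z τ x t) =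
      sgn F a ((Fr.top.sort (· ≤ ·)).map Fr.pa).sum •
        M.act (G.zeroProj x) (Fr.topCoeff h2 (Fr.isGradedAction_twist M) t) := by
  set hρ := Fr.isGradedAction_twist M
  -- The decomposition into degrees does not keep track of parity, so the parity component is taken
  -- explicitly.
  have hom : ∀ i, 0 ≤ i → ∀ y ∈ G.deg i, Fr.topCoeff h2 hρ (G.indAct z τ (G.proj a y) t) =
      sgn F a ((Fr.top.sort (· ≤ ·)).map Fr.pa).sum •
        M.act (G.zeroProj (G.proj a y)) (Fr.topCoeff h2 hρ t) := by
    intro i hi y hy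
    have hy' := G.deg_proj i a y hy
    have hP : LinearMap.eqLocus (Fr.topCoeff h2 hρ ∘ₗ G.indAct z τ (G.proj a y))
        (sgn F a ((Fr.top.sort (· ≤ ·)).map Fr.pa).sum •
          (M.act (G.zeroProj (G.proj a y)) ∘ₗ Fr.topCoeff h2 hρ)) = ⊤ := by
      refine Fr.ind_induction_word h2 hρ _ fun s hs v => ?_
      simp only [LinearMap.mem_eqLocus, LinearMap.comp_apply, LinearMap.smul_apply]
      -- Strictly above the lowest degree the largest monomial does not occur. This covers proper
      -- submonomials, whose degree is too high and is not lowered by `K`, and also positive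
      -- elements applied to the largest monomial.
      have hlt : ∀ e, (Fr.top.map Fr.d).sum < e → ∀ n, ∀ t ∈ Fr.filt z τ n e,
          Fr.topCoeff h2 hρ t = 0 := by
        intro e he n t ht
        refine (Submodule.span_le.2 ?_ : Fr.reduced z τ n e ≤ LinearMap.ker (Fr.topCoeff h2 hρ))
          (Fr.filt_le_reduced h2 hρ n e ht)
        rintro t ⟨s, v, hs, -, hs', rfl⟩
        rw [SetLike.mem_coe, LinearMap.mem_ker, Fr.topCoeff_sort h2 hρ hs, if_neg]
        rintro rfl
        omega
      have hmem := Fr.indAct_mem_filt hy' (Fr.word_mem_filt (z := z) (ρ := τ)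
        (w := s.sort (· ≤ ·)) (Nat.lt_succ_self _) rfl v)
      have hsum : ((s.sort (· ≤ ·)).map Fr.d).sum = (s.map Fr.d).sum := by
        rw [← Multiset.sum_coe, ← Multiset.map_coe, Multiset.sort_eq]
      rw [hsum] at hmem
      rcases hs.lt_or_eq with hlt' | rfl
      · rw [Fr.topCoeff_sort h2 hρ hs, if_neg hlt'.ne, map_zero, smul_zero]
        have := Fr.sum_d_lt_of_lt_top hlt'
        exact hlt _ (by omega) _ _ hmem
      · rw [Fr.topCoeff_top]
        rcases hi.eq_or_lt with rfl | hi
        · have h := Fr.indAct_top M h2 ⟨_, hy'⟩ (G.proj_mem a y) v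
          have h0 := G.zeroProj_of_mem ⟨_, hy'⟩
          simp only at h h0
          rw [h, h0, map_smul, Fr.topCoeff_top]
        · rw [zeroProj_of_mem_deg hi.ne' hy', map_zero, LinearMap.zero_apply, smul_zero]
          exact hlt _ (by omega) _ _ hmem
    have : t ∈ (⊤ : Submodule F (G.Ind z τ)) := trivial
    rw [← hP] at this
    exact this
  have h := G.nonneg_induction (P := fun y => Fr.topCoeff h2 hρ (G.indAct z τ (G.proj a y) t) =
      sgn F a ((Fr.top.sort (· ≤ ·)).map Fr.pa).sum •
        M.act (G.zeroProj (G.proj a y)) (Fr.topCoeff h2 hρ t))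
    (fun x y hx hy => by simp only [map_add, LinearMap.add_apply, smul_add, hx, hy])
    (by simp) hom hK
  simpa only [G.proj_of_mem a a x hx, if_true] using h

end Frame
end Twisted

end ZGradedLieSuperalgebra
end SuperLie

/-! ### From an invariant form to a self-duality. -/

namespace SuperLie

section Forms

variable {F M : Type*} [Field F] [AddCommGroup M] [Module F M]

theorem isSuperSymm_or_isSkewSuperSymm_iff {ℳ : ZMod 2 → Submodule F M} {β : M →ₗ[F] M →ₗ[F] F} :
    (IsSuperSymm ℳ β ∨ IsSkewSuperSymm ℳ β) ↔ ∃ ε : F, (ε = 1 ∨ ε = -1) ∧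
      ∀ a b, ∀ v ∈ ℳ a, ∀ w ∈ ℳ b, β v w = ε * (sgn F a b * β w v) := by
  constructor
  · rintro (h | h)
    · exact ⟨1, Or.inl rfl, fun a b v hv w hw => by rw [h a b v hv w hw, one_mul]⟩
    · exact ⟨-1, Or.inr rfl, fun a b v hv w hw => by rw [h a b v hv w hw, neg_one_mul]⟩
  · rintro ⟨ε, rfl | rfl, h⟩
    · exact Or.inl fun a b v hv w hw => by rw [h a b v hv w hw, one_mul]
    · exact Or.inr fun a b v hv w hw => by rw [h a b v hv w hw, neg_one_mul]

theorem Superspace.apply_eq_zero_of_mem_dualPar (S : Superspace F M) {a b : ZMod 2}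
    {f : Module.Dual F M} (hf : f ∈ S.dualPar a) (hab : b ≠ a) {v : M} (hv : v ∈ S.par b) :
    f v = 0 :=
  (Submodule.mem_dualAnnihilator f).1 hf v
    ((le_iSup₂_of_le (f := fun b (_ : b ≠ a) => S.par b) b hab le_rfl) hv)

theorem Superspace.mem_dualPar (S : Superspace F M) {a : ZMod 2} {f : Module.Dual F M}
    (h : ∀ b ≠ a, ∀ v ∈ S.par b, f v = 0) : f ∈ S.dualPar a := by
  refine (Submodule.mem_dualAnnihilator f).2 fun v hv => ?_
  exact (iSup₂_le (a := LinearMap.ker f) fun b hb v hv => h b hb v hv) hv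

theorem Superspace.apply_proj_of_mem_dualPar (S : Superspace F M) {a : ZMod 2}
    {f : Module.Dual F M} (hf : f ∈ S.dualPar a) (b : ZMod 2) (v : M) :
    f (S.proj b v) = if b = a then f v else 0 := by
  split_ifs with h
  · subst h
    refine S.hom_induction (P := fun v => f (S.proj b v) = f v)
      (fun v w hv hw => by simp only [map_add, hv, hw]) (fun c v hv => ?_) v
    rw [S.proj_of_mem b c v hv]
    split_ifs with h
    · rfl
    · rw [map_zero, S.apply_eq_zero_of_mem_dualPar hf h hv]
  · exact S.apply_eq_zero_of_mem_dualPar hf h (S.proj_mem b v)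

theorem Superspace.apply_parityOp_of_mem_dualPar (S : Superspace F M) {a : ZMod 2}
    {f : Module.Dual F M} (hf : f ∈ S.dualPar a) (v : M) :
    f (S.parityOp v) = sgn F 1 a * f v := by
  rw [Superspace.parityOp, LinearMap.sub_apply, map_sub, S.apply_proj_of_mem_dualPar hf,
    S.apply_proj_of_mem_dualPar hf]
  rcases zmod_two_cases a with rfl | rfl <;> simp

theorem Superspace.parityOp_pow_of_mem (S : Superspace F M) (c : ZMod 2) {a : ZMod 2} {v : M}
    (hv : v ∈ S.par a) : (S.parityOp ^ c.val) v = sgn F c a • v := by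
  rcases zmod_two_cases c with rfl | rfl
  · simp
  · simp [ZMod.val_one, S.parityOp_of_mem hv]

theorem dualAct_of_mem {L : Type*} [AddCommGroup L] [Module F L] {A : LieSuperalgebra F L}
    {S : Superspace F M} {ρ : L →ₗ[F] Module.End F M} {a b : ZMod 2} {x : L} (hx : x ∈ A.par a)
    {f : Module.Dual F M} (hf : f ∈ S.dualPar b) (v : M) :
    dualAct A S ρ x f v = -(sgn F a b * f (ρ x v)) := by
  simp only [dualAct, LinearMap.mk₂_apply, LinearMap.neg_apply, LinearMap.sum_apply,
    LinearMap.smul_apply, LinearMap.comp_apply, A.proj_of_mem _ a x hx,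
    S.apply_proj_of_mem_dualPar hf]
  rw [Finset.sum_eq_single a, Finset.sum_eq_single b]
  · simp
  · intro b' _ hb'; simp [hb']
  · simp
  · intro a' _ ha'
    simp [ha'.symm]
  · simp

end Forms

namespace ZGradedLieSuperalgebra

variable {F L V : Type*} [Field F] [AddCommGroup L] [Module F L] [AddCommGroup V] [Module F V]
variable {G : ZGradedLieSuperalgebra F L}
variable {k : ℕ} {z : Fin k → G.Env} {ρ : G.nonneg →ₗ[F] Module.End F V}

namespace Frame

variable {J : Type*} [LinearOrder J] [Fintype J] (Fr : G.Frame z J)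

theorem sum_pa_reverse (w : List J) : (w.reverse.map Fr.pa).sum = (w.map Fr.pa).sum := by
  rw [List.map_reverse, List.sum_reverse]

/-- Moving a product of letters to the second argument of an invariant form. -/
theorem form_word {S : Superspace F V} {β : G.Ind z ρ →ₗ[F] G.Ind z ρ →ₗ[F] F}
    (hβ : IsInvariantForm G.toLieSuperalgebra (G.indPar z ρ S) (G.indAct z ρ) β) (w : List J) :
    ∃ η : F, (η = 1 ∨ η = -1) ∧ ∀ a, ∀ t ∈ G.indPar z ρ S a, ∀ s,
      β (Fr.word z ρ w t) s =
        η * (sgn F a (w.map Fr.pa).sum * β t (Fr.word z ρ w.reverse s)) := by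
  induction w with
  | nil => exact ⟨1, Or.inl rfl, fun a t _ s => by simp⟩
  | cons j w ih =>
    obtain ⟨η, hη, h⟩ := ih
    refine ⟨-(sgn F (w.map Fr.pa).sum (Fr.pa j) * η), ?_, fun a t ht s => ?_⟩
    · rcases zmod_two_cases (w.map Fr.pa).sum with h1 | h1 <;>
        rcases zmod_two_cases (Fr.pa j) with h3 | h3 <;> rcases hη with rfl | rfl <;> simp [h1, h3]
    · rw [word_cons, Module.End.mul_apply, hβ _ _ _ (Fr.mem_par j) _ (Fr.word_mem_indPar w ht),
        h a t ht, List.reverse_cons, word_append, Module.End.mul_apply, word_cons, word_nil,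
        mul_one, List.map_cons, List.sum_cons, sgn_add_left, sgn_add_right]
      ring

/-- An invariant form on the induced module gives a form on `V` by evaluation at the largest
monomial. -/
theorem exists_dual_iso_of_form (Fr : G.Frame z J) [FiniteDimensional F V] (h2 : (2 : F) ≠ 0)
    (M : Supermodule G.zeroPart V) (hρM : ρ = G.twistAct (G.extendAct M.act))
    (β : G.Ind z ρ →ₗ[F] G.Ind z ρ →ₗ[F] F) (hsep : β.SeparatingLeft)
    (hhom : IsHomogeneousForm (G.indPar z ρ M.toSuperspace) β)
    (hinv : IsInvariantForm G.toLieSuperalgebra (G.indPar z ρ M.toSuperspace) (G.indAct z ρ) β)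
    (hsym : IsSuperSymm (G.indPar z ρ M.toSuperspace) β ∨
      IsSkewSuperSymm (G.indPar z ρ M.toSuperspace) β) :
    ∃ ζ : V ≃ₗ[F] Module.Dual F V,
      IsSupermoduleHom G.zeroPart M.par M.act M.dualPar
        (dualAct G.zeroPart M.toSuperspace (G.restrictAct ρ)) (ζ : V →ₗ[F] Module.Dual F V) ∧
      (IsSuperSymm M.par (ζ : V →ₗ[F] Module.Dual F V) ∨
        IsSkewSuperSymm M.par (ζ : V →ₗ[F] Module.Dual F V)) := by
  have hρ : G.IsGradedAction M.toSuperspace ρ := by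
    rw [hρM]; exact Fr.isGradedAction_twist M
  set δ : List J := Fr.top.sort (· ≤ ·) with hδ
  set D : ZMod 2 := (δ.map Fr.pa).sum with hD
  have hactTop : ∀ {a : ZMod 2} (x : G.deg 0), (x : L) ∈ G.par a → ∀ v,
      G.indAct z ρ x (Fr.word z ρ δ (G.indOne z ρ v)) =
        sgn F a D • Fr.word z ρ δ (G.indOne z ρ (M.act x v)) := by
    subst hρM
    exact fun x hx v => Fr.indAct_top M h2 x hx v
  have hone : ∀ {b : ZMod 2} {v : V}, v ∈ M.par b →
      G.indOne z ρ v ∈ G.indPar z ρ M.toSuperspace b := fun hv => G.indOne_mem_indPar z ρ _ hv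
  have htop : ∀ {b : ZMod 2} {v : V}, v ∈ M.par b →
      Fr.word z ρ δ (G.indOne z ρ v) ∈ G.indPar z ρ M.toSuperspace (D + b) :=
    fun hv => Fr.word_mem_indPar δ (hone hv)
  -- The first argument runs over `δ ⊗ V`, where `L_0` acts without twist up to sign, and the second
  -- over `1 ⊗ V`, which carries the twisted action.
  let B : V →ₗ[F] Module.Dual F V := β.compl₁₂ (Fr.word z ρ δ ∘ₗ G.indOne z ρ) (G.indOne z ρ)
  have hB : ∀ v w, B v w = β (Fr.word z ρ δ (G.indOne z ρ v)) (G.indOne z ρ w) :=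
    fun _ _ => rfl
  have hinj : Function.Injective B := by
    rw [← LinearMap.ker_eq_bot, LinearMap.ker_eq_bot']
    intro v hv
    -- By invariance a letter of negative degree moves to the first argument, where it kills the
    -- largest monomial. So only `1 ⊗ V` can pair nontrivially with `δ ⊗ v`.
    have hneg : ∀ j, Fr.d j < 0 → ∀ t,
        β (Fr.word z ρ δ (G.indOne z ρ v)) (G.indAct z ρ (Fr.b j) t) = 0 := by
      intro j hj t
      refine M.hom_induction (P := fun v =>
        β (Fr.word z ρ δ (G.indOne z ρ v)) (G.indAct z ρ (Fr.b j) t) = 0)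
        (fun v w hv hw => by simp only [map_add, LinearMap.add_apply, hv, hw, add_zero])
        (fun a v hv => ?_) v
      have h := hinv _ _ _ (Fr.mem_par j) _ (htop hv) t
      rw [Fr.indAct_top_of_neg h2 hρ hj (Fr.mem_deg j), map_zero, LinearMap.zero_apply, eq_comm,
        neg_eq_zero] at h
      refine (mul_eq_zero.1 h).resolve_left fun h0 => ?_
      have := sgn_mul_self F (D + a) (Fr.pa j)
      rw [h0, mul_zero] at this
      exact zero_ne_one this
    have hzero : LinearMap.ker (β (Fr.word z ρ δ (G.indOne z ρ v))) = ⊤ := by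
      refine Fr.ind_induction_word h2 hρ _ fun s hs w => ?_
      rw [LinearMap.mem_ker]
      have hmem : ∀ j ∈ s.sort (· ≤ ·), Fr.d j < 0 := fun j hj =>
        Fr.d_neg_of_mem_top (Multiset.mem_of_le hs ((Multiset.mem_sort _).1 hj))
      cases hsort : s.sort (· ≤ ·) with
      | nil => rw [word_nil, Module.End.one_apply, ← hB, hv, LinearMap.zero_apply]
      | cons j l =>
        rw [word_cons, Module.End.mul_apply]
        exact hneg j (hmem j (by rw [hsort]; simp)) _
    have h0 : Fr.word z ρ δ (G.indOne z ρ v) = 0 := hsep _ fun t => by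
      have : t ∈ LinearMap.ker (β (Fr.word z ρ δ (G.indOne z ρ v))) := by rw [hzero]; trivial
      exact this
    rw [← Fr.topCoeff_top (z := z) h2 hρ v, h0, map_zero]
  refine ⟨LinearMap.linearEquivOfInjective B hinj (Subspace.dual_finrank_eq).symm, ?_, ?_⟩
  · obtain ⟨c, hc⟩ := hhom
    have hdual : ∀ b, ∀ v ∈ M.par b, B v ∈ M.dualPar (b + (c + D)) := by
      intro b v hv
      refine M.mem_dualPar fun b' hb' w hw => ?_
      rw [hB]
      refine hc _ _ _ (htop hv) _ (hone hw) ?_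
      have hb : ∀ b D b' : ZMod 2, b' = b + (D + b + b' + D) := by decide
      exact fun h => hb' (by rw [← h]; exact hb b D b')
    -- The parity of `ζ` is that of the form plus that of the largest monomial.
    refine ⟨c + D, hdual, fun a x hx v => ?_⟩
    change dualAct _ _ _ x (B v) = sgn F a (c + D) • B (M.act x v)
    refine M.hom_induction (P := fun v => dualAct _ _ _ x (B v) =
      sgn F a (c + D) • B (M.act x v))
      (fun v w hv hw => by simp only [map_add, hv, hw, smul_add]) (fun b v hv => ?_) v
    refine LinearMap.ext fun w => ?_
    have hx' : (x : L) ∈ G.par a := hx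
    rw [dualAct_of_mem hx (hdual b v hv), LinearMap.smul_apply, smul_eq_mul]
    have h := hinv _ _ _ hx' _ (htop hv) (G.indOne z ρ w)
    rw [hactTop x hx' v, map_smul, LinearMap.smul_apply,
      smul_eq_mul, ← hB,
      G.indAct_one (ρ := ρ) ⟨x, G.deg_le_nonneg 0 le_rfl x.2⟩, ← hB] at h
    change -(sgn F a (b + (c + D)) * B v (ρ ⟨x, G.deg_le_nonneg 0 le_rfl x.2⟩ w)) = _
    have h' : B (M.act x v) w =
        sgn F a D * -(sgn F (D + b) a * B v (ρ ⟨x, G.deg_le_nonneg 0 le_rfl x.2⟩ w)) := by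
      rw [← h, sgn_self_mul]
    rw [h', sgn_add_right, sgn_add_right, sgn_add_left, sgn_comm F D a, sgn_comm F b a]
    linear_combination (sgn F a c * sgn F a D * sgn F a b *
      B v (ρ ⟨x, G.deg_le_nonneg 0 le_rfl x.2⟩ w)) * sgn_mul_self F a D
  · rw [isSuperSymm_or_isSkewSuperSymm_iff] at hsym ⊢
    obtain ⟨ε, hε, hsym⟩ := hsym
    -- After the symmetry of `β` is used, the largest monomial stands in the second argument. Moving
    -- it back reverses it, and the reversed word is `κ` times the original one on `1 ⊗ V`.
    obtain ⟨η, hη, hform⟩ := Fr.form_word hinv δ.reverse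
    obtain ⟨κ, hκ, htopr⟩ := Fr.word_top_perm (z := z) h2 hρ (w := δ.reverse) (by simp [hδ])
    refine ⟨ε * η * κ, ?_, fun a b v hv w hw => ?_⟩
    · rcases hε with rfl | rfl <;> rcases hη with rfl | rfl <;> rcases hκ with rfl | rfl <;> simp
    · change B v w = _ * (_ * B w v)
      have h := hform b _ (hone hw) (G.indOne z ρ v)
      rw [htopr, map_smul, LinearMap.smul_apply, smul_eq_mul, ← hδ, ← hB, List.reverse_reverse,
        sum_pa_reverse, ← hD] at h
      rw [hB, hsym _ _ _ (htop hv) _ (hone hw), sgn_add_left]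
      have hκ2 : κ * κ = 1 := by rcases hκ with rfl | rfl <;> simp
      have hη2 : η * η = 1 := by rcases hη with rfl | rfl <;> simp
      have hs := sgn_mul_self F b D
      rw [sgn_comm F D b]
      have h' : sgn F b D * β (G.indOne z ρ w) (Fr.word z ρ δ (G.indOne z ρ v)) =
          η * (κ * B w v) := by
        rw [h, ← mul_assoc, hη2, one_mul]
      linear_combination (ε * sgn F a b) * h'

end Frame

end ZGradedLieSuperalgebra
end SuperLie

/-! ### The signed dual of the induced module and the forms obtained from it. -/

namespace SuperLie

theorem Superspace.parityOp_parityOp {F V : Type*} [Field F] [AddCommGroup V] [Module F V]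
    (S : Superspace F V) (v : V) : S.parityOp (S.parityOp v) = v := by
  refine S.hom_induction (P := fun v => S.parityOp (S.parityOp v) = v)
    (fun v w hv hw => by simp only [map_add, hv, hw]) (fun c v hv => ?_) v
  rw [S.parityOp_of_mem hv, map_smul, S.parityOp_of_mem hv, smul_smul, sgn_mul_self, one_smul]

namespace ZGradedLieSuperalgebra

variable {F L V : Type*} [Field F] [AddCommGroup L] [Module F L] [AddCommGroup V] [Module F V]
variable {G : ZGradedLieSuperalgebra F L}
variable {k : ℕ} {z : Fin k → G.Env} {ρ : G.nonneg →ₗ[F] Module.End F V}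
variable {S : Superspace F V}

namespace Frame

variable {J : Type*} [LinearOrder J] [Fintype J] (Fr : G.Frame z J)

theorem indParityOp_indParityOp (hρ : G.IsGradedAction S ρ) (t : G.Ind z ρ) :
    Fr.indParityOp hρ (Fr.indParityOp hρ t) = t := by
  have h : LinearMap.eqLocus (Fr.indParityOp hρ * Fr.indParityOp hρ) 1 = ⊤ := by
    refine G.ind_induction _ (fun v => ?_) fun x t ht => ?_
    · rw [LinearMap.mem_eqLocus, Module.End.mul_apply, indParityOp_one, indParityOp_one,
        S.parityOp_parityOp]; rfl
    · rw [LinearMap.mem_eqLocus, Module.End.mul_apply] at ht ⊢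
      rw [indParityOp_indAct, indParityOp_indAct, ht, G.parityOp_parityOp]; rfl
  have ht : t ∈ (⊤ : Submodule F (G.Ind z ρ)) := trivial
  rw [← h] at ht
  exact ht

/-- The action of `L` on the dual of the induced module, twisted by a sign `s` on the odd part. -/
noncomputable def dualIndAct (hρ : G.IsGradedAction S ρ) (s : F) :
    L →ₗ[F] Module.End F (Module.Dual F (G.Ind z ρ)) :=
  -- Invariance requires the sign `(-1)^{d(t)}` for odd `x` acting on `f = β(t, ·)`. If the form has
  -- parity `c` and `s = (-1)^c`, composing `f` with the parity operator and multiplying by `s`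
  -- produces this sign, without any grading on the dual.
  (-1 : F) • (Module.Dual.transpose ∘ₗ G.indAct z ρ ∘ₗ G.proj 0) +
    (-s) • (Module.Dual.transpose ∘ₗ LinearMap.mulLeft F (Fr.indParityOp hρ) ∘ₗ
      G.indAct z ρ ∘ₗ G.proj 1)

theorem dualIndAct_even (hρ : G.IsGradedAction S ρ) (s : F) {x : L} (hx : x ∈ G.par 0)
    (f : Module.Dual F (G.Ind z ρ)) (t : G.Ind z ρ) :
    Fr.dualIndAct hρ s x f t = -f (G.indAct z ρ x t) := by
  simp [dualIndAct, G.proj_of_mem _ _ x hx, Module.Dual.transpose_apply]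

theorem dualIndAct_odd (hρ : G.IsGradedAction S ρ) (s : F) {x : L} (hx : x ∈ G.par 1)
    (f : Module.Dual F (G.Ind z ρ)) (t : G.Ind z ρ) :
    Fr.dualIndAct hρ s x f t = -(s * f (Fr.indParityOp hρ (G.indAct z ρ x t))) := by
  simp [dualIndAct, G.proj_of_mem _ _ x hx, Module.Dual.transpose_apply]

/-- The action of `U(L)` on the dual of the induced module. -/
noncomputable def dualIndRep (hρ : G.IsGradedAction S ρ) {s : F} (hs : s * s = 1) :
    G.Env →ₐ[F] Module.End F (Module.Dual F (G.Ind z ρ)) :=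
  G.envLift (B := Module.End F (Module.Dual F (G.Ind z ρ))) (Fr.dualIndAct hρ s)
      fun a c x hx y hy => by
    refine LinearMap.ext fun f => LinearMap.ext fun t => ?_
    have hodd : ∀ {x}, x ∈ G.par 1 → ∀ t, Fr.indParityOp hρ (G.indAct z ρ x t) =
        -G.indAct z ρ x (Fr.indParityOp hρ t) := fun hx t => by
      rw [indParityOp_indAct, G.parityOp_of_mem hx]; simp
    have heven : ∀ {x}, x ∈ G.par 0 → ∀ t, Fr.indParityOp hρ (G.indAct z ρ x t) =
        G.indAct z ρ x (Fr.indParityOp hρ t) := fun hx t => by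
      rw [indParityOp_indAct, G.parityOp_of_mem hx]; simp
    have hbr := G.bracket_mem a c x hx y hy
    have hcomm := G.indAct_comm (z := z) (ρ := ρ) hx hy t
    have h11 : (1 : ZMod 2) + 1 = 0 := by decide
    simp only [Module.End.mul_apply, LinearMap.add_apply, LinearMap.smul_apply, smul_eq_mul]
    rcases zmod_two_cases a with rfl | rfl <;> rcases zmod_two_cases c with rfl | rfl
    · rw [zero_add] at hbr
      simp only [Fr.dualIndAct_even hρ s hx, Fr.dualIndAct_even hρ s hy,
        Fr.dualIndAct_even hρ s hbr, hcomm, map_add, sgn_zero_left, one_smul]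
      ring
    · rw [zero_add] at hbr
      simp only [Fr.dualIndAct_even hρ s hx, Fr.dualIndAct_odd hρ s hy,
        Fr.dualIndAct_odd hρ s hbr, ← heven hx, hcomm, map_add, sgn_zero_left, one_smul]
      ring
    · rw [add_zero] at hbr
      simp only [Fr.dualIndAct_odd hρ s hx, Fr.dualIndAct_even hρ s hy,
        Fr.dualIndAct_odd hρ s hbr, ← heven hy, hcomm, map_add, sgn_zero_right, one_smul]
      ring
    · rw [h11] at hbr
      simp only [Fr.dualIndAct_odd hρ s hx, Fr.dualIndAct_odd hρ s hy,
        Fr.dualIndAct_even hρ s hbr]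
      have hΓ : ∀ {x y}, x ∈ G.par 1 → y ∈ G.par 1 → Fr.indParityOp hρ (G.indAct z ρ y
          (Fr.indParityOp hρ (G.indAct z ρ x t))) = -G.indAct z ρ y (G.indAct z ρ x t) :=
        fun hx hy => by rw [hodd hy, indParityOp_indParityOp]
      rw [hΓ hx hy, hΓ hy hx, hcomm, sgn_one_one]
      simp only [map_neg, map_add, neg_smul, one_smul]
      linear_combination (-f (G.indAct z ρ (G.bracket x y) t)) * hs

theorem dualIndRep_envι (hρ : G.IsGradedAction S ρ) {s : F} (hs : s * s = 1) (x : L) :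
    Fr.dualIndRep hρ hs (G.envι x) = Fr.dualIndAct hρ s x := G.envLift_envι _ _ x

/-- The `z i` are powers of even letters, so on the dual they act by `±` the transpose of their
action on the induced module, and that action is zero. -/
theorem dualIndRep_z (hρ : G.IsGradedAction S ρ) {s : F} (hs : s * s = 1) (i : Fin k) :
    Fr.dualIndRep hρ hs (z i) = 0 := by
  obtain ⟨j, hj, h0, hz⟩ := Fr.exists_letter i
  have hm := Fr.mem_par j
  rw [h0] at hm
  have hpow : ∀ n f t, (Fr.dualIndAct hρ s (Fr.b j) ^ n) f t =
      (-1) ^ n * f ((G.indAct z ρ (Fr.b j) ^ n) t) := by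
    intro n
    induction n with
    | zero => simp
    | succ n ih =>
      intro f t
      rw [pow_succ, Module.End.mul_apply, ih, Fr.dualIndAct_even hρ s hm, pow_succ' (G.indAct z ρ _),
        Module.End.mul_apply]
      ring
  rw [hz, map_pow, dualIndRep_envι]
  refine LinearMap.ext fun f => LinearMap.ext fun t => ?_
  rw [hpow, G.indAct_pow_eq_zero (Fr.central j hj h0) hz]
  simp

/-- The form on the induced module associated with a `K`-equivariant map to its dual. -/
noncomputable def indForm (hρ : G.IsGradedAction S ρ) {s : F} (hs : s * s = 1)
    (φ : V →ₗ[F] Module.Dual F (G.Ind z ρ))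
    (hφ : ∀ (x : G.nonneg) v, Fr.dualIndAct hρ s x (φ v) = φ (ρ x v)) :
    G.Ind z ρ →ₗ[F] G.Ind z ρ →ₗ[F] F :=
  (G.indRel z ρ).liftQ (TensorProduct.lift ((Fr.dualIndRep hρ hs).toLinearMap.compl₂ φ)) <|
    Submodule.span_le.2 <| by
    rintro t (⟨u, x, v, rfl⟩ | ⟨u, i, v, rfl⟩)
    · simp [LinearMap.compl₂_apply, dualIndRep_envι, hφ]
    · simp [LinearMap.compl₂_apply, dualIndRep_z]

section Form

variable (hρ : G.IsGradedAction S ρ) {s : F} (hs : s * s = 1)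
  (φ : V →ₗ[F] Module.Dual F (G.Ind z ρ))
  (hφ : ∀ (x : G.nonneg) v, Fr.dualIndAct hρ s x (φ v) = φ (ρ x v))

theorem indForm_one (v : V) : Fr.indForm hρ hs φ hφ (G.indOne z ρ v) = φ v := by
  change Fr.dualIndRep hρ hs 1 (φ v) = φ v
  rw [map_one]; rfl

theorem indForm_indAct (x : L) (t : G.Ind z ρ) :
    Fr.indForm hρ hs φ hφ (G.indAct z ρ x t) =
      Fr.dualIndAct hρ s x (Fr.indForm hρ hs φ hφ t) := by
  refine LinearMap.congr_fun (f := Fr.indForm hρ hs φ hφ ∘ₗ G.indAct z ρ x)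
    (g := Fr.dualIndAct hρ s x ∘ₗ Fr.indForm hρ hs φ hφ) (G.ind_hom_ext fun u v => ?_) t
  change Fr.dualIndRep hρ hs (G.envι x * u) (φ v) =
    Fr.dualIndAct hρ s x (Fr.dualIndRep hρ hs u (φ v))
  rw [map_mul, dualIndRep_envι]; rfl

/-- This expresses homogeneity of the form without splitting its arguments. It spreads from `1 ⊗ V`
because the action of `L` is compatible with the parity operators on both sides. -/
theorem indForm_parityOp (hpar : ∀ v t, φ (S.parityOp v) t = s * φ v (Fr.indParityOp hρ t))
    (t t' : G.Ind z ρ) : Fr.indForm hρ hs φ hφ (Fr.indParityOp hρ t) t' =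
      s * Fr.indForm hρ hs φ hφ t (Fr.indParityOp hρ t') := by
  have h : LinearMap.eqLocus (Fr.indForm hρ hs φ hφ ∘ₗ Fr.indParityOp hρ)
      (s • (Module.Dual.transpose (Fr.indParityOp hρ) ∘ₗ Fr.indForm hρ hs φ hφ)) = ⊤ := by
    refine G.ind_induction _ (fun v => ?_) fun x t ht => ?_
    · refine LinearMap.ext fun t' => ?_
      rw [LinearMap.comp_apply, indParityOp_one, indForm_one, hpar]
      simp [Module.Dual.transpose_apply, indForm_one]
    · rw [LinearMap.mem_eqLocus] at ht
      have ht : ∀ t', Fr.indForm hρ hs φ hφ (Fr.indParityOp hρ t) t' =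
        s * Fr.indForm hρ hs φ hφ t (Fr.indParityOp hρ t') := fun t' => LinearMap.congr_fun ht t'
      refine G.hom_induction (P := fun x => G.indAct z ρ x t ∈ LinearMap.eqLocus _ _)
        (fun x y hx hy => by
          rw [map_add, LinearMap.add_apply]; exact Submodule.add_mem _ hx hy)
        (fun a x hx => ?_) x
      refine LinearMap.ext fun t' => ?_
      change Fr.indForm hρ hs φ hφ (Fr.indParityOp hρ (G.indAct z ρ x t)) t' =
        s * Fr.indForm hρ hs φ hφ (G.indAct z ρ x t) (Fr.indParityOp hρ t')
      rw [indParityOp_indAct, G.parityOp_of_mem hx, map_smul, LinearMap.smul_apply, map_smul,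
        LinearMap.smul_apply, indForm_indAct, indForm_indAct]
      rcases zmod_two_cases a with rfl | rfl
      · rw [Fr.dualIndAct_even hρ s hx, Fr.dualIndAct_even hρ s hx, ht, indParityOp_indAct,
          G.parityOp_of_mem hx]
        simp
      · rw [Fr.dualIndAct_odd hρ s hx, Fr.dualIndAct_odd hρ s hx, ht, indParityOp_indParityOp,
          indParityOp_indAct, indParityOp_indParityOp, G.parityOp_of_mem hx]
        simp
  have ht : t ∈ (⊤ : Submodule F (G.Ind z ρ)) := trivial
  rw [← h] at ht
  exact LinearMap.congr_fun ht t'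

theorem indForm_indParityOp_right
    (hpar : ∀ v t, φ (S.parityOp v) t = s * φ v (Fr.indParityOp hρ t)) {a : ZMod 2}
    {t : G.Ind z ρ} (ht : t ∈ G.indPar z ρ S a) (t' : G.Ind z ρ) :
    Fr.indForm hρ hs φ hφ t (Fr.indParityOp hρ t') =
      s * (sgn F 1 a * Fr.indForm hρ hs φ hφ t t') := by
  have h := Fr.indForm_parityOp hρ hs φ hφ hpar t t'
  rw [Fr.indParityOp_of_mem hρ ht, map_smul, LinearMap.smul_apply, smul_eq_mul] at h
  rw [h, ← mul_assoc, hs, one_mul]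

/-- Equivariance of the map to the dual already is invariance up to sign. For odd `x` the parity
operator in the dual action evaluates to `s (-1)^{d(t)}`, and the two factors `s` cancel. -/
theorem isInvariantForm_indForm
    (hpar : ∀ v t, φ (S.parityOp v) t = s * φ v (Fr.indParityOp hρ t)) :
    IsInvariantForm G.toLieSuperalgebra (G.indPar z ρ S) (G.indAct z ρ)
      (Fr.indForm hρ hs φ hφ) := by
  intro a b x hx t ht t'
  rw [indForm_indAct]
  rcases zmod_two_cases a with rfl | rfl
  · rw [Fr.dualIndAct_even hρ s hx, sgn_zero_right, one_mul]
  · rw [Fr.dualIndAct_odd hρ s hx, Fr.indForm_indParityOp_right hρ hs φ hφ hpar ht, ← mul_assoc,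
      hs, one_mul, sgn_comm]

/-- Evaluating the parity operator on the second argument in two ways gives `β(t, t')` with the
signs `(-1)^{c+a}` and `(-1)^b`. If `a + b ≠ c` these differ, so `2 β(t, t') = 0`. -/
theorem isHomogeneousForm_indForm (h2 : (2 : F) ≠ 0)
    (hpar : ∀ v t, φ (S.parityOp v) t = s * φ v (Fr.indParityOp hρ t)) {c : ZMod 2}
    (hc : s = sgn F 1 c) : IsHomogeneousForm (G.indPar z ρ S) (Fr.indForm hρ hs φ hφ) := by
  refine ⟨c, fun a b t ht t' ht' hab => ?_⟩
  have h := Fr.indForm_indParityOp_right hρ hs φ hφ hpar ht t'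
  rw [Fr.indParityOp_of_mem hρ ht', map_smul, smul_eq_mul] at h
  generalize Fr.indForm hρ hs φ hφ t t' = y at h ⊢
  rw [hc, ← mul_assoc, ← sgn_add_right] at h
  have hb : b = c + a + 1 := by
    rw [zmodTwo_ne hab]; exact (by decide : ∀ a b : ZMod 2, b = a + b + 1 + a + 1) a b
  rw [hb, sgn_add_right, sgn_one_one, mul_neg_one, neg_mul, neg_eq_iff_add_eq_zero, ← two_mul] at h
  refine (mul_eq_zero.1 ((mul_eq_zero.1 h).resolve_left h2)).resolve_left fun h0 => ?_
  have := sgn_mul_self F 1 (c + a)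
  rw [h0, mul_zero] at this
  exact zero_ne_one this

end Form

end Frame

end ZGradedLieSuperalgebra
end SuperLie

/-! ### Equivariance over `K` and the reduction of symmetry to `1 ⊗ V`. -/

namespace SuperLie

theorem sgn_ne_zero (F : Type*) [Field F] (a b : ZMod 2) : sgn F a b ≠ 0 := fun h => by
  have := sgn_mul_self F a b
  rw [h, mul_zero] at this
  exact zero_ne_one this

namespace ZGradedLieSuperalgebra

variable {F L V : Type*} [Field F] [AddCommGroup L] [Module F L] [AddCommGroup V] [Module F V]
variable {G : ZGradedLieSuperalgebra F L}
variable {k : ℕ} {z : Fin k → G.Env} {ρ : G.nonneg →ₗ[F] Module.End F V}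
variable {S : Superspace F V}

theorem nonneg_hom_induction {P : G.nonneg → Prop} (add : ∀ x y, P x → P y → P (x + y))
    (hom : ∀ a, ∀ x : G.nonneg, (x : L) ∈ G.par a → P x) (x : G.nonneg) : P x := by
  have hK : ∀ a, ∀ x ∈ G.nonneg, G.proj a x ∈ G.nonneg := by
    intro a
    change G.nonneg ≤ G.nonneg.comap (G.proj a)
    exact iSup₂_le fun i hi x hx => G.deg_le_nonneg i hi (G.deg_proj i a x hx)
  have h : x = ⟨_, hK 0 x x.2⟩ + ⟨_, hK 1 x x.2⟩ := Subtype.ext (G.proj_add_proj x).symm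
  rw [h]
  exact add _ _ (hom 0 _ (G.proj_mem _ _)) (hom 1 _ (G.proj_mem _ _))

namespace Frame

variable {J : Type*} [LinearOrder J] [Fintype J] (Fr : G.Frame z J)

/-- Elements of nonzero degree have no diagonal structure constants, so `σ` only sees the component
in `L_0`. -/
theorem sigma_zeroProj (Fr : G.Frame z J) (x : G.nonneg) :
    G.sigma ⟨G.zeroProj x, G.deg_le_nonneg 0 le_rfl (G.zeroProj x).2⟩ = G.sigma x := by
  obtain ⟨x, hx⟩ := x
  refine (G.nonneg_induction (P := fun x => ∃ hx : x ∈ G.nonneg,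
      G.sigma ⟨G.zeroProj x, G.deg_le_nonneg 0 le_rfl (G.zeroProj x).2⟩ = G.sigma ⟨x, hx⟩)
    (fun x y ⟨hx, h⟩ ⟨hy, h'⟩ => ⟨add_mem hx hy, ?_⟩) ⟨zero_mem _, ?_⟩
    (fun i hi x hx => ⟨G.deg_le_nonneg i hi hx, ?_⟩) hx).2
  · have := congrArg₂ (· + ·) h h'
    simp only [← map_add] at this
    rw [← AddMemClass.mk_add_mk G.nonneg x y hx hy, ← this]
    congr 1
    exact Subtype.ext (by simp)
  · congr 1
    exact Subtype.ext (by simp)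
  · by_cases h0 : i = 0
    · subst h0
      congr 1
      exact Subtype.ext (congrArg (Subtype.val (p := (· ∈ G.deg 0))) (G.zeroProj_of_mem ⟨x, hx⟩))
    · rw [Fr.sigma_eq_zero_of_pos (x := ⟨x, _⟩) h0 hx, ← map_zero G.sigma]
      congr 1
      exact Subtype.ext (by simp [zeroProj_of_mem_deg h0 hx])

theorem topCoeff_indParityOp (h2 : (2 : F) ≠ 0) (hρ : G.IsGradedAction S ρ) (t : G.Ind z ρ) :
    Fr.topCoeff h2 hρ (Fr.indParityOp hρ t) =
      sgn F 1 ((Fr.top.sort (· ≤ ·)).map Fr.pa).sum • S.parityOp (Fr.topCoeff h2 hρ t) := by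
  have h : LinearMap.eqLocus (Fr.topCoeff h2 hρ ∘ₗ Fr.indParityOp hρ)
      (sgn F 1 ((Fr.top.sort (· ≤ ·)).map Fr.pa).sum • (S.parityOp ∘ₗ Fr.topCoeff h2 hρ)) = ⊤ := by
    refine Fr.ind_induction_word h2 hρ _ fun s hs v => ?_
    rw [LinearMap.mem_eqLocus, LinearMap.comp_apply, LinearMap.smul_apply, LinearMap.comp_apply,
      indParityOp_word, map_smul, indParityOp_one, Fr.topCoeff_sort h2 hρ hs,
      Fr.topCoeff_sort h2 hρ hs]
    split_ifs with h
    · rw [h]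
    · simp
  have ht : t ∈ (⊤ : Submodule F (G.Ind z ρ)) := trivial
  rw [← h] at ht
  exact ht

/-- An isomorphism `V ≃ (V_σ)*` over `L_0` satisfies a twisted equivariance over `K`. -/
theorem apply_twistAct (Fr : G.Frame z J) (M : Supermodule G.zeroPart V)
    (hρM : ρ = G.twistAct (G.extendAct M.act)) (ζ : V →ₗ[F] Module.Dual F V) {c : ZMod 2}
    (hpar : ∀ b, ∀ v ∈ M.par b, ζ v ∈ M.dualPar (b + c))
    (hact : ∀ a, ∀ x ∈ G.zeroPart.par a, ∀ v,
      dualAct G.zeroPart M.toSuperspace (G.restrictAct ρ) x (ζ v) = sgn F a c • ζ (M.act x v))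
    {a b : ZMod 2} {x : G.nonneg} (hx : (x : L) ∈ G.par a) {v : V} (hv : v ∈ M.par b) (w : V) :
    ζ (ρ x v) w = -(sgn F a b * ζ v (M.act (G.zeroProj x) w)) := by
  have happ : ∀ (x : G.nonneg) v, ρ x v = M.act (G.zeroProj x) v + G.sigma x • v := by
    subst hρM; exact fun x v => rfl
  have hx0 : G.zeroProj x ∈ G.zeroPart.par a := zeroProj_mem_par hx
  have h := LinearMap.congr_fun (hact a _ hx0 v) w
  rw [dualAct_of_mem hx0 (hpar b v hv), LinearMap.smul_apply, smul_eq_mul, restrictAct,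
    LinearMap.comp_apply, happ, Submodule.coe_inclusion, G.zeroProj_of_mem, sgn_add_right] at h
  change -(_ * ζ v (_ + G.sigma ⟨G.zeroProj x, _⟩ • w)) = _ at h
  rw [Fr.sigma_zeroProj, map_add, map_smul, smul_eq_mul] at h
  rw [happ, map_add, map_smul, LinearMap.add_apply, LinearMap.smul_apply, smul_eq_mul]
  have hs := sgn_mul_self F a c
  -- The twist sits on the second argument here. For even `x` the scalar `σ(x)` can be moved to the
  -- first argument, and for odd `x` it vanishes.
  have h' : ζ (M.act (G.zeroProj x) v) w = -(sgn F a b * (ζ v (M.act (G.zeroProj x) w) +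
      G.sigma x * ζ v w)) := by
    linear_combination (-sgn F a c) * h - (ζ (M.act (G.zeroProj x) v) w +
      (sgn F a b * (ζ v (M.act (G.zeroProj x) w) + G.sigma x * ζ v w))) * hs
  rw [h']
  rcases zmod_two_cases a with rfl | rfl
  · rw [sgn_zero_left]; ring
  · rw [Fr.sigma_eq_zero_of_odd hx]; ring

end Frame

/-- The symmetry of an invariant form can be tested on `V`. -/
theorem form_symm_of_one {β : G.Ind z ρ →ₗ[F] G.Ind z ρ →ₗ[F] F}
    (hβ : IsInvariantForm G.toLieSuperalgebra (G.indPar z ρ S) (G.indAct z ρ) β) {ε : F}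
    (h : ∀ a, ∀ v ∈ S.par a, ∀ b, ∀ t ∈ G.indPar z ρ S b,
      β (G.indOne z ρ v) t = ε * (sgn F a b * β t (G.indOne z ρ v)))
    (a b : ZMod 2) (t : G.Ind z ρ) (ht : t ∈ G.indPar z ρ S a) (t' : G.Ind z ρ)
    (ht' : t' ∈ G.indPar z ρ S b) : β t t' = ε * (sgn F a b * β t' t) := by
  -- `Q a` collects the vectors of parity `a` that satisfy the symmetry against all homogeneous
  -- vectors. It contains the part of `1 ⊗ V` of parity `a`, and by invariance `L` maps these
  -- subspaces into one another, so they exhaust the homogeneous parts.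
  let Q : ZMod 2 → Submodule F (G.Ind z ρ) := fun a =>
    { carrier := {t | t ∈ G.indPar z ρ S a ∧ ∀ b, ∀ t' ∈ G.indPar z ρ S b,
        β t t' = ε * (sgn F a b * β t' t)}
      add_mem' := fun {x y} hx hy => ⟨Submodule.add_mem _ hx.1 hy.1, fun b t' ht' => by
        rw [map_add, LinearMap.add_apply, hx.2 b t' ht', hy.2 b t' ht', map_add]; ring⟩
      zero_mem' := ⟨Submodule.zero_mem _, fun b t' _ => by simp⟩
      smul_mem' := fun r x hx => ⟨Submodule.smul_mem _ _ hx.1, fun b t' ht' => by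
        rw [map_smul, LinearMap.smul_apply, hx.2 b t' ht', map_smul, smul_eq_mul, smul_eq_mul]
        ring⟩ }
  refine (G.indPar_le Q (fun c v hv => ⟨G.indOne_mem_indPar z ρ S hv, h c v hv⟩)
    (fun a c x hx t ht => ⟨G.indAct_mem_indPar hx ht.1, fun b t' ht' => ?_⟩) a ht).2 b t' ht'
  rw [hβ _ _ x hx t ht.1, ht.2 _ _ (G.indAct_mem_indPar hx ht'), hβ _ _ x hx t' ht',
    sgn_add_right, sgn_add_left, sgn_comm F b a]
  linear_combination (ε * sgn F c b * sgn F a b * β t' (G.indAct z ρ x t)) * sgn_mul_self F c a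

end ZGradedLieSuperalgebra
end SuperLie

/-! ### From a self-duality to a nondegenerate invariant form. -/

namespace SuperLie
namespace ZGradedLieSuperalgebra

variable {F L V : Type*} [Field F] [AddCommGroup L] [Module F L] [AddCommGroup V] [Module F V]
variable {G : ZGradedLieSuperalgebra F L}
variable {k : ℕ} {z : Fin k → G.Env} {ρ : G.nonneg →ₗ[F] Module.End F V}
variable {S : Superspace F V}

namespace Frame

variable {J : Type*} [LinearOrder J] [Fintype J] (Fr : G.Frame z J)

/-- An invariant form restricting to a nondegenerate form at the largest monomial is
nondegenerate. -/
theorem separatingLeft_of_one (h2 : (2 : F) ≠ 0) (hρ : G.IsGradedAction S ρ)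
    {β : G.Ind z ρ →ₗ[F] G.Ind z ρ →ₗ[F] F}
    (hβ : IsInvariantForm G.toLieSuperalgebra (G.indPar z ρ S) (G.indAct z ρ) β) {ε s : F}
    (hsymm : ∀ a b, ∀ t ∈ G.indPar z ρ S a, ∀ t' ∈ G.indPar z ρ S b,
      β t t' = ε * (sgn F a b * β t' t))
    (hpar : ∀ t t', β (Fr.indParityOp hρ t) t' = s * β t (Fr.indParityOp hρ t'))
    (hone : ∀ t, (∀ a, ∀ v ∈ S.par a, β (G.indOne z ρ v) t = 0) → Fr.topCoeff h2 hρ t = 0) :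
    β.SeparatingLeft := by
  have hsup : ∀ {P : Submodule F (G.Ind z ρ)}, (∀ a, G.indPar z ρ S a ≤ P) → ∀ t, t ∈ P := by
    intro P hP t
    have ht : t ∈ (⊤ : Submodule F (G.Ind z ρ)) := trivial
    rw [← indPar_sup (S := S)] at ht
    exact (sup_le (hP 0) (hP 1)) ht
  -- By symmetry a homogeneous `t` in the left radical also lies in the right radical, hence so does
  -- every product of letters applied to `t`. All top coefficients of such products then vanish,
  -- which forces `t = 0`.
  have hom : ∀ a, ∀ t ∈ G.indPar z ρ S a, (∀ t', β t t' = 0) → t = 0 := by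
    intro a t ht h0
    by_contra hne
    obtain ⟨w, hw⟩ := Fr.exists_topCoeff_ne_zero h2 hρ hne
    refine hw (hone _ fun b v hv => ?_)
    have hker : ∀ t', β t' t = 0 := hsup (P := LinearMap.ker (β.flip t)) fun b t' ht' => by
      rw [LinearMap.mem_ker, LinearMap.flip_apply, hsymm b a t' ht' t ht, h0, mul_zero, mul_zero]
    obtain ⟨η, hη, hform⟩ := Fr.form_word hβ w.reverse
    have h := hform b _ (G.indOne_mem_indPar z ρ S hv) t
    rw [hker, List.reverse_reverse, eq_comm] at h
    refine (mul_eq_zero.1 ((mul_eq_zero.1 h).resolve_left ?_)).resolve_left (sgn_ne_zero F _ _)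
    rcases hη with rfl | rfl <;> simp
  intro t h0
  obtain ⟨t0, ht0, t1, ht1, rfl⟩ := Submodule.mem_sup.1
    (show t ∈ G.indPar z ρ S 0 ⊔ G.indPar z ρ S 1 by rw [indPar_sup]; trivial)
  -- The left radical is stable under the parity operator. As `2` is invertible, it contains the
  -- homogeneous components of its elements.
  have h1 : ∀ t', β (t0 - t1) t' = 0 := fun t' => by
    have h := hpar (t0 + t1) t'
    rw [h0, mul_zero, map_add, Fr.indParityOp_of_mem hρ ht0, Fr.indParityOp_of_mem hρ ht1] at h
    simpa [sub_eq_add_neg] using h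
  have e0 : t0 = 0 := hom 0 _ ht0 fun t' => by
    have a := h0 t'
    have b := h1 t'
    rw [map_add, LinearMap.add_apply] at a
    rw [map_sub, LinearMap.sub_apply] at b
    refine (mul_eq_zero.1 (?_ : 2 * β t0 t' = 0)).resolve_left h2
    linear_combination a + b
  have e1 : t1 = 0 := hom 1 _ ht1 fun t' => by
    have a := h0 t'
    rwa [e0, zero_add] at a
  rw [e0, e1, zero_add]

theorem indParityOp_pow_of_mem (hρ : G.IsGradedAction S ρ) (c : ZMod 2) {a : ZMod 2}
    {t : G.Ind z ρ} (ht : t ∈ G.indPar z ρ S a) :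
    (Fr.indParityOp hρ ^ c.val) t = sgn F c a • t := by
  rcases zmod_two_cases c with rfl | rfl
  · simp
  · simp [ZMod.val_one, Fr.indParityOp_of_mem hρ ht]

/-- A self-duality of `V` gives an invariant form on the induced module. -/
theorem exists_form_of_dual_iso (Fr : G.Frame z J) (h2 : (2 : F) ≠ 0)
    (M : Supermodule G.zeroPart V) (hρM : ρ = G.twistAct (G.extendAct M.act))
    (ζ : V ≃ₗ[F] Module.Dual F V)
    (hhom : IsSupermoduleHom G.zeroPart M.par M.act M.dualPar
        (dualAct G.zeroPart M.toSuperspace (G.restrictAct ρ)) (ζ : V →ₗ[F] Module.Dual F V))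
    (hsym : IsSuperSymm M.par (ζ : V →ₗ[F] Module.Dual F V) ∨
        IsSkewSuperSymm M.par (ζ : V →ₗ[F] Module.Dual F V)) :
    ∃ β : G.Ind z ρ →ₗ[F] G.Ind z ρ →ₗ[F] F, β.SeparatingLeft ∧
      IsHomogeneousForm (G.indPar z ρ M.toSuperspace) β ∧
      IsInvariantForm G.toLieSuperalgebra (G.indPar z ρ M.toSuperspace) (G.indAct z ρ) β ∧
      (IsSuperSymm (G.indPar z ρ M.toSuperspace) β ∨
        IsSkewSuperSymm (G.indPar z ρ M.toSuperspace) β) := by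
  have hρ : G.IsGradedAction M.toSuperspace ρ := by
    rw [hρM]; exact Fr.isGradedAction_twist M
  set δ : List J := Fr.top.sort (· ≤ ·) with hδ
  set D : ZMod 2 := (δ.map Fr.pa).sum with hD
  set π := Fr.topCoeff (z := z) h2 hρ with hπ
  have hπact : ∀ {a : ZMod 2} (x : G.nonneg), (x : L) ∈ G.par a → ∀ t,
      π (G.indAct z ρ x t) = sgn F a D • M.act (G.zeroProj x) (π t) := by
    subst hρM
    exact fun x hx t => Fr.topCoeff_indAct M h2 x.2 hx t
  have hπΓ : ∀ t, π (Fr.indParityOp hρ t) = sgn F 1 D • M.parityOp (π t) :=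
    Fr.topCoeff_indParityOp h2 hρ
  obtain ⟨c, hdual, hact⟩ := hhom
  have hK : ∀ {a b : ZMod 2} {x : G.nonneg}, (x : L) ∈ G.par a → ∀ {v}, v ∈ M.par b → ∀ w,
      ζ (ρ x v) w = -(sgn F a b * ζ v (M.act (G.zeroProj x) w)) := fun {a b x} hx {v} hv w =>
    Fr.apply_twistAct M hρM (ζ : V →ₗ[F] Module.Dual F V) hdual hact hx hv w
  -- The power of the parity operator is the sign `(-1)^{D d(v)}`. It compensates for the sign
  -- `(-1)^{D d(x)}` which arises when `x` in `K` passes the largest monomial.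
  let φ : V →ₗ[F] Module.Dual F (G.Ind z ρ) :=
    Module.Dual.transpose π ∘ₗ (ζ : V →ₗ[F] Module.Dual F V) ∘ₗ (M.parityOp ^ D.val)
  have hφ : ∀ {b v}, v ∈ M.par b → ∀ t, φ v t = sgn F D b * ζ v (π t) := fun {b v} hv t => by
    change ζ ((M.parityOp ^ D.val) v) (π t) = _
    rw [M.parityOp_pow_of_mem D hv, map_smul, LinearMap.smul_apply, smul_eq_mul]
  have hζΓ : ∀ {b v}, v ∈ M.par b → ∀ w, ζ v (M.parityOp w) = sgn F 1 (b + c) * ζ v w :=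
    fun hv w => M.apply_parityOp_of_mem_dualPar (hdual _ _ hv) w
  -- The form to be built has parity `c + D`, where `c` is the parity of `ζ`; this sign is the
  -- parameter `s` of the signed dual action.
  have hs : sgn F 1 (c + D) * sgn F 1 (c + D) = 1 := sgn_mul_self F 1 (c + D)
  have hφK : ∀ (x : G.nonneg) v, Fr.dualIndAct hρ (sgn F 1 (c + D)) x (φ v) = φ (ρ x v) := by
    intro x v
    refine nonneg_hom_induction (P := fun x : G.nonneg =>
      Fr.dualIndAct hρ (sgn F 1 (c + D)) x (φ v) = φ (ρ x v)) (fun x y hx hy => by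
        simp only [Submodule.coe_add, map_add, LinearMap.add_apply, hx, hy]) (fun a x hx => ?_) x
    refine M.hom_induction (P := fun v =>
      Fr.dualIndAct hρ (sgn F 1 (c + D)) x (φ v) = φ (ρ x v)) (fun v w hv hw => by
        simp only [map_add, hv, hw]) (fun b v hv => ?_) v
    refine LinearMap.ext fun t => ?_
    rw [hφ (hρ.mem a b x hx v hv), hK hx hv]
    rcases zmod_two_cases a with rfl | rfl
    · rw [Fr.dualIndAct_even hρ _ hx, hφ hv, hπact x hx]
      simp
    · rw [Fr.dualIndAct_odd hρ _ hx, hφ hv, hπΓ, map_smul, hζΓ hv, hπact x hx, map_smul]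
      simp only [smul_eq_mul, sgn_add_right, sgn_comm F D 1]
      have h : sgn F 1 D * sgn F 1 D * (sgn F 1 c * sgn F 1 c) = 1 := by
        rw [sgn_mul_self, sgn_mul_self, one_mul]
      linear_combination (-sgn F 1 D * sgn F D b * sgn F 1 b *
        ζ v (M.act (G.zeroProj x) (π t))) * h
  have hφpar : ∀ v t, φ (M.parityOp v) t = sgn F 1 (c + D) * φ v (Fr.indParityOp hρ t) := by
    intro v t
    refine M.hom_induction (P := fun v =>
      φ (M.parityOp v) t = sgn F 1 (c + D) * φ v (Fr.indParityOp hρ t)) (fun v w hv hw => by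
        simp only [map_add, LinearMap.add_apply, hv, hw, mul_add]) (fun b v hv => ?_) v
    rw [M.parityOp_of_mem hv, map_smul, LinearMap.smul_apply, hφ hv, hφ hv, hπΓ, map_smul, hζΓ hv]
    simp only [smul_eq_mul, sgn_add_right]
    have h : sgn F 1 D * sgn F 1 D * (sgn F 1 c * sgn F 1 c) = 1 := by
      rw [sgn_mul_self, sgn_mul_self, one_mul]
    linear_combination (-sgn F 1 b * sgn F D b * ζ v (π t)) * h
  set β := Fr.indForm hρ hs φ hφK with hβ
  have hinv := Fr.isInvariantForm_indForm hρ hs φ hφK hφpar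
  rw [isSuperSymm_or_isSkewSuperSymm_iff] at hsym
  obtain ⟨ε, hε, hsym⟩ := hsym
  obtain ⟨η, hη, hform⟩ := Fr.form_word hinv δ
  obtain ⟨κ, hκ, htopr⟩ := Fr.word_top_perm (z := z) h2 hρ (w := δ.reverse) (by simp [hδ])
  have hε' : ε * η * κ = 1 ∨ ε * η * κ = -1 := by
    rcases hε with rfl | rfl <;> rcases hη with rfl | rfl <;> rcases hκ with rfl | rfl <;> simp
  have hη2 : η * η = 1 := by rcases hη with rfl | rfl <;> simp
  have hκ2 : κ * κ = 1 := by rcases hκ with rfl | rfl <;> simp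
  have hbase : ∀ a, ∀ v ∈ M.par a, ∀ b, ∀ t ∈ G.indPar z ρ M.toSuperspace b,
      β (G.indOne z ρ v) t = ε * η * κ * (sgn F a b * β t (G.indOne z ρ v)) := by
    intro a v hv b t ht
    -- The sign `(-1)^{ab}` is written as a power of the parity operator, so that the identity is
    -- linear in `t` and can be checked on monomials.
    have h : LinearMap.eqLocus (β (G.indOne z ρ v))
        ((ε * η * κ) • (β.flip (G.indOne z ρ v) ∘ₗ (Fr.indParityOp hρ ^ a.val))) = ⊤ := by
      refine Fr.ind_induction_word h2 hρ _ fun s hs w => ?_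
      refine M.hom_induction (P := fun w => Fr.word z ρ s.sort (G.indOne z ρ w) ∈
        LinearMap.eqLocus (β (G.indOne z ρ v))
          ((ε * η * κ) • (β.flip (G.indOne z ρ v) ∘ₗ (Fr.indParityOp hρ ^ a.val))))
        (fun w w' hw hw' => by
          rw [map_add, map_add]; exact Submodule.add_mem _ hw hw') (fun b w hw => ?_) w
      have hw1 := G.indOne_mem_indPar z ρ M.toSuperspace hw
      rw [LinearMap.mem_eqLocus, LinearMap.smul_apply, LinearMap.comp_apply,
        Fr.indParityOp_pow_of_mem hρ a (Fr.word_mem_indPar _ hw1), map_smul,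
        LinearMap.flip_apply, hβ, indForm_one, hφ hv, Fr.topCoeff_sort h2 hρ hs]
      split_ifs with htop
      · subst htop
        rw [hform _ _ hw1, htopr, map_smul, indForm_one, hφ hw,
          Fr.topCoeff_top h2 hρ, ← hδ, ← hD, sgn_add_right]
        simp only [smul_eq_mul]
        have hsym' : ζ v w = ε * (sgn F a b * ζ w v) := hsym a b v hv w hw
        have h : η * η * (κ * κ) * (sgn F b D * sgn F b D) = 1 := by
          rw [hη2, hκ2, sgn_mul_self]; ring
        rw [sgn_comm F D a, sgn_comm F D b]
        linear_combination sgn F a D * hsym' - (ε * sgn F a D * sgn F a b * ζ w v) * h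
      -- For a monomial other than the largest one both sides vanish: the left side is its top
      -- coefficient, and on the right side the reversed word has no top coefficient either.
      · obtain ⟨η', -, hform'⟩ := Fr.form_word hinv s.sort
        rw [hform' _ _ hw1, indForm_one, hφ hw,
          Fr.topCoeff_word_eq_zero h2 hρ]
        · simp
        · simpa using Multiset.card_le_card hs
        · simpa using htop
    have ht' : t ∈ (⊤ : Submodule F (G.Ind z ρ)) := trivial
    rw [← h, LinearMap.mem_eqLocus, LinearMap.smul_apply, LinearMap.comp_apply,
      Fr.indParityOp_pow_of_mem hρ a ht, map_smul, LinearMap.flip_apply] at ht'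
    exact ht'
  have hsymm := form_symm_of_one hinv hbase
  refine ⟨β, ?_, Fr.isHomogeneousForm_indForm hρ hs φ hφK h2 hφpar rfl, hinv,
    isSuperSymm_or_isSkewSuperSymm_iff.2 ⟨_, hε', hsymm⟩⟩
  refine Fr.separatingLeft_of_one h2 hρ hinv hsymm
    (Fr.indForm_parityOp hρ hs φ hφK hφpar) fun t ht => ?_
  -- Surjectivity of `ζ` makes every functional on `V` one of the `ζ v`, and each of these is tested
  -- by `1 ⊗ v` up to sign.
  refine (Module.forall_dual_apply_eq_zero_iff F _).1 fun f => ?_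
  obtain ⟨v, rfl⟩ := ζ.surjective f
  refine M.hom_induction (P := fun v => ζ v (π t) = 0) (fun v v' hv hv' => by
    rw [map_add, LinearMap.add_apply, hv, hv', add_zero]) (fun a v hv => ?_) v
  have h := ht a v hv
  rw [indForm_one, hφ hv] at h
  exact (mul_eq_zero.1 h).resolve_left (sgn_ne_zero F D a)

end Frame

end ZGradedLieSuperalgebra
end SuperLie

/-! ### Existence of a homogeneous frame, and the equivalence. -/

namespace SuperLie
namespace ZGradedLieSuperalgebra

variable {F L : Type*} [Field F] [AddCommGroup L] [Module F L]
variable (G : ZGradedLieSuperalgebra F L)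

theorem span_homogeneous : ⊤ ≤ Submodule.span F {x : L | ∃ i a, x ∈ G.deg i ∧ x ∈ G.par a} := by
  rintro x -
  refine G.deg_induction (P := fun x => x ∈ Submodule.span F _)
    (fun x y hx hy => Submodule.add_mem _ hx hy) (Submodule.zero_mem _) (fun i x hx => ?_) x
  rw [← G.proj_add_proj x]
  exact Submodule.add_mem _
    (Submodule.subset_span ⟨i, 0, G.deg_proj i 0 x hx, G.proj_mem 0 x⟩)
    (Submodule.subset_span ⟨i, 1, G.deg_proj i 1 x hx, G.proj_mem 1 x⟩)

theorem lt_zero_of_mem_neg {i : ℤ} {x : L} (hx : x ∈ G.deg i) (hn : x ∈ G.neg) (h0 : x ≠ 0) :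
    i < 0 := by
  by_contra hi
  have h : G.neg ≤ LinearMap.ker (gradedProj G.deg_isInternal i) := iSup₂_le fun j hj y hy => by
    rw [LinearMap.mem_ker]
    exact Subtype.ext ((gradedProj_of_mem G.deg_isInternal i j y hy).trans
      (if_neg (by rintro rfl; exact hi hj)))
  have h1 := gradedProj_of_mem G.deg_isInternal i i x hx
  rw [if_pos rfl, LinearMap.mem_ker.1 (h hn)] at h1
  exact h0 h1.symm

/-- The basis of `L⁻ ∩ L_0̄` extends to a homogeneous basis of `L`. -/
theorem exists_frame [FiniteDimensional F L] (p : ℕ) [Fact p.Prime] [CharP F p] {k : ℕ}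
    (e : Module.Basis (Fin k) F (G.neg ⊓ G.par 0 : Submodule F L))
    (he : ∀ i, ∃ j : ℤ, (e i : L) ∈ G.deg j) (m : Fin k → ℕ)
    (hz : ∀ i, G.zElt p e m i ∈ Subalgebra.center F G.Env) :
    ∃ (J : Set L) (_ : LinearOrder J) (_ : Fintype J), Nonempty (G.Frame (G.zElt p e m) J) := by
  classical
  have hli : LinearIndependent F fun i => (e i : L) :=
    e.linearIndependent.map' (Submodule.subtype _) (Submodule.ker_subtype _)
  have hinj : Function.Injective fun i => (e i : L) := hli.injective
  have hs : LinearIndepOn F id (Set.range fun i => (e i : L)) := hli.linearIndepOn_id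
  have hst : (Set.range fun i => (e i : L)) ⊆ {x | ∃ i a, x ∈ G.deg i ∧ x ∈ G.par a} := by
    rintro x ⟨i, rfl⟩
    obtain ⟨j, hj⟩ := he i
    exact ⟨j, 0, hj, (e i).2.2⟩
  let J : Set L := hs.extend hst
  let b : Module.Basis J F L := Module.Basis.extendLe hs hst G.span_homogeneous
  have hb : ∀ j, b j = j := fun j => Module.Basis.extendLe_apply_self hs hst G.span_homogeneous j
  have hJ : ∀ j : J, ∃ i a, (j : L) ∈ G.deg i ∧ (j : L) ∈ G.par a := fun j =>
    hs.extend_subset hst j.2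
  choose d pa hd hpa using hJ
  have : Finite J := Module.Finite.finite_basis b
  let _ : Fintype J := Fintype.ofFinite J
  -- The letters are ordered by degree, with ties broken by an arbitrary numbering, so those of
  -- negative degree come first.
  let f : J → ℤ ×ₗ Fin (Fintype.card J) := fun j => toLex (d j, Fintype.equivFin J j)
  have hf : Function.Injective f := fun i j h =>
    (Fintype.equivFin J).injective (congrArg Prod.snd (toLex.injective h))
  let _ : LinearOrder J := LinearOrder.lift' f hf
  -- The default value `1` concerns letters outside the given basis, for which no exponent is used.
  let q : J → ℕ := fun j => if h : ∃ i, (e i : L) = j then p ^ m h.choose else 1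
  have hq : ∀ i (j : J), (e i : L) = j → q j = p ^ m i := fun i j hij => by
    have h : ∃ i, (e i : L) = j := ⟨i, hij⟩
    have : h.choose = i := hinj (h.choose_spec.trans hij.symm)
    simp only [q, dif_pos h, this]
  -- The even letters of negative degree are exactly the `e i`: another one would lie in the span of
  -- the `e i`, which are themselves members of the basis `b`.
  have hletter : ∀ j, d j < 0 → pa j = 0 → ∃ i, (e i : L) = j := by
    intro j hdj hpj
    by_contra hne
    have hmem : (j : L) ∈ (G.neg ⊓ G.par 0 : Submodule F L) :=
      ⟨le_iSup₂_of_le (f := fun (i : ℤ) (_ : i < 0) => G.deg i) (d j) hdj le_rfl (hd j),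
        hpj ▸ hpa j⟩
    refine b.linearIndependent.notMem_span_image (s := {j | ∃ i, (e i : L) = j}) hne ?_
    rw [hb, show (j : L) = Submodule.subtype _ (⟨j, hmem⟩ : (G.neg ⊓ G.par 0 : Submodule F L))
      from rfl, ← e.sum_repr ⟨j, hmem⟩, map_sum]
    refine Submodule.sum_mem _ fun i _ => ?_
    rw [map_smul]
    refine Submodule.smul_mem _ _ (Submodule.subset_span
      ⟨⟨e i, hs.subset_extend hst ⟨i, rfl⟩⟩, ⟨i, rfl⟩, hb _⟩)
  refine ⟨J, inferInstance, inferInstance, ⟨{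
    b := b
    pa := pa
    mem_par := fun j => by rw [hb]; exact hpa j
    d := d
    mem_deg := fun j => by rw [hb]; exact hd j
    lt_of_d_lt := fun i j h => Prod.Lex.toLex_lt_toLex.2 (Or.inl h)
    q := q
    q_pos := fun j h1 h2 => by
      obtain ⟨i, hi⟩ := hletter j h1 h2
      rw [hq i j hi]
      exact pow_pos (Fact.out : p.Prime).pos _
    q_cast := fun j h1 h2 => by
      obtain ⟨i, hi⟩ := hletter j h1 h2
      rw [hq i j hi]
      rcases Nat.eq_zero_or_pos (m i) with h | h
      · right; rw [h, pow_zero]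
      · left; rw [Nat.cast_pow, CharP.cast_eq_zero, zero_pow h.ne']
    exists_z := fun j h1 h2 => by
      obtain ⟨i, hi⟩ := hletter j h1 h2
      exact ⟨i, by rw [hq i j hi, hb, ← hi]; rfl⟩
    exists_letter := fun i => by
      let j : J := ⟨e i, hs.subset_extend hst ⟨i, rfl⟩⟩
      have h0 : (e i : L) ≠ 0 := hli.ne_zero i
      refine ⟨j, G.lt_zero_of_mem_neg (hd j) (e i).2.1 h0, ?_, ?_⟩
      · by_contra hne
        have h1 := G.proj_of_mem 0 _ _ (hpa j)
        rw [G.proj_of_mem 0 0 _ (e i).2.2, if_pos rfl, if_neg hne] at h1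
        exact h0 h1
      · rw [hq i j rfl, hb]; rfl
    central := fun j h1 h2 => by
      obtain ⟨i, hi⟩ := hletter j h1 h2
      rw [hq i j hi, hb, ← hi]
      exact hz i }⟩⟩

end ZGradedLieSuperalgebra
end SuperLie

theorem mainTheorem2 {F L V : Type*} [Field F] (p : ℕ) [Fact p.Prime] [CharP F p] (hp : p ≠ 2)
    [AddCommGroup L] [Module F L] [FiniteDimensional F L]
    [AddCommGroup V] [Module F V] [FiniteDimensional F V]
    (G : SuperLie.ZGradedLieSuperalgebra F L) (M : SuperLie.Supermodule G.zeroPart V)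
    {k : ℕ} (e : Module.Basis (Fin k) F (G.neg ⊓ G.par 0 : Submodule F L))
    (he : ∀ i, ∃ j : ℤ, (e i : L) ∈ G.deg j)
    (m : Fin k → ℕ) (hz : ∀ i, G.zElt p e m i ∈ Subalgebra.center F G.Env) :
    (∃ β : G.Ind (G.zElt p e m) (G.twistAct (G.extendAct M.act)) →ₗ[F]
          G.Ind (G.zElt p e m) (G.twistAct (G.extendAct M.act)) →ₗ[F] F,
        β.SeparatingLeft ∧
        SuperLie.IsHomogeneousForm (G.indPar _ _ M.toSuperspace) β ∧
        SuperLie.IsInvariantForm G.toLieSuperalgebra (G.indPar _ _ M.toSuperspace)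
          (G.indAct _ _) β ∧
        (SuperLie.IsSuperSymm (G.indPar _ _ M.toSuperspace) β ∨
          SuperLie.IsSkewSuperSymm (G.indPar _ _ M.toSuperspace) β)) ↔
    (∃ ζ : V ≃ₗ[F] Module.Dual F V,
        SuperLie.IsSupermoduleHom G.zeroPart M.par M.act M.dualPar
          (SuperLie.dualAct G.zeroPart M.toSuperspace
            (G.restrictAct (G.twistAct (G.extendAct M.act))))
          (ζ : V →ₗ[F] Module.Dual F V) ∧
        (SuperLie.IsSuperSymm M.par (ζ : V →ₗ[F] Module.Dual F V) ∨
          SuperLie.IsSkewSuperSymm M.par (ζ : V →ₗ[F] Module.Dual F V))) := by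
  have h2 : (2 : F) ≠ 0 := Ring.two_ne_zero (by rwa [ringChar.eq F p])
  obtain ⟨J, _, _, ⟨Fr⟩⟩ := G.exists_frame p e he m hz
  constructor
  · rintro ⟨β, hsep, hhom, hinv, hsym⟩
    exact Fr.exists_dual_iso_of_form h2 M rfl β hsep hhom hinv hsym
  · rintro ⟨ζ, hhom, hsym⟩
    exact Fr.exists_form_of_dual_iso h2 M rfl ζ hhom hsym
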